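/- **Proposition (Reduction).** Let the endogenous variables be $\mathbf V=\{V_0,V_1,V_2,\dots\}$, where each $V_n$ has a finite range $\mathrm{Val}(V_n)$ with at least two elements, and fix a (finite or countable) set $OP$ of finitary operations on $\mathbb R$, each given a name. Let $\mathcal L_{\mathrm{prop}}$ be the language generated by $V=v\mid\neg\beta\mid\beta\wedge\beta'$ (with $V\in\mathbf V$, $v\in \mathrm{Val}(V)$), and let $\mathcal L_{\mathrm{full}}$ be generated by $[\alpha]\beta\mid\neg\epsilon\mid\epsilon\wedge\epsilon'$, where $\beta\in\mathcal L_{\mathrm{prop}}$ and $\alpha$ is built from $\top$ and assignments $V=v$ by conjunction and sets no variable to two different values. For $\mathcal L\in\{\mathcal L_{\mathrm{prop}},\mathcal L_{\mathrm{full}}\}$, terms are generated from the probability terms $\mathbf P(\epsilon)$, $\epsilon\in\mathcal L$, by the operations in $OP$, and formulas are generated by $\mathbf t_1\ge\mathbf t_2\mid\neg\varphi\mid\varphi\wedge\psi$. This gives $\mathcal L_{\mathrm{prob}}$ (for $\mathcal L_{\mathrm{prop}}$) and $\mathcal L_{\mathrm{causal}}$ (for $\mathcal L_{\mathrm{full}}$).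 A structural causal model (SCM) consists of exogenous variables with finite ranges, a probability measure on a $\sigma$-algebra on the set of exogenous assignments $\mathbf u$, and, for each $V\in\mathbf V$, a function $f_V$ giving the value of $V$ from $\mathbf u$ and the values of the endogenous variables. It is recursive if for some well-order $\prec$ on $\mathbf V$ each $f_V$ depends, besides $\mathbf u$, only on the variables $V'\prec V$. It is measurable if, under every finite intervention (which replaces finitely many of the $f_V$ by constants), the induced values of the endogenous variables are measurable functions of $\mathbf u$. The formula $[\alpha]\beta$ holds at $\mathbf u$ if $\beta$ holds under the endogenous values determined by $\mathbf u$ after the intervention $\alpha$, a formula of $\mathcal L_{\mathrm{prop}}$ is evaluated without intervention, and $\mathbf P(\epsilon)$ denotes the probability of $\{\mathbf u:\epsilon\text{ holds at }\mathbf u\}$. A formula is satisfiable if it is true in some recursive and measurable SCM over $\mathbf V$. Let $\mathsf{SAT}_{\mathcal L_{\mathrm{causal}}}$ and $\mathsf{SAT}_{\mathcal L_{\mathrm{prob}}}$ be the two satisfiability problems, formulas being written as strings over a finite alphabet with variable indices, values and names of operations in binary. Then there is a many-one $\mathsf{NP}$-reduction from $\mathsf{SAT}_{\mathcal L_{\mathrm{causal}}}$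 to $\mathsf{SAT}_{\mathcal L_{\mathrm{prob}}}$: a nondeterministic Turing machine and a polynomial $p$ such that, for every input $\varphi\in\mathcal L_{\mathrm{causal}}$, every computation halts within $p(|\varphi|)$ steps and outputs a formula of $\mathcal L_{\mathrm{prob}}$, and $\varphi$ is satisfiable if and only if some computation outputs a satisfiable formula. -/

import Mathlib

open MeasureTheory

namespace CausalLogic

/-! ## Variables and the deterministic languages -/

/-- A signature: the endogenous variables are `V₀, V₁, V₂, …` (identified with their indices), and
`Val(Vₙ)` is a finite set with `card n ≥ 2` elements, namely `{0, …, card n - 1}`. -/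
structure Signature where
  card : ℕ → ℕ
  two_le_card : ∀ n, 2 ≤ card n

/-- The range of the `n`-th endogenous variable. -/
abbrev Signature.Val (S : Signature) (n : ℕ) : Type := Fin (S.card n)

/-- A joint assignment of values to all endogenous variables. -/
abbrev Assignment (S : Signature) : Type := ∀ n, S.Val n

instance (S : Signature) (n : ℕ) : Nonempty (S.Val n) :=
  ⟨⟨0, lt_of_lt_of_le Nat.zero_lt_two (S.two_le_card n)⟩⟩

/-- The language of interventions: `⊤ | V = v | α ∧ α`. -/
inductive LInt (S : Signature) : Type
  | top : LInt S
  | eq (n : ℕ) (v : S.Val n) : LInt S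
  | and (α β : LInt S) : LInt S

/-- The propositional language: `V = v | ¬ β | β ∧ β`. -/
inductive LProp (S : Signature) : Type
  | eq (n : ℕ) (v : S.Val n) : LProp S
  | neg (β : LProp S) : LProp S
  | and (β γ : LProp S) : LProp S

/-- The set of assignments `V = v` that occur as conjuncts. -/
def LInt.conjuncts {S : Signature} : LInt S → Set (Σ n, S.Val n)
  | .top => ∅
  | .eq n v => {⟨n, v⟩}
  | .and α β => α.conjuncts ∪ β.conjuncts

/-- `α` describes a partial function: no variable is set to two different values. -/
def LInt.Consistent {S : Signature} (α : LInt S) : Prop :=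
  ∀ n (v w : S.Val n), ⟨n, v⟩ ∈ α.conjuncts → ⟨n, w⟩ ∈ α.conjuncts → v = w

/-- The causal conditional language: `[α] β | ¬ ε | ε ∧ ε`, where `α` is (a description of) an
intervention and `β` is propositional. -/
inductive LFull (S : Signature) : Type
  | box (α : LInt S) (hα : α.Consistent) (β : LProp S) : LFull S
  | neg (ε : LFull S) : LFull S
  | and (ε ζ : LFull S) : LFull S

/-! ## Terms and formulas over a set of operations -/

/-- A finitary operation on `ℝ`, together with its arity. -/
abbrev Operation : Type := Σ n : ℕ, ((Fin n → ℝ) → ℝ)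

/-- `OP({P(ε) : ε ∈ B})`: the terms generated from the probability terms `P(ε)`, with `ε` in the
base language `B`, by applying the operations in `OP`. -/
inductive Term (OP : Set Operation) (B : Type) : Type
  | prob (ε : B) : Term OP B
  | app (f : OP) (args : Fin f.1.1 → Term OP B) : Term OP B

/-- The formulas `t₁ ≥ t₂ | ¬ φ | φ ∧ φ`. -/
inductive Formula (OP : Set Operation) (B : Type) : Type
  | ge (t₁ t₂ : Term OP B) : Formula OP B
  | neg (φ : Formula OP B) : Formula OP B
  | and (φ ψ : Formula OP B) : Formula OP B

/-- The purely probabilistic language over `OP`. -/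
abbrev LProb (S : Signature) (OP : Set Operation) : Type := Formula OP (LProp S)

/-- The causal language over `OP`. -/
abbrev LCausal (S : Signature) (OP : Set Operation) : Type := Formula OP (LFull S)

/-! ## Structural causal models -/

/-- A structural causal model over the signature `S`. That `f_V` only looks at the variables other
than `V` itself is part of `SCM.IsRecursive`. -/
structure SCM (S : Signature) where
  /-- the set of exogenous variables -/
  Exo : Type
  /-- their ranges -/
  ExoVal : Exo → Type
  finite_exoVal : ∀ U, Finite (ExoVal U)
  /-- the structural functions `f_V` -/
  F : ∀ n : ℕ, Assignment S → (∀ U, ExoVal U) → S.Val n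
  /-- the σ-algebra on the exogenous assignments -/
  sigma : MeasurableSpace (∀ U, ExoVal U)
  /-- the probability measure on the exogenous assignments -/
  P : @Measure (∀ U, ExoVal U) sigma
  isProbabilityMeasure : @IsProbabilityMeasure (∀ U, ExoVal U) sigma P

/-- An intervention: a partial function sending variables to values. -/
abbrev Intervention (S : Signature) : Type := ∀ n, Option (S.Val n)

open scoped Classical in
/-- The intervention that effects the assignments described by `α`. -/
noncomputable def LInt.toIntervention {S : Signature} (α : LInt S) : Intervention S :=
  fun n => if h : ∃ v : S.Val n, ⟨n, v⟩ ∈ α.conjuncts then some h.choose else none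

namespace SCM

variable {S : Signature}

/-- An assignment of values to the exogenous variables. -/
abbrev ExoAssignment (M : SCM S) : Type := ∀ U, M.ExoVal U

/-- `M` is recursive: its structural functions respect some well-order on the variables. -/
def IsRecursive (M : SCM S) : Prop :=
  ∃ r : ℕ → ℕ → Prop, IsWellOrder ℕ r ∧
    ∀ (n : ℕ) (v₁ v₂ : Assignment S) (u : M.ExoAssignment),
      (∀ m, r m n → v₁ m = v₂ m) → M.F n v₁ u = M.F n v₂ u

/-- The intervened equations `i(F)`: the function of each variable in the domain of `i` is
replaced by a constant. -/
def intervene (M : SCM S) (i : Intervention S) (n : ℕ) (v : Assignment S)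
    (u : M.ExoAssignment) : S.Val n :=
  (i n).getD (M.F n v u)

/-- `v` solves the equations `i(F)` under the exogenous assignment `u`. -/
def IsSolution (M : SCM S) (i : Intervention S) (u : M.ExoAssignment) (v : Assignment S) : Prop :=
  ∀ n, v n = M.intervene i n v u

/-- In a recursive model the equations `i(F)` determine the values of all variables. -/
theorem IsRecursive.existsUnique_solution {M : SCM S} (h : M.IsRecursive) (i : Intervention S)
    (u : M.ExoAssignment) : ∃! v, M.IsSolution i u v := by
  classical
  obtain ⟨r, hr, hF⟩ := h
  have wf : WellFounded r := hr.toIsWellFounded.wf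
  let g : ∀ n, (∀ m, r m n → S.Val m) → S.Val n := fun n rec =>
    M.intervene i n
      (fun m => if h : r m n then rec m h else Classical.choice inferInstance) u
  have key : ∀ (n : ℕ) (v₁ v₂ : Assignment S), (∀ m, r m n → v₁ m = v₂ m) →
      M.intervene i n v₁ u = M.intervene i n v₂ u := by
    intro n v₁ v₂ hv
    unfold intervene
    rw [hF n v₁ v₂ u hv]
  refine ⟨wf.fix g, ?_, ?_⟩
  · intro n
    rw [wf.fix_eq]
    refine key n _ _ fun m hm => ?_
    simp only [hm, dite_true]
  · intro w hw
    funext n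
    induction n using wf.induction with
    | _ n ih =>
      rw [hw n, wf.fix_eq]
      refine key n _ _ fun m hm => ?_
      simp only [hm, dite_true]
      exact ih m hm

/-- The values of the endogenous variables determined by `i(F)` and `u` (for recursive `M`, the
unique solution of the equations). -/
noncomputable def solution (M : SCM S) (i : Intervention S) (u : M.ExoAssignment) : Assignment S :=
  Classical.epsilon (M.IsSolution i u)

/-- `M` is measurable: under every finite intervention, the joint distribution of the endogenous
variables is well-defined. -/
def IsMeasurable (M : SCM S) : Prop :=
  ∀ i : Intervention S, {n | (i n).isSome}.Finite →
    @Measurable _ _ M.sigma MeasurableSpace.pi (M.solution i)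

end SCM

/-! ## Truth definitions -/

section Semantics

variable {S : Signature} {OP : Set Operation} {B : Type}

/-- Truth of a propositional formula under an assignment. -/
def LProp.Holds (s : Assignment S) : LProp S → Prop
  | .eq n v => s n = v
  | .neg β => ¬ β.Holds s
  | .and β γ => β.Holds s ∧ γ.Holds s

/-- `F, u ⊨ β` for propositional `β`. -/
def SCM.ModelsProp (M : SCM S) (u : M.ExoAssignment) (β : LProp S) : Prop :=
  β.Holds (M.solution (fun _ => none) u)

/-- `F, u ⊨ ε` for causal `ε`. -/
def SCM.ModelsFull (M : SCM S) (u : M.ExoAssignment) : LFull S → Prop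
  | .box α _ β => β.Holds (M.solution α.toIntervention u)
  | .neg ε => ¬ M.ModelsFull u ε
  | .and ε ζ => M.ModelsFull u ε ∧ M.ModelsFull u ζ

/-- The value of a term, given the values `p ε` of the probability terms `P(ε)`. -/
def Term.value (p : B → ℝ) : Term OP B → ℝ
  | .prob ε => p ε
  | .app f args => f.1.2 fun i => (args i).value p

/-- The truth of a formula, given the values `p ε` of the probability terms `P(ε)`. -/
def Formula.Holds (p : B → ℝ) : Formula OP B → Prop
  | .ge t₁ t₂ => t₁.value p ≥ t₂.value p
  | .neg φ => ¬ φ.Holds p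
  | .and φ ψ => φ.Holds p ∧ ψ.Holds p

/-- `φ` is satisfiable: it is true in some recursive measurable model. -/
def SATProb (φ : LProb S OP) : Prop :=
  ∃ M : SCM S, M.IsRecursive ∧ M.IsMeasurable ∧
    φ.Holds fun ε => (M.P {u | M.ModelsProp u ε}).toReal

/-- `φ` is satisfiable: it is true in some recursive measurable model. -/
def SATCausal (φ : LCausal S OP) : Prop :=
  ∃ M : SCM S, M.IsRecursive ∧ M.IsMeasurable ∧
    φ.Holds fun ε => (M.P {u | M.ModelsFull u ε}).toReal

end Semantics

/-! ## Formulas as strings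

Formulas are written in prefix notation over a finite alphabet; variables, values and operations
are named by natural numbers in binary notation. -/

/-- The alphabet. -/
inductive Sym : Type
  | bit (b : Bool)
  | var
  | eq
  | top
  | neg
  | and
  | box
  | prob
  | lpar
  | rpar
  | ge
  deriving DecidableEq, Fintype

/-- Binary notation, least significant digit first. -/
def natCode (n : ℕ) : List Sym := n.bits.map Sym.bit

section Codes

variable {S : Signature} {OP : Set Operation} {B : Type}

def eqCode (n v : ℕ) : List Sym := Sym.var :: natCode n ++ Sym.eq :: natCode v

def LInt.code : LInt S → List Sym
  | .top => [Sym.top]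
  | .eq n v => eqCode n v
  | .and α β => Sym.and :: (α.code ++ β.code)

def LProp.code : LProp S → List Sym
  | .eq n v => eqCode n v
  | .neg β => Sym.neg :: β.code
  | .and β γ => Sym.and :: (β.code ++ γ.code)

def LFull.code : LFull S → List Sym
  | .box α _ β => Sym.box :: (α.code ++ β.code)
  | .neg ε => Sym.neg :: ε.code
  | .and ε ζ => Sym.and :: (ε.code ++ ζ.code)

def Term.code [Encodable OP] (c : B → List Sym) : Term OP B → List Sym
  | .prob ε => Sym.prob :: c ε
  | .app f args =>
      Sym.lpar :: natCode (Encodable.encode f) ++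
        (List.ofFn fun i => (args i).code c).flatten ++ [Sym.rpar]

def Formula.code [Encodable OP] (c : B → List Sym) : Formula OP B → List Sym
  | .ge t₁ t₂ => Sym.ge :: (t₁.code c ++ t₂.code c)
  | .neg φ => Sym.neg :: φ.code c
  | .and φ ψ => Sym.and :: (φ.code c ++ ψ.code c)

/-- The string that represents a formula of the probabilistic language. -/
def LProb.code [Encodable OP] (φ : LProb S OP) : List Sym := Formula.code LProp.code φ

/-- The string that represents a formula of the causal language. -/
def LCausal.code [Encodable OP] (φ : LCausal S OP) : List Sym := Formula.code LFull.code φ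

end Codes

/-! ## Nondeterministic Turing machines and NP-reductions -/

/-- A nondeterministic Turing machine with finitely many stacks (half-tapes), finitely many labels
and internal states, and a finite stack alphabet `Γ` that contains the input and output alphabet
`A`. It has two programs, each of the kind of `Turing.TM2`; in every step it chooses one of the two
and executes the statement that this program has at the current label. -/
structure NTM (A : Type) where
  K : Type
  Γ : Type
  Λ : Type
  σ : Type
  decidableEqK : DecidableEq K
  finite_K : Finite K
  finite_Γ : Finite Γ
  finite_Λ : Finite Λ
  finite_σ : Finite σ
  letter : A ↪ Γ
  inputStack : K
  outputStack : K
  start : Λ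
  initialState : σ
  program : Bool → Λ → Turing.TM2.Stmt (fun _ : K => Γ) Λ σ

namespace NTM

variable {A : Type}

instance (N : NTM A) : DecidableEq N.K := N.decidableEqK

abbrev Cfg (N : NTM A) : Type := Turing.TM2.Cfg (fun _ : N.K => N.Γ) N.Λ N.σ

/-- The initial configuration: the input is on the input stack, all other stacks are empty. -/
def initial (N : NTM A) (w : List A) : N.Cfg where
  l := some N.start
  var := N.initialState
  stk := Function.update (fun _ => []) N.inputStack (w.map N.letter)

/-- One step, when `b` is the nondeterministic choice; a halted machine does not move. -/
def next (N : NTM A) (c : N.Cfg) (b : Bool) : N.Cfg :=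
  (Turing.TM2.step (N.program b) c).getD c

/-- The configuration on input `w` after `bs.length` steps with the choices `bs`. -/
def run (N : NTM A) (w : List A) (bs : List Bool) : N.Cfg := bs.foldl N.next (N.initial w)

/-- Every computation on input `w` halts within `t` steps. -/
def HaltsWithin (N : NTM A) (w : List A) (t : ℕ) : Prop :=
  ∀ bs : List Bool, bs.length = t → (N.run w bs).l = none

/-- Some computation on input `w` halts with output `y`. -/
def Outputs (N : NTM A) (w y : List A) : Prop :=
  ∃ bs : List Bool, (N.run w bs).l = none ∧ (N.run w bs).stk N.outputStack = y.map N.letter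

end NTM

/-- There is a many-one NP-reduction from the problem `P` on `X` to the problem `Q` on `Y`
(instances being represented by strings): a nondeterministic Turing machine all of whose
computations halt within polynomially many steps and output an instance of `Q`, such that `x` is a
yes-instance of `P` if and only if some computation on input `x` outputs a yes-instance of `Q`. -/
def NPReducible {A X Y : Type} (codeX : X → List A) (P : X → Prop)
    (codeY : Y → List A) (Q : Y → Prop) : Prop :=
  ∃ (N : NTM A) (p : Polynomial ℕ), ∀ x : X,
    N.HaltsWithin (codeX x) (p.eval (codeX x).length) ∧
    (∀ bs : List Bool, (N.run (codeX x) bs).l = none →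
      ∃ y : Y, (N.run (codeX x) bs).stk N.outputStack = (codeY y).map N.letter) ∧
    (P x ↔ ∃ y : Y, N.Outputs (codeX x) (codeY y) ∧ Q y)

end CausalLogic

/-!
The reduction is deterministic. A causal formula `φ` mentions finitely many assignments `V = v` and
finitely many interventions `α`. Introduce fresh binary endogenous variables, used as propositional
variables, for the statements "`V = v` under `α`" (`LProp.world`) and "`V` precedes `V'`"
(`LProp.order`), and replace every `[α] β` in `φ` by the formula that results from `β` when each
`V = v` becomes the variable for "`V = v` under `α`" (`LFull.toProp`). The reduced formula `reduct`
is the conjunction of this translation with two statements about probabilities: each order variable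
is almost surely true or almost surely false, and almost surely the propositional variables satisfy
`consistency`. The latter says that precedence is a strict order, that interventions set the
variables that they should set and give no variable two values, and that if neither `α` nor `α'`
sets `V` and the predecessors of `V` have the same mentioned values under both, then so does `V`
(`Describes`). An event has probability one if and only if its probability is at least that of a
tautology, so no arithmetical operation is needed to say this, and `OP` may be arbitrary.

A variable may have values that are not mentioned in `φ`. At most one of them matters
(`otherValue`), and whether there is one is expressed by the variable itself: in `consistency`, if
its actual value is mentioned, then one of the mentioned values is taken under every `α`. When the
formula is satisfied by a model coming from a causal model, the actual value is chosen to be one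
that is not mentioned, unless all of them are mentioned.

*From the reduced to the causal formula* (`satCausal_of_satProb_reduct`). The order variables are
almost surely constant, so they define one partial order on the mentioned variables, which extends
to a well-order of all variables (`exists_isWellOrder`). The structural function of `V` looks for a
mentioned intervention that does not set `V` and gives the predecessors of `V` the values that they
have, and returns the value of `V` under it (`structural`); by consistency the choice does not
matter. By induction along the well-order the solution under each mentioned `α` is the one that the
propositional variables describe (`Describes.solution_eq`).

*From the causal to the reduced formula* (`satProb_reduct_of_satCausal`). The only statement that
is not immediate is the last one of `consistency`. If two solutions differ at a predecessor of `V`,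
consider the first one where they differ. It is set by one of the two interventions, so one of its
values is mentioned and tells the solutions apart
(`SCM.IsRecursive.solution_eq_of_forall_atoms`).

*The Turing machine.* The reduced formula consists of clauses that are indexed by tuples of
occurrences of assignments and interventions in `φ`, and it is written by nested loops over the
input. Such loops form a small language `LoopProg`, in which pointers run over suffixes of the input
and every program terminates in polynomial time; `LoopProg.reachesIn` shows that its programs are
executed by machines with one stack for each pointer. What loops cannot recognize is the end of `α`
in `[α] β`, so the machine first inserts a separator there by counting (`mark`). The program
`Prog.reduct` writes the reduced formula (`Prog.writes_reduct`); a fresh variable has as its index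
a run of zeros as long as the input, followed by an encoding of the statement for which it stands
(`freshIndex`).
-/

namespace CausalLogic

/-! ### Loop programs -/

section LoopPrograms

/-- A program of a small functional language that reads a string and writes a string. A pointer
`x : V` stands for a suffix of the string that is read; pointers are bound by `loop` and are never
assigned otherwise. -/
inductive LoopProg (V Γ : Type) : Type
  /-- do nothing -/
  | skip
  /-- write one letter, determined by the letter that `x` points at -/
  | emit (x : V) (f : Option Γ → Γ)
  /-- do one after the other -/
  | seq (a b : LoopProg V Γ)
  /-- branch on the letter that `x` points at -/
  | ite (x : V) (p : Option Γ → Bool) (a b : LoopProg V Γ)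
  /-- branch on whether `x` and `y` point at the same letter, followed by the same word over `p` -/
  | iteEq (x y : V) (p : Γ → Bool) (a b : LoopProg V Γ)
  /-- let `x` run over the positions after `y`, up to the first letter outside `p` -/
  | loop (x y : V) (p : Γ → Bool) (a : LoopProg V Γ)

/-- Concatenate the values of `f` at the nonempty suffixes of a list, up to the first letter
outside `p`. -/
def suffixFlatMap {Γ Γ' : Type} (p : Γ → Bool) (f : List Γ → List Γ') : List Γ → List Γ'
  | [] => []
  | a :: l => if p a then f (a :: l) ++ suffixFlatMap p f l else []

/-- Two words begin with the same letter and, after it, have the same longest prefix over `p`. -/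
def SameWord {Γ : Type} (p : Γ → Bool) (l₁ l₂ : List Γ) : Prop :=
  l₁.head? = l₂.head? ∧ l₁.tail.takeWhile p = l₂.tail.takeWhile p

namespace LoopProg

variable {V Γ : Type} [DecidableEq V]

open scoped Classical in
/-- The word that a program writes, depending on the pointers. -/
noncomputable def eval : LoopProg V Γ → (V → List Γ) → List Γ
  | skip, _ => []
  | emit x f, e => [f (e x).head?]
  | seq a b, e => a.eval e ++ b.eval e
  | ite x p a b, e => if p (e x).head? then a.eval e else b.eval e
  | iteEq x y p a b, e => if SameWord p (e x) (e y) then a.eval e else b.eval e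
  | loop x y p a, e => suffixFlatMap p (fun l => a.eval (Function.update e x l)) (e y).tail

/-- `c` is well formed if the pointers in `S` are bound: no pointer is bound twice. -/
def WellFormed : LoopProg V Γ → Finset V → Prop
  | skip, _ => True
  | emit _ _, _ => True
  | seq a b, S => a.WellFormed S ∧ b.WellFormed S
  | ite _ _ a b, S => a.WellFormed S ∧ b.WellFormed S
  | iteEq x y _ a b, S => x ≠ y ∧ a.WellFormed S ∧ b.WellFormed S
  | loop x y _ a, S => x ∉ S ∧ y ∈ S ∧ a.WellFormed (insert x S)

/-- A bound for the running time in terms of the length of the words that are pointed at. -/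
noncomputable def cost : LoopProg V Γ → Polynomial ℕ
  | skip => 1
  | emit _ _ => 1
  | seq a b => a.cost + b.cost
  | ite _ _ a b => 1 + a.cost + b.cost
  | iteEq _ _ _ a b => (2 * Polynomial.X + 2) + a.cost + b.cost
  | loop _ _ _ a => (4 * Polynomial.X + 6) + Polynomial.X * (a.cost + 2)

end LoopProg

end LoopPrograms

/-! ### Compilation of loop programs -/

/-- The stacks of the compiled machine: one for each pointer, one for the input and the final
output, an auxiliary one, and one on which the output is written in reverse. -/
inductive Stack (V : Type) : Type
  | ptr (x : V)
  | inp
  | tmp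
  | out
  deriving DecidableEq

instance {V : Type} [Finite V] : Finite (Stack V) :=
  Finite.of_injective
    (fun k : Stack V => (match k with
      | .ptr x => Sum.inl x | .inp => Sum.inr 0 | .tmp => Sum.inr 1 | .out => Sum.inr 2 :
        V ⊕ Fin 3))
    (by intro a b; cases a <;> cases b <;> simp)

/-- The internal states: two letters and a flag. -/
abbrev Mem (Γ : Type) : Type := Option Γ × Option Γ × Bool

/-- The labels of a comparison. -/
inductive EqLabel : Type
  | first | more | restore

instance : Finite EqLabel :=
  Finite.of_injective
    (fun q : EqLabel => match q with | .first => (0 : Fin 3) | .more => 1 | .restore => 2)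
    (by intro a b; cases a <;> cases b <;> simp)

/-- The labels of a loop. -/
inductive LoopLabel : Type
  | unload | reload | advance | test | clear

instance : Finite LoopLabel :=
  Finite.of_injective
    (fun q : LoopLabel => match q with
      | .unload => (0 : Fin 5) | .reload => 1 | .advance => 2 | .test => 3 | .clear => 4)
    (by intro a b; cases a <;> cases b <;> simp)

section Compile

variable {V Γ Λ : Type}

/-- The contents of the stacks. -/
def contents (e : V → List Γ) (i t o : List Γ) : Stack V → List Γ
  | .ptr x => e x
  | .inp => i
  | .tmp => t
  | .out => o

variable (e : V → List Γ) (i t o l : List Γ)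

@[simp] theorem contents_ptr (x : V) : contents e i t o (.ptr x) = e x := rfl
@[simp] theorem contents_inp : contents e i t o .inp = i := rfl
@[simp] theorem contents_tmp : contents e i t o .tmp = t := rfl
@[simp] theorem contents_out : contents e i t o .out = o := rfl

variable [DecidableEq V]

@[simp] theorem update_contents_ptr (x : V) : Function.update (contents e i t o) (.ptr x) l =
    contents (Function.update e x l) i t o := by
  funext k; cases k <;> simp [Function.update_apply]

@[simp] theorem update_contents_inp : Function.update (contents e i t o) .inp l =
    contents e l t o := by
  funext k; cases k <;> simp

@[simp] theorem update_contents_tmp : Function.update (contents e i t o) .tmp l =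
    contents e i l o := by
  funext k; cases k <;> simp

@[simp] theorem update_contents_out : Function.update (contents e i t o) .out l =
    contents e i t l := by
  funext k; cases k <;> simp

/-- Statements of the compiled machine. -/
abbrev Code (V Γ Λ : Type) : Type := Turing.TM2.Stmt (fun _ : Stack V => Γ) Λ (Mem Γ)

/-- Configurations of the compiled machine. -/
abbrev Conf (V Γ Λ : Type) : Type := Turing.TM2.Cfg (fun _ : Stack V => Γ) Λ (Mem Γ)

/-- A step of a deterministic machine; a halted machine does not move. -/
def stepOrStay (M : Λ → Code V Γ Λ) (c : Conf V Γ Λ) : Conf V Γ Λ :=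
  (Turing.TM2.step M c).getD c

@[simp] theorem stepOrStay_some (M : Λ → Code V Γ Λ) (q : Λ) (m : Mem Γ)
    (s : Stack V → List Γ) :
    stepOrStay M ⟨some q, m, s⟩ = Turing.TM2.stepAux (M q) m s := rfl

/-- The machine `M` gets from `c` to `c'` in at most `n` steps. -/
def ReachesIn (M : Λ → Code V Γ Λ) (n : ℕ) (c c' : Conf V Γ Λ) : Prop :=
  ∃ k ≤ n, (stepOrStay M)^[k] c = c'

theorem ReachesIn.refl (M : Λ → Code V Γ Λ) (n : ℕ) (c : Conf V Γ Λ) : ReachesIn M n c c :=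
  ⟨0, Nat.zero_le _, rfl⟩

theorem ReachesIn.trans {M : Λ → Code V Γ Λ} {m n : ℕ} {c c' c'' : Conf V Γ Λ}
    (h : ReachesIn M m c c') (h' : ReachesIn M n c' c'') : ReachesIn M (m + n) c c'' := by
  obtain ⟨j, hj, rfl⟩ := h
  obtain ⟨k, hk, rfl⟩ := h'
  exact ⟨k + j, by omega, Function.iterate_add_apply _ _ _ _⟩

theorem ReachesIn.mono {M : Λ → Code V Γ Λ} {m n : ℕ} {c c' : Conf V Γ Λ}
    (h : ReachesIn M m c c') (hmn : m ≤ n) : ReachesIn M n c c' :=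
  let ⟨k, hk, h⟩ := h
  ⟨k, hk.trans hmn, h⟩

theorem ReachesIn.step {M : Λ → Code V Γ Λ} {n : ℕ} {c c' c'' : Conf V Γ Λ}
    (h : stepOrStay M c = c') (h' : ReachesIn M n c' c'') : ReachesIn M (n + 1) c c'' := by
  obtain ⟨k, hk, rfl⟩ := h'
  exact ⟨k + 1, by omega, by rw [Function.iterate_succ_apply, h]⟩

open Turing.TM2.Stmt

variable [DecidableEq Γ] [Inhabited Γ]

/-- Compare the letters that `x` and `y` point at. If they agree and are accepted by `p`, put them
aside and go on; otherwise restore the words. The flag records the result of the comparison. -/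
def compareCode (x y : V) (p : Γ → Bool) (result : Mem Γ → Bool) (more restore : Λ) :
    Code V Γ Λ :=
  peek (.ptr x) (fun m a => (a, m.2)) <|
  peek (.ptr y) (fun m b => (m.1, b, m.2.2)) <|
  branch (fun m => (m.1 == m.2.1) && m.1.any p)
    (pop (.ptr x) (fun m _ => m) <| pop (.ptr y) (fun m _ => m) <|
      push .tmp (fun m => m.1.getD default) <| goto fun _ => more)
    (load (fun m => (m.1, m.2.1, result m)) <| goto fun _ => restore)

/-- Pop a letter from the stack `k`; if there was one, execute `a`, otherwise go to `exit`. -/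
def popCode (k : Stack V) (a : Code V Γ Λ) (exit : Mem Γ → Λ) : Code V Γ Λ :=
  pop k (fun m a => (a, m.2)) <| branch (fun m => m.1.isSome) a (goto exit)

namespace LoopProg

/-- The labels of the compiled program. -/
def Label : LoopProg V Γ → Type
  | skip => Unit
  | emit _ _ => Unit
  | seq a b => a.Label ⊕ b.Label
  | ite _ _ a b => Unit ⊕ (a.Label ⊕ b.Label)
  | iteEq _ _ _ a b => EqLabel ⊕ (a.Label ⊕ b.Label)
  | loop _ _ _ a => LoopLabel ⊕ a.Label

instance finite_label : ∀ c : LoopProg V Γ, Finite c.Label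
  | skip => inferInstanceAs (Finite Unit)
  | emit _ _ => inferInstanceAs (Finite Unit)
  | seq a b =>
    have := finite_label a
    have := finite_label b
    inferInstanceAs (Finite (a.Label ⊕ b.Label))
  | ite _ _ a b =>
    have := finite_label a
    have := finite_label b
    inferInstanceAs (Finite (Unit ⊕ (a.Label ⊕ b.Label)))
  | iteEq _ _ _ a b =>
    have := finite_label a
    have := finite_label b
    inferInstanceAs (Finite (EqLabel ⊕ (a.Label ⊕ b.Label)))
  | loop _ _ _ a =>
    have := finite_label a
    inferInstanceAs (Finite (LoopLabel ⊕ a.Label))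

/-- The label at which the compiled program starts. -/
def entry : ∀ c : LoopProg V Γ, c.Label
  | skip => ()
  | emit _ _ => ()
  | seq a _ => Sum.inl a.entry
  | ite _ _ _ _ => Sum.inl ()
  | iteEq _ _ _ _ _ => Sum.inl EqLabel.first
  | loop _ _ _ _ => Sum.inl LoopLabel.unload

/-- The statements of the compiled program, as part of a machine whose labels are `Λ`: the labels
of the program are embedded by `emb`, and the program ends by going to the label `exit`. -/
def code : ∀ c : LoopProg V Γ, (c.Label → Λ) → Λ → c.Label → Code V Γ Λ
  | skip, _, exit, _ => goto fun _ => exit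
  | emit x f, _, exit, _ =>
      peek (.ptr x) (fun m a => (a, m.2)) <| push .out (fun m => f m.1) <| goto fun _ => exit
  | seq a b, emb, _, Sum.inl q => a.code (emb ∘ Sum.inl) (emb (Sum.inr b.entry)) q
  | seq _ b, emb, exit, Sum.inr q => b.code (emb ∘ Sum.inr) exit q
  | ite x p a b, emb, _, Sum.inl _ =>
      peek (.ptr x) (fun m a => (a, m.2)) <|
      goto fun m => if p m.1 then emb (Sum.inr (Sum.inl a.entry))
        else emb (Sum.inr (Sum.inr b.entry))
  | ite _ _ a _, emb, exit, Sum.inr (Sum.inl q) => a.code (emb ∘ Sum.inr ∘ Sum.inl) exit q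
  | ite _ _ _ b, emb, exit, Sum.inr (Sum.inr q) => b.code (emb ∘ Sum.inr ∘ Sum.inr) exit q
  | iteEq x y _ _ _, emb, _, Sum.inl .first =>
      compareCode x y (fun _ => true) (fun m => (m.1 == m.2.1))
        (emb (Sum.inl .more)) (emb (Sum.inl .restore))
  | iteEq x y p _ _, emb, _, Sum.inl .more =>
      compareCode x y p (fun m => !m.1.any p && !m.2.1.any p)
        (emb (Sum.inl .more)) (emb (Sum.inl .restore))
  | iteEq x y _ a b, emb, _, Sum.inl .restore =>
      popCode .tmp
        (push (.ptr x) (fun m => m.1.getD default) <| push (.ptr y) (fun m => m.1.getD default) <|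
          goto fun _ => emb (Sum.inl .restore))
        (fun m => if m.2.2 then emb (Sum.inr (Sum.inl a.entry))
          else emb (Sum.inr (Sum.inr b.entry)))
  | iteEq _ _ _ a _, emb, exit, Sum.inr (Sum.inl q) => a.code (emb ∘ Sum.inr ∘ Sum.inl) exit q
  | iteEq _ _ _ _ b, emb, exit, Sum.inr (Sum.inr q) => b.code (emb ∘ Sum.inr ∘ Sum.inr) exit q
  | loop _ y _ _, emb, _, Sum.inl .unload =>
      popCode (.ptr y)
        (push .tmp (fun m => m.1.getD default) <| goto fun _ => emb (Sum.inl .unload))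
        (fun _ => emb (Sum.inl .reload))
  | loop x y _ _, emb, _, Sum.inl .reload =>
      popCode .tmp
        (push (.ptr x) (fun m => m.1.getD default) <| push (.ptr y) (fun m => m.1.getD default) <|
          goto fun _ => emb (Sum.inl .reload))
        (fun _ => emb (Sum.inl .advance))
  | loop x _ _ _, emb, _, Sum.inl .advance =>
      pop (.ptr x) (fun m _ => m) <| goto fun _ => emb (Sum.inl .test)
  | loop x _ p a, emb, _, Sum.inl .test =>
      peek (.ptr x) (fun m a => (a, m.2)) <|
      goto fun m => if m.1.any p then emb (Sum.inr a.entry) else emb (Sum.inl .clear)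
  | loop x _ _ _, emb, exit, Sum.inl .clear =>
      popCode (.ptr x) (goto fun _ => emb (Sum.inl .clear)) (fun _ => exit)
  | loop _ _ _ a, emb, _, Sum.inr q => a.code (emb ∘ Sum.inr) (emb (Sum.inl .advance)) q

end LoopProg

omit [DecidableEq Γ] [Inhabited Γ] in
theorem update_update_update_update {x y : V} (hxy : x ≠ y) (e : V → List Γ)
    (a b c d : List Γ) : Function.update (Function.update (Function.update (Function.update e x a)
      y b) x c) y d = Function.update (Function.update e x c) y d := by
  funext z
  by_cases h : z = y <;> by_cases h' : z = x <;> simp_all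

omit [DecidableEq Γ] in
/-- Moving a word from a stack to the auxiliary stack. -/
theorem reachesIn_unload {M : Λ → Code V Γ Λ} {q q' : Λ} {y : V}
    (hq : M q = popCode (.ptr y)
      (push .tmp (fun m => m.1.getD default) <| goto fun _ => q) (fun _ => q'))
    (i o : List Γ) : ∀ (l : List Γ) (e : V → List Γ) (t : List Γ) (m : Mem Γ), e y = l →
      ReachesIn M (l.length + 1) ⟨some q, m, contents e i t o⟩
        ⟨some q', (none, m.2), contents (Function.update e y []) i (l.reverse ++ t) o⟩
  | [], e, t, m, he => by
    refine .step (c' := ⟨some q', (none, m.2), contents (Function.update e y []) i t o⟩) ?_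
      (.refl _ _ _)
    simp [hq, popCode, he]
  | a :: l, e, t, m, he => by
    have h := reachesIn_unload hq i o l (Function.update e y l) (a :: t) (some a, m.2) (by simp)
    refine .step ?_ (by simpa using h)
    simp [hq, popCode, he]

omit [DecidableEq Γ] in
/-- Moving a word from the auxiliary stack to two pointers. -/
theorem reachesIn_reload {M : Λ → Code V Γ Λ} {q : Λ} {q' : Mem Γ → Λ} {x y : V} (hxy : x ≠ y)
    (hq : M q = popCode .tmp
        (push (.ptr x) (fun m => m.1.getD default) <| push (.ptr y) (fun m => m.1.getD default) <|
          goto fun _ => q) q')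
    (i o : List Γ) : ∀ (t : List Γ) (e : V → List Γ) (m : Mem Γ),
      ReachesIn M (t.length + 1) ⟨some q, m, contents e i t o⟩
        ⟨some (q' (none, m.2)), (none, m.2), contents (Function.update
          (Function.update e x (t.reverse ++ e x)) y (t.reverse ++ e y)) i [] o⟩
  | [], e, m => by
    refine .step (c' := ⟨some (q' (none, m.2)), (none, m.2), contents e i [] o⟩) ?_ ?_
    · simp [hq, popCode]
    · simpa using .refl _ _ _
  | a :: t, e, m => by
    have h := reachesIn_reload hxy hq i o t
      (Function.update (Function.update e x (a :: e x)) y (a :: e y)) (some a, m.2)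
    refine .step (c' := ⟨some q, (some a, m.2), contents
      (Function.update (Function.update e x (a :: e x)) y (a :: e y)) i t o⟩) ?_ ?_
    · simp [hq, popCode, hxy.symm]
    · simp only [Function.update_self, Function.update_of_ne hxy] at h
      rw [update_update_update_update hxy] at h
      simpa using h

omit [DecidableEq Γ] [Inhabited Γ] in
/-- Emptying a stack. -/
theorem reachesIn_clear {M : Λ → Code V Γ Λ} {q q' : Λ} {y : V}
    (hq : M q = popCode (.ptr y) (goto fun _ => q) (fun _ => q'))
    (i t o : List Γ) : ∀ (l : List Γ) (e : V → List Γ) (m : Mem Γ), e y = l →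
      ReachesIn M (l.length + 1) ⟨some q, m, contents e i t o⟩
        ⟨some q', (none, m.2), contents (Function.update e y []) i t o⟩
  | [], e, m, he => by
    refine .step (c' := ⟨some q', (none, m.2), contents (Function.update e y []) i t o⟩) ?_
      (.refl _ _ _)
    simp [hq, popCode, he]
  | a :: l, e, m, he => by
    have h := reachesIn_clear hq i t o l (Function.update e y l) (some a, m.2) (by simp)
    refine .step ?_ (by simpa using h)
    simp [hq, popCode, he]

/-- Whether the longest prefixes over `p` of two words agree, computed letter by letter. -/
def compareList (p : Γ → Bool) : List Γ → List Γ → Bool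
  | a :: l₁, b :: l₂ => if a = b ∧ p a then compareList p l₁ l₂ else !p a && !p b
  | a :: _, [] => !p a
  | [], b :: _ => !p b
  | [], [] => true

omit [Inhabited Γ] in
theorem compareList_iff (p : Γ → Bool) : ∀ l₁ l₂ : List Γ,
    compareList p l₁ l₂ = true ↔ l₁.takeWhile p = l₂.takeWhile p
  | a :: l₁, b :: l₂ => by
    have := compareList_iff p l₁ l₂
    rw [compareList]
    split_ifs with h
    · obtain ⟨rfl, h⟩ := h
      simp [h, this]
    · by_cases ha : p a = true <;> by_cases hb : p b = true <;>
        simp_all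
  | a :: _, [] => by
    by_cases ha : p a = true <;> simp_all [compareList]
  | [], b :: _ => by
    by_cases ha : p b = true <;> simp_all [compareList]
  | [], [] => by simp [compareList]

/-- Comparing two words: the common part has been moved to the auxiliary stack. -/
theorem reachesIn_compare {M : Λ → Code V Γ Λ} {q q' : Λ} {x y : V} (hxy : x ≠ y) {p : Γ → Bool}
    (hq : M q = compareCode x y p (fun m => !m.1.any p && !m.2.1.any p) q q')
    (i o : List Γ) : ∀ (l₁ l₂ : List Γ) (e : V → List Γ) (t : List Γ) (m : Mem Γ),
      e x = l₁ → e y = l₂ → ∃ w l₁' l₂' m₁ m₂, l₁ = w ++ l₁' ∧ l₂ = w ++ l₂' ∧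
        ReachesIn M (w.length + 1) ⟨some q, m, contents e i t o⟩
        ⟨some q', (m₁, m₂, compareList p l₁ l₂),
          contents (Function.update (Function.update e x l₁') y l₂') i (w.reverse ++ t) o⟩ := by
  have finish : ∀ (l₁ l₂ : List Γ) (e : V → List Γ) (t : List Γ) (m : Mem Γ),
      e x = l₁ → e y = l₂ → ¬ (l₁.head? = l₂.head? ∧ l₁.head?.any p) →
      ∃ w l₁' l₂' m₁ m₂, l₁ = w ++ l₁' ∧ l₂ = w ++ l₂' ∧
        ReachesIn M (w.length + 1) ⟨some q, m, contents e i t o⟩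
        ⟨some q', (m₁, m₂, compareList p l₁ l₂),
          contents (Function.update (Function.update e x l₁') y l₂') i (w.reverse ++ t) o⟩ := by
    rintro l₁ l₂ e t m rfl rfl h
    refine ⟨[], e x, e y, (e x).head?, (e y).head?, rfl, rfl, .step ?_ (.refl _ _ _)⟩
    have hc : (!(e x).head?.any p && !(e y).head?.any p) = compareList p (e x) (e y) := by
      revert h
      cases e x <;> cases e y <;> simp [compareList]
      intro h h' h''
      simp_all
    simp only [hq, compareCode, stepOrStay_some, Turing.TM2.stepAux, contents_ptr]
    rw [cond_eq_ite, if_neg (by rw [Bool.and_eq_true, beq_iff_eq]; exact h)]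
    simp [hc]
  intro l₁
  induction l₁ with
  | nil =>
    intro l₂ e t m h₁ h₂
    exact finish _ _ e t m h₁ h₂ (by simp)
  | cons a l₁ ih =>
    intro l₂ e t m h₁ h₂
    by_cases h : (a :: l₁).head? = l₂.head? ∧ (a :: l₁).head?.any p
    · obtain ⟨h, ha⟩ := h
      obtain ⟨l₂, rfl⟩ : ∃ l, l₂ = a :: l := by cases l₂ <;> simp_all
      obtain ⟨w, l₁', l₂', m₁, m₂, hw₁, hw₂, hr⟩ :=
        ih l₂ (Function.update (Function.update e x l₁) y l₂) (a :: t) (some a, some a, m.2.2)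
          (by simp [hxy]) (by simp)
      refine ⟨a :: w, l₁', l₂', m₁, m₂, by simp [hw₁], by simp [hw₂], ?_⟩
      have ha' : p a = true := by simpa using ha
      refine .step (c' := ⟨some q, (some a, some a, m.2.2),
        contents (Function.update (Function.update e x l₁) y l₂) i (a :: t) o⟩) ?_ ?_
      · simp [hq, compareCode, h₁, h₂, ha', hxy.symm]
      · rw [update_update_update_update hxy] at hr
        simpa [compareList, ha'] using hr
    · exact finish _ _ e t m h₁ h₂ h

/-- The compiled program writes the value of the program and leaves the other stacks as they
were. -/
theorem LoopProg.reachesIn {M : Λ → Code V Γ Λ} (N : ℕ) (i : List Γ) :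
    ∀ (c : LoopProg V Γ) (emb : c.Label → Λ) (exit : Λ),
      (∀ q, M (emb q) = c.code emb exit q) → ∀ (S : Finset V), c.WellFormed S →
      ∀ (e : V → List Γ), (∀ x ∉ S, e x = []) → (∀ x, (e x).length ≤ N) →
      ∀ (o : List Γ) (m : Mem Γ), ∃ m', ReachesIn M (c.cost.eval N)
        ⟨some (emb c.entry), m, contents e i [] o⟩
        ⟨some exit, m', contents e i [] ((c.eval e).reverse ++ o)⟩
  | skip, emb, exit, hM, S, hS, e, he, hN, o, m => by
    refine ⟨m, ?_⟩
    simp only [cost, Polynomial.eval_one]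
    refine .step (n := 0) ?_ (.refl _ _ _)
    simp [hM, code, eval]
  | emit x f, emb, exit, hM, S, hS, e, he, hN, o, m => by
    refine ⟨((e x).head?, m.2), ?_⟩
    simp only [cost, Polynomial.eval_one]
    refine .step (n := 0) ?_ (.refl _ _ _)
    simp [hM, code, eval]
  | seq a b, emb, exit, hM, S, hS, e, he, hN, o, m => by
    obtain ⟨m₁, h₁⟩ := a.reachesIn N i (emb ∘ Sum.inl) (emb (Sum.inr b.entry))
      (fun q => hM (Sum.inl q)) S hS.1 e he hN o m
    obtain ⟨m₂, h₂⟩ := b.reachesIn N i (emb ∘ Sum.inr) exit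
      (fun q => hM (Sum.inr q)) S hS.2 e he hN ((a.eval e).reverse ++ o) m₁
    refine ⟨m₂, ?_⟩
    rw [cost, Polynomial.eval_add, eval, List.reverse_append, List.append_assoc]
    exact h₁.trans h₂
  | ite x p a b, emb, exit, hM, S, hS, e, he, hN, o, m => by
    have h₀ := hM (Sum.inl ())
    by_cases hp : p (e x).head? = true
    · obtain ⟨m', h⟩ := a.reachesIn N i (emb ∘ Sum.inr ∘ Sum.inl) exit
        (fun q => hM (Sum.inr (Sum.inl q))) S hS.1 e he hN o ((e x).head?, m.2)
      rw [eval, if_pos hp]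
      refine ⟨m', ReachesIn.mono (.step ?_ h) ?_⟩
      · simp [entry, h₀, code, hp]
        rfl
      · simp only [cost, Polynomial.eval_add, Polynomial.eval_one]; omega
    · obtain ⟨m', h⟩ := b.reachesIn N i (emb ∘ Sum.inr ∘ Sum.inr) exit
        (fun q => hM (Sum.inr (Sum.inr q))) S hS.2 e he hN o ((e x).head?, m.2)
      rw [eval, if_neg hp]
      refine ⟨m', ReachesIn.mono (.step ?_ h) ?_⟩
      · simp [entry, h₀, code, hp]
        rfl
      · simp only [cost, Polynomial.eval_add, Polynomial.eval_one]; omega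
  | iteEq x y p a b, emb, exit, hM, S, hS, e, he, hN, o, m => by
    classical
    have hxy : x ≠ y := hS.1
    have hF := hM (Sum.inl .first)
    have hR := hM (Sum.inl .restore)
    have key : ∃ m', ReachesIn M (2 * N + 2)
        ⟨some (emb (Sum.inl .first)), m, contents e i [] o⟩
        ⟨some (if SameWord p (e x) (e y) then emb (Sum.inr (Sum.inl a.entry))
          else emb (Sum.inr (Sum.inr b.entry))), m', contents e i [] o⟩ := by
      by_cases h : (e x).head? = (e y).head? ∧ (e x).head?.isSome
      · obtain ⟨h, ha⟩ := h
        obtain ⟨c, l₁, h₁⟩ : ∃ c l, e x = c :: l := by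
          cases hx : e x with
          | nil => simp [hx] at ha
          | cons c l => exact ⟨c, l, rfl⟩
        obtain ⟨l₂, h₂⟩ : ∃ l, e y = c :: l := by
          rw [h₁] at h
          cases hy : e y with
          | nil => simp [hy] at h
          | cons c l => simp_all
        obtain ⟨w, l₁', l₂', m₁, m₂, rfl, rfl, hr⟩ := reachesIn_compare hxy
          (hM (Sum.inl .more)) i o l₁ l₂ (Function.update (Function.update e x l₁) y l₂) [c]
          (some c, some c, m.2.2) (by simp [hxy]) (by simp)
        have hr' := reachesIn_reload hxy (hM (Sum.inl .restore)) i o (w.reverse ++ [c])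
          (Function.update (Function.update e x l₁') y l₂')
          (m₁, m₂, compareList p (w ++ l₁') (w ++ l₂'))
        rw [update_update_update_update hxy] at hr hr'
        have hs : SameWord p (e x) (e y) ↔ compareList p (w ++ l₁') (w ++ l₂') = true := by
          rw [compareList_iff, h₁, h₂]
          simp [SameWord]
        have he' : Function.update (Function.update e x (c :: (w ++ l₁'))) y (c :: (w ++ l₂')) =
            e := by
          rw [← h₁, ← h₂]; simp
        simp only [List.reverse_append, List.reverse_reverse, List.reverse_singleton,
          Function.update_self, Function.update_of_ne hxy, List.nil_append,
          List.cons_append, he'] at hr'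
        refine ⟨(none, m₂, compareList p (w ++ l₁') (w ++ l₂')), ?_⟩
        simp only [hs]
        refine ReachesIn.mono (.step ?_ (hr.trans hr')) ?_
        · simp [hF, code, compareCode, h₁, h₂, hxy.symm]
        · have := hN x
          rw [h₁] at this
          simp at this ⊢
          omega
      · have hs : SameWord p (e x) (e y) ↔ (e x).head? = (e y).head? := by
          refine ⟨fun h => h.1, fun h' => ⟨h', ?_⟩⟩
          revert h h'
          cases e x <;> cases e y <;> simp +contextual
        refine ⟨(none, (e y).head?, ((e x).head? == (e y).head?)), .mono (n := 2 * N + 2) (.step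
          (c' := ⟨some (emb (Sum.inl .restore)), ((e x).head?, (e y).head?,
            ((e x).head? == (e y).head?)), contents e i [] o⟩) ?_ (.step (n := 0) ?_
              (.refl _ _ _))) (by omega)⟩
        · simp only [hF, code, compareCode, stepOrStay_some, Turing.TM2.stepAux, contents_ptr]
          rw [cond_eq_ite, if_neg (by
            rw [Bool.and_eq_true, beq_iff_eq]
            cases hx : e x <;> simp_all)]
        · simp [hR, code, popCode, hs]
    obtain ⟨m', hk⟩ := key
    rw [cost, Polynomial.eval_add, Polynomial.eval_add, eval]
    have hN2 : (2 * Polynomial.X + 2 : Polynomial ℕ).eval N = 2 * N + 2 := by simp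
    rw [hN2]
    split_ifs at hk ⊢ with hs
    · obtain ⟨m'', h⟩ := a.reachesIn N i (emb ∘ Sum.inr ∘ Sum.inl) exit
        (fun q => hM (Sum.inr (Sum.inl q))) S hS.2.1 e he hN o m'
      exact ⟨m'', (hk.trans h).mono (n := 2 * N + 2 + a.cost.eval N + b.cost.eval N) (by omega)⟩
    · obtain ⟨m'', h⟩ := b.reachesIn N i (emb ∘ Sum.inr ∘ Sum.inr) exit
        (fun q => hM (Sum.inr (Sum.inr q))) S hS.2.2 e he hN o m'
      exact ⟨m'', (hk.trans h).mono (n := 2 * N + 2 + a.cost.eval N + b.cost.eval N) (by omega)⟩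
  | loop x y p a, emb, exit, hM, S, hS, e, he, hN, o, m => by
    obtain ⟨hx, hy, ha⟩ := hS
    have hxy : x ≠ y := fun h => hx (h ▸ hy)
    have hT := hM (Sum.inl .test)
    have hA := hM (Sum.inl .advance)
    have hex : Function.update e x [] = e := by rw [← he x hx]; simp
    have iter : ∀ (l : List Γ), l.length ≤ N → ∀ (o : List Γ) (m : Mem Γ), ∃ m', ReachesIn M
        (l.length * (a.cost.eval N + 2) + (l.length + 2))
        ⟨some (emb (Sum.inl .test)), m, contents (Function.update e x l) i [] o⟩
        ⟨some exit, m', contents e i []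
          ((suffixFlatMap p (fun l => a.eval (Function.update e x l)) l).reverse ++ o)⟩ := by
      intro l
      induction l with
      | nil =>
        intro _ o m
        have h := reachesIn_clear (hM (Sum.inl .clear)) i [] o [] (Function.update e x [])
          (none, m.2) (by simp)
        simp only [hex, List.length_nil] at h
        refine ⟨(none, m.2), ReachesIn.mono (.step ?_ h) (by simp)⟩
        simp [hT, code, hex, he x hx]
      | cons c l ih =>
        intro hl o m
        by_cases hp : p c = true
        · obtain ⟨m₁, h₁⟩ := a.reachesIn N i (emb ∘ Sum.inr) (emb (Sum.inl .advance))
            (fun q => hM (Sum.inr q)) (insert x S) ha (Function.update e x (c :: l))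
            (fun z hz => by
              rw [Finset.mem_insert, not_or] at hz
              rw [Function.update_of_ne hz.1, he z hz.2])
            (fun z => by
              by_cases hz : z = x
              · subst hz; simpa using hl
              · rw [Function.update_of_ne hz]; exact hN z) o (some c, m.2)
          obtain ⟨m₂, h₂⟩ := ih (by simp at hl; omega)
            ((a.eval (Function.update e x (c :: l))).reverse ++ o) m₁
          refine ⟨m₂, ReachesIn.mono (.step ?_ (h₁.trans (.step ?_ (by
            simpa [suffixFlatMap, hp] using h₂)))) ?_⟩
          · simp [hT, code, hp]; rfl
          · simp [hA, code]
          · simp only [List.length_cons, add_mul, one_mul]; omega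
        · refine ⟨_, .mono (.step ?_ (by
            simpa [hex, suffixFlatMap, hp] using reachesIn_clear (hM (Sum.inl .clear)) i [] o
              (c :: l) (Function.update e x (c :: l)) (some c, m.2) (by simp))) ?_⟩
          · simp [hT, code, hp]
          · simp only [List.length_cons]; omega
    have h₁ := reachesIn_unload (hM (Sum.inl .unload)) i o (e y) e [] m rfl
    have h₂ := reachesIn_reload hxy (hM (Sum.inl .reload)) i o ((e y).reverse ++ [])
      (Function.update e y []) (none, m.2)
    have hu : Function.update (Function.update (Function.update e y []) x (e y)) y (e y) =
        Function.update e x (e y) := by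
      funext z
      by_cases h : z = y <;> by_cases h' : z = x <;> simp_all
    simp only [List.append_nil, List.reverse_reverse, Function.update_of_ne hxy, he x hx,
      Function.update_self, hu] at h₂ h₁
    obtain ⟨m', h₃⟩ := iter (e y).tail (by have := hN y; simp; omega) o (none, m.2)
    refine ⟨m', ReachesIn.mono ((h₁.trans h₂).trans (.step ?_ (by simpa [eval] using h₃))) ?_⟩
    · simp [hA, code]
    · have := hN y
      have h' : (e y).tail.length ≤ N := by simp; omega
      have := Nat.mul_le_mul_right (a.cost.eval N + 2) h'
      simp only [cost, Polynomial.eval_add, Polynomial.eval_mul, Polynomial.eval_X,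
        Polynomial.eval_ofNat, List.length_reverse]
      rw [List.length_tail] at h' this
      generalize ((e y).length - 1) * (a.cost.eval N + 2) = A at *
      omega

end Compile

/-! ### The machine of a loop program -/

section


/-- The symbols of which the numerals and the interior of an assignment `V = v` consist. -/
def Sym.isInner : Sym → Bool
  | .bit _ => true
  | .eq => true
  | _ => false

/-- Insert a separator `none` after the intervention `α` of every `[α] β`. The flag says whether
the reading position is inside an intervention, and the counter is the number of interventions that
remain to be read until `α` is complete. -/
def mark : Bool → ℕ → List Sym → List (Option Sym)
  | _, _, [] => []
  | false, c, s :: l => some s :: if s = .box then mark true (c + 1) l else mark false c l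
  | true, c, s :: l =>
    if s.isInner then some s :: mark true c l
    else match c with
      | 0 => none :: some s :: mark false 0 l
      | c + 1 => some s :: if s = .and then mark true (c + 2) l else mark true c l

theorem length_mark_le : ∀ (b : Bool) (c : ℕ) (l : List Sym), (mark b c l).length ≤ 2 * l.length
  | b, c, [] => by simp [mark]
  | false, c, s :: l => by
    have h₁ := length_mark_le true (c + 1) l
    have h₂ := length_mark_le false c l
    rw [mark]
    split_ifs <;> simp <;> omega
  | true, 0, s :: l => by
    have h₁ := length_mark_le true 0 l
    have h₂ := length_mark_le false 0 l
    rw [mark]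
    split_ifs <;> simp <;> omega
  | true, c + 1, s :: l => by
    have h₁ := length_mark_le true (c + 1) l
    have h₂ := length_mark_le true (c + 2) l
    have h₃ := length_mark_le true c l
    rw [mark]
    split_ifs <;> simp [*] <;> omega

/-- The labels of the machine outside the compiled program. -/
inductive Phase : Type
  | mark | clear | load | finish

instance : Finite Phase :=
  Finite.of_injective
    (fun q : Phase => match q with | .mark => (0 : Fin 4) | .clear => 1 | .load => 2 | .finish => 3)
    (by intro a b; cases a <;> cases b <;> simp)

open Turing.TM2.Stmt

variable {V : Type} [DecidableEq V]

/-- The statements of the machine of a loop program. The flag of the internal state says whether the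
reading position is inside an intervention; the auxiliary stack holds the counter of `mark`. -/
def machineCode (c : LoopProg V (Option Sym)) (w : V) :
    Phase ⊕ c.Label → Code V (Option Sym) (Phase ⊕ c.Label)
  | .inl .mark =>
      pop .inp (fun m a => (a, m.2)) <|
      branch (fun m => m.1.isNone) (goto fun _ => .inl .clear) <|
      push .out (fun m => m.1.getD default) <|
      branch (fun m => m.2.2)
        (branch (fun m => m.1.any fun s => s.any Sym.isInner) (goto fun _ => .inl .mark) <|
          pop .tmp (fun m a => (m.1, a, m.2.2)) <|
          branch (fun m => m.2.1.isSome)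
            (branch (fun m => m.1 == some (some .and))
              (push .tmp (fun _ => none) <| push .tmp (fun _ => none) <| goto fun _ => .inl .mark)
              (goto fun _ => .inl .mark))
            (pop .out (fun m _ => m) <| push .out (fun _ => none) <|
              push .out (fun m => m.1.getD default) <| load (fun m => (m.1, m.2.1, false)) <|
              goto fun _ => .inl .mark))
        (branch (fun m => m.1 == some (some .box))
          (push .tmp (fun _ => none) <| load (fun m => (m.1, m.2.1, true)) <|
            goto fun _ => .inl .mark)
          (goto fun _ => .inl .mark))
  | .inl .clear => popCode .tmp (goto fun _ => .inl .clear) (fun _ => .inl .load)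
  | .inl .load =>
      pop .out (fun m a => (a, m.2)) <|
      branch (fun m => m.1.isSome)
        (push (.ptr w) (fun m => m.1.getD default) <| goto fun _ => .inl .load)
        (push (.ptr w) (fun _ => none) <| goto fun _ => .inr c.entry)
  | .inl .finish =>
      pop .out (fun m a => (a, m.2)) <|
      branch (fun m => m.1.isSome)
        (push .inp (fun m => m.1.getD default) <| goto fun _ => .inl .finish)
        halt
  | .inr q => c.code Sum.inr (.inl .finish) q

/-- The machine of a loop program. It is deterministic: the two programs agree. -/
def machine [Finite V] (c : LoopProg V (Option Sym)) (w : V) : NTM Sym where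
  K := Stack V
  Γ := Option Sym
  Λ := Phase ⊕ c.Label
  σ := Mem (Option Sym)
  decidableEqK := inferInstance
  finite_K := inferInstance
  finite_Γ := inferInstance
  finite_Λ := inferInstance
  finite_σ := inferInstance
  letter := ⟨some, Option.some_injective _⟩
  inputStack := .inp
  outputStack := .inp
  start := .inl .mark
  initialState := (none, none, false)
  program := fun _ => machineCode c w

variable (c : LoopProg V (Option Sym)) (w : V)

/-- The machine computes `mark`: the counter is the height of the auxiliary stack, and the flag is
that of the internal state. -/
theorem reachesIn_mark (e : V → List (Option Sym)) : ∀ (l : List Sym) (k : ℕ)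
    (m : Mem (Option Sym)) (o : List (Option Sym)), ∃ k' m', k' ≤ k + l.length ∧
      ReachesIn (machineCode c w) (l.length + 1)
        ⟨some (.inl .mark), m, contents e (l.map some) (List.replicate k none) o⟩
        ⟨some (.inl .clear), m', contents e [] (List.replicate k' none)
          ((mark m.2.2 k l).reverse ++ o)⟩
  | [], k, m, o => by
    refine ⟨k, (none, m.2), by omega, .step (n := 0) ?_ (.refl _ _ _)⟩
    simp [machineCode, mark]
  | s :: l, k, (m₁, m₂, false), o => by
    by_cases hs : s = .box
    · obtain ⟨k', m', hk, h⟩ := reachesIn_mark e l (k + 1) (some (some s), m₂, true) (some s :: o)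
      refine ⟨k', m', by simp; omega, .step ?_ (by simpa [mark, hs] using h)⟩
      simp [machineCode, hs, List.replicate_succ]
    · obtain ⟨k', m', hk, h⟩ := reachesIn_mark e l k (some (some s), m₂, false) (some s :: o)
      refine ⟨k', m', by simp; omega, .step ?_ (by simpa [mark, hs] using h)⟩
      have hs' : (s == .box) = false := by simpa using hs
      simp [machineCode, hs']
  | s :: l, k, (m₁, m₂, true), o => by
    by_cases hi : s.isInner = true
    · obtain ⟨k', m', hk, h⟩ := reachesIn_mark e l k (some (some s), m₂, true) (some s :: o)
      refine ⟨k', m', by simp; omega, .step ?_ (by simpa [mark, hi] using h)⟩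
      simp [machineCode, hi]
    · cases k with
      | zero =>
        obtain ⟨k', m', hk, h⟩ := reachesIn_mark e l 0 (some (some s), none, false)
          (some s :: none :: o)
        refine ⟨k', m', by simp; omega, .step ?_ (by simpa [mark, hi] using h)⟩
        simp [machineCode, hi]
      | succ k =>
        by_cases hs : s = .and
        · obtain ⟨k', m', hk, h⟩ := reachesIn_mark e l (k + 2) (some (some s), some none, true)
            (some s :: o)
          subst hs
          have hi' : Sym.and.isInner = false := rfl
          refine ⟨k', m', by simp; omega, .step ?_ (by simpa [mark, hi'] using h)⟩
          simp [machineCode, hi, List.replicate_succ]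
        · obtain ⟨k', m', hk, h⟩ := reachesIn_mark e l k (some (some s), some none, true)
            (some s :: o)
          refine ⟨k', m', by simp; omega, .step ?_ (by simpa [mark, hi, hs] using h)⟩
          have hs' : (s == .and) = false := by simpa using hs
          simp [machineCode, hi, hs', List.replicate_succ]

theorem reachesIn_clear_tmp (e : V → List (Option Sym)) (i o : List (Option Sym)) :
    ∀ (t : List (Option Sym)) (m : Mem (Option Sym)),
      ReachesIn (machineCode c w) (t.length + 1) ⟨some (.inl .clear), m, contents e i t o⟩
        ⟨some (.inl .load), (none, m.2), contents e i [] o⟩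
  | [], m => by
    refine .step (n := 0) ?_ (.refl _ _ _)
    simp [machineCode, popCode]
  | a :: t, m => by
    refine .step ?_ (reachesIn_clear_tmp e i o t (some a, m.2))
    simp [machineCode, popCode]

/-- The pointer to the input is preceded by one more letter, since loops start after the letter
that is pointed at. -/
theorem reachesIn_load (i t : List (Option Sym)) :
    ∀ (o : List (Option Sym)) (e : V → List (Option Sym)) (m : Mem (Option Sym)),
      ReachesIn (machineCode c w) (o.length + 1) ⟨some (.inl .load), m, contents e i t o⟩
        ⟨some (.inr c.entry), (none, m.2),
          contents (Function.update e w (none :: (o.reverse ++ e w))) i t []⟩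
  | [], e, m => by
    refine .step (n := 0) ?_ (.refl _ _ _)
    simp [machineCode]
  | a :: o, e, m => by
    have h := reachesIn_load i t o (Function.update e w (a :: e w)) (some a, m.2)
    refine .step ?_ (by simpa using h)
    simp [machineCode]

theorem reachesIn_finish (e : V → List (Option Sym)) (t : List (Option Sym)) :
    ∀ (o i : List (Option Sym)) (m : Mem (Option Sym)),
      ReachesIn (machineCode c w) (o.length + 1) ⟨some (.inl .finish), m, contents e i t o⟩
        ⟨none, (none, m.2), contents e (o.reverse ++ i) t []⟩
  | [], i, m => by
    refine .step (n := 0) ?_ (.refl _ _ _)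
    simp [machineCode]
  | a :: o, i, m => by
    have h := reachesIn_finish e t o (a :: i) (some a, m.2)
    refine .step ?_ (by simpa using h)
    simp [machineCode]

/-- Every letter of the output takes a step. -/
theorem LoopProg.length_eval_le (N : ℕ) : ∀ (c : LoopProg V (Option Sym))
    (e : V → List (Option Sym)), (∀ x, (e x).length ≤ N) →
    (c.eval e).length ≤ c.cost.eval N
  | skip, e, he => by simp [eval]
  | emit x f, e, he => by simp [eval, cost]
  | seq a b, e, he => by
    have h₁ := a.length_eval_le N e he
    have h₂ := b.length_eval_le N e he
    simp only [eval, cost, List.length_append, Polynomial.eval_add]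
    omega
  | ite x p a b, e, he => by
    have h₁ := a.length_eval_le N e he
    have h₂ := b.length_eval_le N e he
    simp only [eval, cost, Polynomial.eval_add]
    split_ifs <;> omega
  | iteEq x y p a b, e, he => by
    have h₁ := a.length_eval_le N e he
    have h₂ := b.length_eval_le N e he
    simp only [eval, cost, Polynomial.eval_add]
    split_ifs <;> omega
  | loop x y p a, e, he => by
    have key : ∀ l : List (Option Sym), l.length ≤ N →
        (suffixFlatMap p (fun l => a.eval (Function.update e x l)) l).length ≤
          l.length * a.cost.eval N := by
      intro l
      induction l with
      | nil => simp [suffixFlatMap]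
      | cons b l ih =>
        intro hl
        have h₁ := a.length_eval_le N (Function.update e x (b :: l)) fun z => by
          by_cases hz : z = x
          · subst hz; simpa using hl
          · rw [Function.update_of_ne hz]; exact he z
        have h₂ := ih (by simp at hl; omega)
        rw [suffixFlatMap]
        split_ifs
        · simp only [List.length_append, List.length_cons, add_mul, one_mul]; omega
        · simp
    have hl : (e y).tail.length ≤ N := by have := he y; simp; omega
    have h := (key _ hl).trans (Nat.mul_le_mul_right _ hl)
    simp only [eval, cost, Polynomial.eval_add, Polynomial.eval_mul, Polynomial.eval_X, mul_add]
    omega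

/-- A bound for the running time of the machine of a loop program. -/
noncomputable def machineTime (c : LoopProg V (Option Sym)) : Polynomial ℕ :=
  4 * Polynomial.X + 4 + 2 * c.cost.comp (2 * Polynomial.X + 1)

/-- The word that the machine of a loop program puts out. -/
noncomputable def machineOutput (c : LoopProg V (Option Sym)) (w : V) (l : List Sym) :
    List (Option Sym) :=
  c.eval (Function.update (fun _ => []) w (none :: mark false 0 l))

theorem reachesIn_machineOutput (hc : c.WellFormed {w}) (l : List Sym) :
    ∃ m s, ReachesIn (machineCode c w) ((machineTime c).eval l.length)
      ⟨some (.inl .mark), (none, none, false), contents (fun _ => []) (l.map some) [] []⟩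
      ⟨none, m, s⟩ ∧ s .inp = machineOutput c w l := by
  obtain ⟨k, m₁, hk, h₁⟩ := reachesIn_mark c w (fun _ => []) l 0 (none, none, false) []
  have h₂ := reachesIn_clear_tmp c w (fun _ => []) []
    ((mark false 0 l).reverse ++ []) (List.replicate k none) m₁
  have h₃ := reachesIn_load c w [] [] ((mark false 0 l).reverse ++ []) (fun _ => []) (none, m₁.2)
  have hlen := length_mark_le false 0 l
  have hN : ∀ x, (Function.update (fun _ => []) w (none :: mark false 0 l) x).length ≤
      2 * l.length + 1 := by
    intro x
    by_cases hx : x = w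
    · subst hx; simp; omega
    · simp [Function.update_of_ne hx]
  obtain ⟨m₄, h₄⟩ := c.reachesIn (M := machineCode c w) (2 * l.length + 1) [] Sum.inr
    (.inl .finish) (fun q => rfl) {w} hc
    (Function.update (fun _ => []) w (none :: mark false 0 l))
    (fun x hx => by simp at hx; simp [Function.update_of_ne hx]) hN [] (none, m₁.2)
  have h₅ := reachesIn_finish c w (Function.update (fun _ => []) w (none :: mark false 0 l)) []
    ((c.eval (Function.update (fun _ => []) w (none :: mark false 0 l))).reverse ++ []) [] m₄
  have hle := c.length_eval_le (2 * l.length + 1) _ hN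
  simp only [List.append_nil, List.reverse_reverse] at h₁ h₂ h₃ h₄ h₅
  refine ⟨_, _, ((((h₁.trans h₂).trans h₃).trans h₄).trans h₅).mono ?_, rfl⟩
  simp only [machineTime, Polynomial.eval_add, Polynomial.eval_mul, Polynomial.eval_X,
    Polynomial.eval_ofNat, Polynomial.eval_comp, Polynomial.eval_one, List.length_reverse,
    List.length_replicate]
  omega

theorem run_machine [Finite V] (l : List Sym) (bs : List Bool) :
    (machine c w).run l bs = (stepOrStay (machineCode c w))^[bs.length]
      ⟨some (.inl .mark), (none, none, false), contents (fun _ => []) (l.map some) [] []⟩ := by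
  have key : ∀ (bs : List Bool) (a : (machine c w).Cfg),
      bs.foldl (machine c w).next a = (stepOrStay (machineCode c w))^[bs.length] a := by
    intro bs
    induction bs with
    | nil => intro a; rfl
    | cons b bs ih => intro a; exact ih _
  have hi : (machine c w).initial l =
      ⟨some (.inl .mark), (none, none, false), contents (fun _ => []) (l.map some) [] []⟩ := by
    have : Function.update (fun _ => []) Stack.inp (l.map some) =
        contents (fun _ : V => []) (l.map some) [] [] := by
      funext k; cases k <;> simp
    unfold NTM.initial
    exact congrArg (fun s => (⟨_, _, s⟩ : Conf V (Option Sym) (Phase ⊕ c.Label))) this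
  rw [NTM.run, key, hi]
  rfl

theorem iterate_stepOrStay_of_halted {Γ Λ : Type} (M : Λ → Code V Γ Λ) (m : Mem Γ)
    (s : Stack V → List Γ) (n : ℕ) :
    (stepOrStay M)^[n] ⟨none, m, s⟩ = ⟨none, m, s⟩ := by
  induction n with
  | zero => rfl
  | succ n ih => rw [Function.iterate_succ_apply]; exact ih

theorem haltsWithin_machine [Finite V] (hc : c.WellFormed {w}) (l : List Sym) :
    (machine c w).HaltsWithin l ((machineTime c).eval l.length) := by
  intro bs hbs
  obtain ⟨m, s, ⟨k, hk, h⟩, -⟩ := reachesIn_machineOutput c w hc l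
  rw [run_machine, hbs]
  obtain ⟨n, hn⟩ := Nat.exists_eq_add_of_le' hk
  rw [hn, Function.iterate_add_apply, h, iterate_stepOrStay_of_halted]
  rfl

theorem stk_run_machine [Finite V] (hc : c.WellFormed {w}) (l : List Sym) (bs : List Bool)
    (hbs : ((machine c w).run l bs).l = none) :
    ((machine c w).run l bs).stk Stack.inp = machineOutput c w l := by
  obtain ⟨m, s, ⟨k, hk, h⟩, hs⟩ := reachesIn_machineOutput c w hc l
  rw [run_machine] at hbs ⊢
  -- A halted machine does not move, so all halted configurations agree.
  have : (stepOrStay (machineCode c w))^[bs.length]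
      ⟨some (.inl .mark), (none, none, false), contents (fun _ => []) (l.map some) [] []⟩ =
      ⟨none, m, s⟩ := by
    generalize hA : (stepOrStay (machineCode c w))^[bs.length] _ = A at hbs
    obtain ⟨_, m', s'⟩ := A
    simp only at hbs
    subst hbs
    rcases le_total k bs.length with hle | hle
    · obtain ⟨n, hn⟩ := Nat.exists_eq_add_of_le' hle
      rw [← hA, hn, Function.iterate_add_apply, h, iterate_stepOrStay_of_halted]
    · obtain ⟨n, hn⟩ := Nat.exists_eq_add_of_le' hle
      rw [← h, hn, Function.iterate_add_apply, hA]
      exact (iterate_stepOrStay_of_halted _ _ _ _).symm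
  rw [this]
  exact hs

end

/-! ### Unique readability -/

/-- The word does not begin with a digit. -/
def NoDigit (r : List Sym) : Prop := ∀ b, r.head? ≠ some (.bit b)

/-- The word does not begin in the interior of a numeral or of an assignment. -/
def AtBoundary (r : List Sym) : Prop := ∀ s ∈ r.head?, s.isInner = false

theorem AtBoundary.noDigit {r : List Sym} (h : AtBoundary r) : NoDigit r := by
  intro b hb
  simpa [Sym.isInner] using h _ hb

theorem atBoundary_nil : AtBoundary [] := by simp [AtBoundary]

theorem atBoundary_cons {s : Sym} (hs : s.isInner = false) (r : List Sym) :
    AtBoundary (s :: r) := by simpa [AtBoundary] using hs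

theorem bits_injective : Function.Injective Nat.bits := by
  intro m
  induction m using Nat.binaryRec' with
  | zero =>
    intro n h
    induction n using Nat.binaryRec' with
    | zero => rfl
    | bit b n hn _ => rw [Nat.bits_append_bit n b hn] at h; simp at h
  | bit b m hm ih =>
    intro n h
    induction n using Nat.binaryRec' with
    | zero => rw [Nat.bits_append_bit m b hm] at h; simp at h
    | bit c n hn _ =>
      rw [Nat.bits_append_bit m b hm, Nat.bits_append_bit n c hn, List.cons.injEq] at h
      rw [h.1, ih h.2]

theorem map_bit_append_inj {r r' : List Sym} (hr : NoDigit r) (hr' : NoDigit r') :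
    ∀ {l l' : List Bool}, l.map Sym.bit ++ r = l'.map Sym.bit ++ r' → l = l' ∧ r = r'
  | [], [], h => ⟨rfl, h⟩
  | [], b :: l', h => by simp at h; exact absurd (by simp [h]) (hr b)
  | b :: l, [], h => by simp at h; exact absurd (by simp [← h]) (hr' b)
  | b :: l, b' :: l', h => by
    simp only [List.map_cons, List.cons_append, List.cons.injEq, Sym.bit.injEq] at h
    obtain ⟨rfl, rfl⟩ := map_bit_append_inj hr hr' h.2
    exact ⟨by rw [h.1], rfl⟩

theorem natCode_append_inj {m n : ℕ} {r r' : List Sym} (hr : NoDigit r) (hr' : NoDigit r')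
    (h : natCode m ++ r = natCode n ++ r') : m = n ∧ r = r' :=
  let ⟨h₁, h₂⟩ := map_bit_append_inj hr hr' h
  ⟨bits_injective h₁, h₂⟩

theorem eqCode_append_inj {m n v w : ℕ} {r r' : List Sym} (hr : NoDigit r) (hr' : NoDigit r')
    (h : eqCode m v ++ r = eqCode n w ++ r') : m = n ∧ v = w ∧ r = r' := by
  simp only [eqCode, List.cons_append, List.append_assoc, List.cons.injEq, true_and] at h
  obtain ⟨rfl, h₂⟩ := natCode_append_inj (by simp [NoDigit]) (by simp [NoDigit]) h
  obtain ⟨rfl, rfl⟩ := natCode_append_inj hr hr' (List.cons.inj h₂).2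
  exact ⟨rfl, rfl, rfl⟩

section Readability

variable {S : Signature} {OP : Set Operation}

theorem LInt.atBoundary_code_append (α : LInt S) (r : List Sym) : AtBoundary (α.code ++ r) := by
  cases α <;> exact atBoundary_cons rfl _

theorem LProp.atBoundary_code_append (β : LProp S) (r : List Sym) : AtBoundary (β.code ++ r) := by
  cases β <;> exact atBoundary_cons rfl _

theorem LInt.code_append_inj (α : LInt S) : ∀ (β : LInt S) {r r' : List Sym}, AtBoundary r →
    AtBoundary r' → α.code ++ r = β.code ++ r' → α = β ∧ r = r' := by
  induction α with
  | top => intro β r r' hr hr' h; cases β <;> simp_all [code, eqCode]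
  | eq n v =>
    intro β r r' hr hr' h
    cases β with
    | eq m w =>
      obtain ⟨rfl, hv, rfl⟩ := eqCode_append_inj hr.noDigit hr'.noDigit h
      rw [Fin.ext hv]
      exact ⟨rfl, rfl⟩
    | _ => simp [code, eqCode] at h
  | and α₁ α₂ ih₁ ih₂ =>
    intro β r r' hr hr' h
    cases β with
    | and β₁ β₂ =>
      simp only [code, List.cons_append, List.append_assoc, List.cons.injEq, true_and] at h
      obtain ⟨rfl, h₂⟩ := ih₁ _ (α₂.atBoundary_code_append _) (β₂.atBoundary_code_append _) h
      obtain ⟨rfl, rfl⟩ := ih₂ _ hr hr' h₂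
      exact ⟨rfl, rfl⟩
    | _ => simp [code, eqCode] at h

theorem LProp.code_append_inj (β : LProp S) : ∀ (γ : LProp S) {r r' : List Sym}, AtBoundary r →
    AtBoundary r' → β.code ++ r = γ.code ++ r' → β = γ ∧ r = r' := by
  induction β with
  | eq n v =>
    intro γ r r' hr hr' h
    cases γ with
    | eq m w =>
      obtain ⟨rfl, hv, rfl⟩ := eqCode_append_inj hr.noDigit hr'.noDigit h
      rw [Fin.ext hv]
      exact ⟨rfl, rfl⟩
    | _ => simp [code, eqCode] at h
  | neg β ih =>
    intro γ r r' hr hr' h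
    cases γ with
    | neg γ =>
      simp only [code, List.cons_append, List.cons.injEq, true_and] at h
      obtain ⟨rfl, rfl⟩ := ih _ hr hr' h
      exact ⟨rfl, rfl⟩
    | _ => simp [code, eqCode] at h
  | and β₁ β₂ ih₁ ih₂ =>
    intro γ r r' hr hr' h
    cases γ with
    | and γ₁ γ₂ =>
      simp only [code, List.cons_append, List.append_assoc, List.cons.injEq, true_and] at h
      obtain ⟨rfl, h₂⟩ := ih₁ _ (β₂.atBoundary_code_append _) (γ₂.atBoundary_code_append _) h
      obtain ⟨rfl, rfl⟩ := ih₂ _ hr hr' h₂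
      exact ⟨rfl, rfl⟩
    | _ => simp [code, eqCode] at h

variable [Encodable OP] {B : Type}

theorem Term.atBoundary_code_append (c : B → List Sym) (t : Term OP B) (r : List Sym) :
    AtBoundary (t.code c ++ r) := by
  cases t <;> exact atBoundary_cons rfl _

theorem atBoundary_flatten_append (c : B → List Sym) {r : List Sym} (hr : AtBoundary r) :
    ∀ l : List (Term OP B), AtBoundary ((l.map (Term.code c)).flatten ++ r)
  | [] => hr
  | t :: l => by
    rw [List.map_cons, List.flatten_cons, List.append_assoc]
    exact t.atBoundary_code_append c _

/-- A code that can be read off from the beginning of a word. -/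
def UniquelyReadable (c : B → List Sym) : Prop :=
  ∀ (ε ζ : B) {r r' : List Sym}, AtBoundary r → AtBoundary r' → c ε ++ r = c ζ ++ r' →
    ε = ζ ∧ r = r'

theorem Term.code_append_inj {c : B → List Sym} (hc : UniquelyReadable c) (t : Term OP B) :
    ∀ (t' : Term OP B) {r r' : List Sym}, AtBoundary r → AtBoundary r' →
      t.code c ++ r = t'.code c ++ r' → t = t' ∧ r = r' := by
  induction t with
  | prob ε =>
    intro t' r r' hr hr' h
    cases t' with
    | prob ζ =>
      simp only [code, List.cons_append, List.cons.injEq, true_and] at h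
      obtain ⟨rfl, rfl⟩ := hc _ _ hr hr' h
      exact ⟨rfl, rfl⟩
    | _ => simp [code] at h
  | app f args ih =>
    intro t' r r' hr hr' h
    cases t' with
    | prob ζ => simp [code] at h
    | app g args' =>
      simp only [code, List.cons_append, List.append_assoc, List.cons.injEq, true_and] at h
      have hrp : ∀ r : List Sym, AtBoundary ([Sym.rpar] ++ r) := fun r => atBoundary_cons rfl _
      have hb : ∀ {k : ℕ} (a : Fin k → Term OP B) (r : List Sym),
          AtBoundary ((List.ofFn fun i => (a i).code c).flatten ++ ([Sym.rpar] ++ r)) := by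
        intro k a r
        have := atBoundary_flatten_append c (hrp r) (List.ofFn a)
        rwa [List.map_ofFn] at this
      obtain ⟨hfg, h⟩ := natCode_append_inj (hb _ _).noDigit (hb _ _).noDigit h
      obtain rfl := Encodable.encode_injective hfg
      suffices key : ∀ (k : ℕ) (a b : Fin k → Term OP B),
          (∀ i (t' : Term OP B) {r r' : List Sym}, AtBoundary r → AtBoundary r' →
            (a i).code c ++ r = t'.code c ++ r' → a i = t' ∧ r = r') →
          (List.ofFn fun i => (a i).code c).flatten ++ ([Sym.rpar] ++ r) =
            (List.ofFn fun i => (b i).code c).flatten ++ ([Sym.rpar] ++ r') →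
          a = b ∧ r = r' by
        obtain ⟨rfl, rfl⟩ := key _ args args' ih h
        exact ⟨rfl, rfl⟩
      intro k
      induction k with
      | zero =>
        intro a b _ h
        refine ⟨Subsingleton.elim _ _, by simpa using h⟩
      | succ k ihk =>
        intro a b hab h
        simp only [List.ofFn_succ, List.flatten_cons, List.append_assoc] at h
        obtain ⟨h₀, h⟩ := hab 0 _ (hb (fun i => a i.succ) _) (hb (fun i => b i.succ) _) h
        obtain ⟨h₁, h₂⟩ := ihk _ _ (fun i => hab i.succ) h
        refine ⟨?_, h₂⟩
        funext i
        refine Fin.cases h₀ (fun j => congrFun h₁ j) i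

theorem Formula.atBoundary_code_append (c : B → List Sym) (φ : Formula OP B) (r : List Sym) :
    AtBoundary (φ.code c ++ r) := by
  cases φ <;> exact atBoundary_cons rfl _

theorem Formula.code_append_inj {c : B → List Sym} (hc : UniquelyReadable c) (φ : Formula OP B) :
    ∀ (ψ : Formula OP B) {r r' : List Sym}, AtBoundary r → AtBoundary r' →
      φ.code c ++ r = ψ.code c ++ r' → φ = ψ ∧ r = r' := by
  induction φ with
  | ge t₁ t₂ =>
    intro ψ r r' hr hr' h
    cases ψ with
    | ge t₁' t₂' =>
      simp only [code, List.cons_append, List.append_assoc, List.cons.injEq, true_and] at h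
      obtain ⟨rfl, h₂⟩ := t₁.code_append_inj hc _ (t₂.atBoundary_code_append c _)
        (t₂'.atBoundary_code_append c _) h
      obtain ⟨rfl, rfl⟩ := t₂.code_append_inj hc _ hr hr' h₂
      exact ⟨rfl, rfl⟩
    | _ => simp [code] at h
  | neg φ ih =>
    intro ψ r r' hr hr' h
    cases ψ with
    | neg ψ =>
      simp only [code, List.cons_append, List.cons.injEq, true_and] at h
      obtain ⟨rfl, rfl⟩ := ih _ hr hr' h
      exact ⟨rfl, rfl⟩
    | _ => simp [code] at h
  | and φ₁ φ₂ ih₁ ih₂ =>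
    intro ψ r r' hr hr' h
    cases ψ with
    | and ψ₁ ψ₂ =>
      simp only [code, List.cons_append, List.append_assoc, List.cons.injEq, true_and] at h
      obtain ⟨rfl, h₂⟩ := ih₁ _ (φ₂.atBoundary_code_append c _) (ψ₂.atBoundary_code_append c _) h
      obtain ⟨rfl, rfl⟩ := ih₂ _ hr hr' h₂
      exact ⟨rfl, rfl⟩
    | _ => simp [code] at h

theorem LProb.code_injective : Function.Injective (LProb.code (S := S) (OP := OP)) := by
  intro φ ψ h
  exact (Formula.code_append_inj (fun β γ => LProp.code_append_inj β γ) φ ψ (r := []) (r' := [])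
    atBoundary_nil atBoundary_nil (by simpa [LProb.code] using h)).1

end Readability

/-! ### Fresh variables -/

/-- Four bits for every symbol. -/
def Sym.toBits : Sym → List Bool
  | .bit b => [false, false, false, b]
  | .var => [false, false, true, false]
  | .eq => [false, false, true, true]
  | .top => [false, true, false, false]
  | .neg => [false, true, false, true]
  | .and => [false, true, true, false]
  | .box => [false, true, true, true]
  | .prob => [true, false, false, false]
  | .lpar => [true, false, false, true]
  | .rpar => [true, false, true, false]
  | .ge => [true, false, true, true]

theorem flatMap_toBits_injective : Function.Injective (List.flatMap Sym.toBits) := by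
  have hlen : ∀ s : Sym, s.toBits.length = 4 := by decide
  have hinj : ∀ s t : Sym, s.toBits = t.toBits → s = t := by decide
  intro l
  induction l with
  | nil =>
    intro l' h
    cases l' with
    | nil => rfl
    | cons s l' =>
      have := congrArg List.length h
      simp [hlen] at this
      omega
  | cons s l ih =>
    intro l' h
    cases l' with
    | nil =>
      have := congrArg List.length h
      simp [hlen] at this
    | cons s' l' =>
      rw [List.flatMap_cons, List.flatMap_cons] at h
      obtain ⟨h₁, h₂⟩ := List.append_inj h (by rw [hlen, hlen])
      rw [hinj _ _ h₁, ih h₂]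

/-- The number with given binary digits, least significant digit first. -/
def natOfBits (l : List Bool) : ℕ := l.foldr Nat.bit 0

theorem bits_natOfBits (l : List Bool) : (natOfBits (l ++ [true])).bits = l ++ [true] := by
  induction l with
  | nil => simp [natOfBits]
  | cons b l ih =>
    have h : natOfBits (b :: l ++ [true]) = Nat.bit b (natOfBits (l ++ [true])) := rfl
    rw [h, Nat.bits_append_bit, ih, List.cons_append]
    intro h0
    rw [h0] at ih
    simp at ih

/-- The index of the variable that is named by the word `l`. The `L` initial zeros make it differ
from all variables whose indices have at most `L` digits. -/
def freshIndex (L : ℕ) (l : List Sym) : ℕ :=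
  natOfBits (List.replicate L false ++ l.flatMap Sym.toBits ++ [true])

theorem bits_freshIndex (L : ℕ) (l : List Sym) : (freshIndex L l).bits =
    List.replicate L false ++ l.flatMap Sym.toBits ++ [true] := bits_natOfBits _

theorem freshIndex_injective (L : ℕ) : Function.Injective (freshIndex L) := by
  intro l l' h
  have h := congrArg Nat.bits h
  simp only [bits_freshIndex, List.append_assoc, List.append_cancel_left_eq,
    List.append_cancel_right_eq] at h
  exact flatMap_toBits_injective h

theorem freshIndex_ne {L n : ℕ} (hn : n.bits.length ≤ L) (l : List Sym) : freshIndex L l ≠ n := by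
  rintro rfl
  rw [bits_freshIndex] at hn
  simp at hn

section Names

variable {S : Signature}

/-- The name of the variable saying that `Vₙ` has the value `v` under the intervention `α`. -/
def worldName (α : LInt S) (n v : ℕ) : List Sym :=
  α.code ++ .ge :: (natCode n ++ .eq :: natCode v)

/-- The name of the variable saying that `Vₘ` precedes `Vₙ`. -/
def orderName (m n : ℕ) : List Sym := natCode m ++ .ge :: natCode n

theorem worldName_inj {α β : LInt S} {m n v w : ℕ} (h : worldName α m v = worldName β n w) :
    α = β ∧ m = n ∧ v = w := by
  obtain ⟨rfl, h₁⟩ := LInt.code_append_inj _ _ (atBoundary_cons rfl _) (atBoundary_cons rfl _) h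
  obtain ⟨rfl, h₂⟩ := natCode_append_inj (by simp [NoDigit]) (by simp [NoDigit])
    (List.cons.inj h₁).2
  have h' : natCode v ++ [] = natCode w ++ [] := by simpa using h₂
  exact ⟨rfl, rfl, (natCode_append_inj atBoundary_nil.noDigit atBoundary_nil.noDigit h').1⟩

theorem orderName_inj {m n m' n' : ℕ} (h : orderName m n = orderName m' n') :
    m = m' ∧ n = n' := by
  obtain ⟨rfl, h₁⟩ := natCode_append_inj (by simp [NoDigit]) (by simp [NoDigit]) h
  have h' : natCode n ++ [] = natCode n' ++ [] := by simpa using h₁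
  exact ⟨rfl, (natCode_append_inj atBoundary_nil.noDigit atBoundary_nil.noDigit h').1⟩

theorem worldName_ne_orderName (α : LInt S) (n v i j : ℕ) : worldName α n v ≠ orderName i j := by
  unfold worldName orderName natCode
  cases α <;> cases i.bits <;> simp [LInt.code, eqCode]

end Names

/-! ### The reduced formula -/

section Reduct

variable {S : Signature} {OP : Set Operation} {B B' : Type}

/-- The value `0`. -/
def Signature.zero (S : Signature) (n : ℕ) : S.Val n :=
  ⟨0, lt_of_lt_of_le Nat.zero_lt_two (S.two_le_card n)⟩

/-- The value `1`. -/
def Signature.one (S : Signature) (n : ℕ) : S.Val n :=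
  ⟨1, lt_of_lt_of_le Nat.one_lt_two (S.two_le_card n)⟩

theorem Signature.one_ne_zero (S : Signature) (n : ℕ) : S.one n ≠ S.zero n := by
  simp [one, zero]

/-- The occurrences of assignments `V = v`. -/
def LInt.atoms : LInt S → List (Σ n, S.Val n)
  | .top => []
  | .eq n v => [⟨n, v⟩]
  | .and α β => α.atoms ++ β.atoms

theorem LInt.mem_atoms {α : LInt S} {t : Σ n, S.Val n} : t ∈ α.atoms ↔ t ∈ α.conjuncts := by
  induction α with
  | top => simp [atoms, conjuncts]
  | eq n v => simp [atoms, conjuncts]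
  | and α β ih₁ ih₂ => simp [atoms, conjuncts, ih₁, ih₂]

/-- The occurrences of assignments `V = v`. -/
def LProp.atoms : LProp S → List (Σ n, S.Val n)
  | .eq n v => [⟨n, v⟩]
  | .neg β => β.atoms
  | .and β γ => β.atoms ++ γ.atoms

/-- The occurrences of assignments `V = v`. -/
def LFull.atoms : LFull S → List (Σ n, S.Val n)
  | .box α _ β => α.atoms ++ β.atoms
  | .neg ε => ε.atoms
  | .and ε ζ => ε.atoms ++ ζ.atoms

/-- The occurrences of interventions. -/
def LFull.boxes : LFull S → List (LInt S)
  | .box α _ _ => [α]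
  | .neg ε => ε.boxes
  | .and ε ζ => ε.boxes ++ ζ.boxes

/-- The formulas `ε` of which the probability is mentioned. -/
def Term.bases : Term OP B → List B
  | .prob ε => [ε]
  | .app _ args => (List.ofFn fun i => (args i).bases).flatten

/-- The formulas `ε` of which the probability is mentioned. -/
def Formula.bases : Formula OP B → List B
  | .ge t₁ t₂ => t₁.bases ++ t₂.bases
  | .neg φ => φ.bases
  | .and φ ψ => φ.bases ++ ψ.bases

/-- Replace the probability terms `P(ε)` by `P(f ε)`. -/
def Term.map (f : B → B') : Term OP B → Term OP B'
  | .prob ε => .prob (f ε)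
  | .app g args => .app g fun i => (args i).map f

/-- Replace the probability terms `P(ε)` by `P(f ε)`. -/
def Formula.map (f : B → B') : Formula OP B → Formula OP B'
  | .ge t₁ t₂ => .ge (t₁.map f) (t₂.map f)
  | .neg φ => .neg (φ.map f)
  | .and φ ψ => .and (φ.map f) (ψ.map f)

theorem Term.value_map {f : B → B'} {p : B → ℝ} {p' : B' → ℝ} (t : Term OP B)
    (h : ∀ ε ∈ t.bases, p ε = p' (f ε)) : (t.map f).value p' = t.value p := by
  induction t with
  | prob ε => exact (h ε (by simp [bases])).symm
  | app g args ih =>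
    simp only [map, value]
    refine congrArg _ (funext fun i => ?_)
    exact ih i fun ε hε => h ε (by
      simp only [bases, List.mem_flatten, List.mem_ofFn]
      exact ⟨_, ⟨i, rfl⟩, hε⟩)

theorem Formula.holds_map {f : B → B'} {p : B → ℝ} {p' : B' → ℝ} (φ : Formula OP B)
    (h : ∀ ε ∈ φ.bases, p ε = p' (f ε)) : (φ.map f).Holds p' ↔ φ.Holds p := by
  induction φ with
  | ge t₁ t₂ =>
    simp only [map, Holds]
    rw [t₁.value_map fun ε hε => h ε (by simp [bases, hε]),
      t₂.value_map fun ε hε => h ε (by simp [bases, hε])]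
  | neg φ ih => exact not_congr (ih h)
  | and φ ψ ih₁ ih₂ =>
    exact and_congr (ih₁ fun ε hε => h ε (by simp [bases, hε]))
      (ih₂ fun ε hε => h ε (by simp [bases, hε]))

namespace LProp

/-- The propositional variable that is named by the word `l`: a fresh endogenous variable, with the
value `0` standing for truth. -/
def fresh (L : ℕ) (l : List Sym) : LProp S := .eq (freshIndex L l) (S.zero _)

/-- The propositional variable saying that `V = v` under the intervention `α`. -/
def world (L : ℕ) (α : LInt S) (t : Σ n, S.Val n) : LProp S := fresh L (worldName α t.1 t.2)

/-- The propositional variable saying that `Vₘ` precedes `Vₙ`. -/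
def order (L : ℕ) (m n : ℕ) : LProp S := fresh L (orderName m n)

/-- A tautology. -/
def taut : LProp S := .neg (.and (.eq 0 (S.zero 0)) (.neg (.eq 0 (S.zero 0))))

/-- The conjunction of a list of formulas. -/
def all (l : List (LProp S)) : LProp S := l.foldr .and taut

/-- Material equivalence. -/
def equiv (β γ : LProp S) : LProp S := .and (.neg (.and β (.neg γ))) (.neg (.and γ (.neg β)))

/-- Replace every `V = v` by the variable saying that `V = v` under the intervention `α`. -/
def relativize (L : ℕ) (α : LInt S) : LProp S → LProp S
  | .eq n v => world L α ⟨n, v⟩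
  | .neg β => .neg (β.relativize L α)
  | .and β γ => .and (β.relativize L α) (γ.relativize L α)

variable (s : Assignment S)

theorem holds_taut : (taut : LProp S).Holds s := by simp [taut, Holds]

theorem holds_all (l : List (LProp S)) : (all l).Holds s ↔ ∀ β ∈ l, β.Holds s := by
  induction l with
  | nil => simp [all, holds_taut]
  | cons β l ih => simpa [all, Holds] using fun _ => ih

theorem holds_equiv (β γ : LProp S) : (equiv β γ).Holds s ↔ (β.Holds s ↔ γ.Holds s) := by
  simp only [equiv, Holds]
  tauto

end LProp

/-- Replace every `V = v` in the scope of `[α]` by the variable saying that `V = v` under `α`. -/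
def LFull.toProp (L : ℕ) : LFull S → LProp S
  | .box α _ β => β.relativize L α
  | .neg ε => .neg (ε.toProp L)
  | .and ε ζ => .and (ε.toProp L) (ζ.toProp L)

open LProp

section Clauses

variable (L : ℕ) (A : List (Σ n, S.Val n)) (I : List (LInt S))

/-- No variable precedes itself. -/
def irreflClauses : List (LProp S) := A.map fun t => .neg (order L t.1 t.1)

/-- Precedence is transitive. -/
def transClauses : List (LProp S) :=
  A.flatMap fun t => A.flatMap fun t' => A.map fun t'' =>
    .neg (.and (order L t.1 t'.1) (.and (order L t'.1 t''.1) (.neg (order L t.1 t''.1))))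

/-- Interventions are effective. -/
def setClauses : List (LProp S) := I.flatMap fun α => α.atoms.map fun t => world L α t

/-- A variable does not have two different values. -/
def uniqueClauses : List (LProp S) :=
  I.flatMap fun α => A.flatMap fun t => A.flatMap fun t' =>
    if t.1 = t'.1 then
      if (t.2 : ℕ) = t'.2 then [] else [.neg (.and (world L α t) (world L α t'))]
    else []

/-- If `V` does not have a value that is mentioned under the intervention `α`, then its value
without intervention is not one of those that are mentioned. -/
def otherClauses : List (LProp S) :=
  I.flatMap fun α => A.map fun t =>
    .neg (.and (.eq t.1 t.2)
      (all (A.flatMap fun t' => if t.1 = t'.1 then [.neg (world L α t')] else [])))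

/-- If neither `α` nor `α'` sets `V`, and the predecessors of `V` have the same values under `α` and
under `α'`, then so does `V`. -/
def determinedClauses : List (LProp S) :=
  I.flatMap fun α => I.flatMap fun α' => A.map fun t =>
    .neg (all
      ((α.atoms ++ α'.atoms).flatMap (fun t' => if t.1 = t'.1 then [.neg taut] else []) ++
      (A.map (fun t' =>
        .neg (.and (order L t'.1 t.1) (.neg (equiv (world L α t') (world L α' t'))))) ++
      [.neg (equiv (world L α t) (world L α' t))])))

/-- The conditions under which the propositional variables describe a recursive model. -/
def consistency : LProp S :=
  all (irreflClauses L A ++ (transClauses L A ++ (setClauses L I ++ (uniqueClauses L A I ++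
    (otherClauses L A I ++ determinedClauses L A I)))))

end Clauses

/-- The formula `β` is almost surely true or almost surely false. -/
def Formula.constant (β : LProp S) : LProb S OP :=
  .neg (.and (.neg (.ge (.prob β) (.prob taut))) (.neg (.ge (.prob (.neg β)) (.prob taut))))

/-- The assignments `V = v` that are mentioned. -/
def LCausal.atoms (φ : LCausal S OP) : List (Σ n, S.Val n) := φ.bases.flatMap LFull.atoms

/-- The interventions that are mentioned. -/
def LCausal.boxes (φ : LCausal S OP) : List (LInt S) := φ.bases.flatMap LFull.boxes

/-- The probabilistic formula to which a causal formula is reduced. -/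
def reduct (L : ℕ) (φ : LCausal S OP) : LProb S OP :=
  (φ.atoms.flatMap fun t => φ.atoms.map fun t' => Formula.constant (order L t.1 t'.1)).foldr .and
    (.and (φ.map (LFull.toProp L))
      (.ge (.prob (consistency L φ.atoms φ.boxes)) (.prob taut)))

theorem Formula.holds_foldr_and (p : B → ℝ) (l : List (Formula OP B)) (φ : Formula OP B) :
    (l.foldr .and φ).Holds p ↔ (∀ ψ ∈ l, ψ.Holds p) ∧ φ.Holds p := by
  induction l with
  | nil => simp
  | cons ψ l ih => simp [Holds, ih, and_assoc]

end Reduct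

/-! ### Models -/

section Models

variable {S : Signature} {OP : Set Operation}

theorem measurableSet_holds (β : LProp S) :
    @MeasurableSet (Assignment S) MeasurableSpace.pi {s | β.Holds s} := by
  induction β with
  | eq n v => exact measurable_pi_apply n (measurableSet_singleton v)
  | neg β ih => exact ih.compl
  | and β γ ih₁ ih₂ => exact ih₁.inter ih₂

/-- A function of finitely many endogenous variables is measurable. -/
theorem measurable_of_finset {X : Type} [MeasurableSpace X] (D : Finset ℕ) {f : Assignment S → X}
    (hf : ∀ s s' : Assignment S, (∀ k ∈ D, s k = s' k) → f s = f s') : Measurable f := by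
  classical
  let g : (∀ k : D, S.Val k) → X := fun a =>
    f fun k => if h : k ∈ D then a ⟨k, h⟩ else S.zero k
  have hg : Measurable g := measurable_of_finite g
  have hr : Measurable fun (s : Assignment S) (k : D) => s k :=
    measurable_pi_lambda _ fun k => measurable_pi_apply (k : ℕ)
  have hfg : f = g ∘ fun (s : Assignment S) (k : D) => s k := by
    funext s
    exact hf _ _ fun k hk => by simp [hk]
  rw [hfg]
  exact hg.comp hr

namespace SCM

variable {M : SCM S}

theorem IsRecursive.isSolution_solution (h : M.IsRecursive) (i : Intervention S)
    (u : M.ExoAssignment) : M.IsSolution i u (M.solution i u) :=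
  Classical.epsilon_spec (h.existsUnique_solution i u).exists

theorem IsMeasurable.measurableSet_modelsProp (h : M.IsMeasurable) (β : LProp S) :
    @MeasurableSet _ M.sigma {u | M.ModelsProp u β} := by
  let _ := M.sigma
  exact (h (fun _ => none) (by simp)) (measurableSet_holds β)

theorem IsMeasurable.le_prob_iff (h : M.IsMeasurable) (β : LProp S) :
    (M.P {u | M.ModelsProp u β}).toReal ≥ (M.P {u | M.ModelsProp u LProp.taut}).toReal ↔
      ∀ᵐ u ∂M.P, M.ModelsProp u β := by
  let _ := M.sigma
  have := M.isProbabilityMeasure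
  have hm := h.measurableSet_modelsProp β
  have ht : {u | M.ModelsProp u (LProp.taut : LProp S)} = Set.univ :=
    Set.eq_univ_of_forall fun u => LProp.holds_taut _
  have hae : (∀ᵐ u ∂M.P, M.ModelsProp u β) ↔ M.P {u | M.ModelsProp u β} = 1 :=
    mem_ae_iff_prob_eq_one hm
  rw [ht, measure_univ, ENNReal.toReal_one, hae]
  refine ⟨fun h => ?_, fun h => by rw [h]; simp⟩
  by_contra hne
  have hlt := (ENNReal.toReal_lt_toReal (measure_ne_top M.P _) ENNReal.one_ne_top).2
    (lt_of_le_of_ne prob_le_one hne)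
  rw [ENNReal.toReal_one] at hlt
  linarith

/-- Replace the structural functions of `M` by functions that depend only on the exogenous
variables. -/
def withValues (M : SCM S) (f : ∀ n, M.ExoAssignment → S.Val n) : SCM S :=
  { M with F := fun n _ u => f n u }

theorem isRecursive_withValues (M : SCM S) (f : ∀ n, M.ExoAssignment → S.Val n) :
    (M.withValues f).IsRecursive :=
  ⟨(· < ·), inferInstance, fun _ _ _ _ _ => rfl⟩

theorem solution_withValues (M : SCM S) (f : ∀ n, M.ExoAssignment → S.Val n) (i : Intervention S)
    (u : M.ExoAssignment) (n : ℕ) : (M.withValues f).solution i u n = (i n).getD (f n u) :=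
  (M.isRecursive_withValues f).isSolution_solution i u n

end SCM

theorem LInt.finite_conjuncts (α : LInt S) : α.conjuncts.Finite := by
  induction α with
  | top => exact Set.finite_empty
  | eq n v => exact Set.finite_singleton _
  | and α β ih₁ ih₂ => exact ih₁.union ih₂

theorem LInt.toIntervention_of_mem {α : LInt S} (hα : α.Consistent) {n : ℕ} {v : S.Val n}
    (h : ⟨n, v⟩ ∈ α.conjuncts) : α.toIntervention n = some v := by
  have h' : ∃ v : S.Val n, ⟨n, v⟩ ∈ α.conjuncts := ⟨v, h⟩
  rw [toIntervention, dif_pos h', hα n _ _ h'.choose_spec h]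

theorem LInt.toIntervention_eq_none {α : LInt S} {n : ℕ}
    (h : ¬ ∃ v : S.Val n, ⟨n, v⟩ ∈ α.conjuncts) : α.toIntervention n = none := by
  rw [toIntervention, dif_neg h]

theorem LInt.finite_toIntervention (α : LInt S) :
    {n | (α.toIntervention n).isSome}.Finite := by
  refine (α.finite_conjuncts.image Sigma.fst).subset fun n hn => ?_
  by_contra h
  have : ¬ ∃ v : S.Val n, ⟨n, v⟩ ∈ α.conjuncts := fun ⟨v, hv⟩ => h ⟨_, hv, rfl⟩
  simp [toIntervention_eq_none this] at hn

theorem LFull.consistent_of_mem_boxes {ε : LFull S} {α : LInt S} (h : α ∈ ε.boxes) :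
    α.Consistent := by
  induction ε with
  | box α' hα' β =>
    simp only [boxes, List.mem_singleton] at h
    exact h ▸ hα'
  | neg ε ih => exact ih h
  | and ε ζ ih₁ ih₂ => exact (List.mem_append.1 h).elim ih₁ ih₂

theorem LFull.mem_atoms_of_mem_boxes {ε : LFull S} {α : LInt S} (h : α ∈ ε.boxes)
    {t : Σ n, S.Val n} (ht : t ∈ α.atoms) : t ∈ ε.atoms := by
  induction ε with
  | box α' hα' β =>
    simp only [boxes, List.mem_singleton] at h
    subst h
    simp [atoms, ht]
  | neg ε ih => exact ih h
  | and ε ζ ih₁ ih₂ =>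
    exact List.mem_append.2 ((List.mem_append.1 h).imp ih₁ ih₂)

theorem LCausal.consistent_of_mem_boxes {φ : LCausal S OP} {α : LInt S} (h : α ∈ φ.boxes) :
    α.Consistent := by
  obtain ⟨ε, -, h⟩ := List.mem_flatMap.1 h
  exact LFull.consistent_of_mem_boxes h

theorem LCausal.mem_atoms_of_mem_boxes {φ : LCausal S OP} {α : LInt S} (h : α ∈ φ.boxes)
    {t : Σ n, S.Val n} (ht : t ∈ α.atoms) : t ∈ φ.atoms := by
  obtain ⟨ε, hε, h⟩ := List.mem_flatMap.1 h
  exact List.mem_flatMap.2 ⟨ε, hε, LFull.mem_atoms_of_mem_boxes h ht⟩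

/-- If the propositional variables describe the values in `M`, then the translation of a causal
formula is equivalent to it. -/
theorem LFull.holds_toProp {M : SCM S} {L : ℕ} {u : M.ExoAssignment} {s : Assignment S}
    (ε : LFull S) (h : ∀ α ∈ ε.boxes, ∀ t ∈ ε.atoms,
      (LProp.world L α t).Holds s ↔ M.solution α.toIntervention u t.1 = t.2) :
    (ε.toProp L).Holds s ↔ M.ModelsFull u ε := by
  induction ε with
  | box α hα β =>
    have h' : ∀ t ∈ β.atoms, (LProp.world L α t).Holds s ↔
        M.solution α.toIntervention u t.1 = t.2 :=
      fun t ht => h α (by simp [boxes]) t (by simp [atoms, ht])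
    clear h
    simp only [toProp, SCM.ModelsFull]
    induction β with
    | eq n v => exact h' ⟨n, v⟩ (by simp [LProp.atoms])
    | neg β ih => exact not_congr (ih h')
    | and β γ ih₁ ih₂ =>
      exact and_congr (ih₁ fun t ht => h' t (by simp [LProp.atoms, ht]))
        (ih₂ fun t ht => h' t (by simp [LProp.atoms, ht]))
  | neg ε ih => exact not_congr (ih h)
  | and ε ζ ih₁ ih₂ =>
    exact and_congr
      (ih₁ fun α hα t ht => h α (by simp [boxes, hα]) t (by simp [atoms, ht]))
      (ih₂ fun α hα t ht => h α (by simp [boxes, hα]) t (by simp [atoms, ht]))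

end Models

section

open LProp

variable {S : Signature} {OP : Set Operation}

/-! ### The truth of the reduced formula -/

/-- The propositional variables describe, at one point of the sample space, the values of the
endogenous variables under the interventions `I`, as far as the assignments in `A` are concerned. -/
structure Describes (L : ℕ) (A : List (Σ n, S.Val n)) (I : List (LInt S)) (s : Assignment S) :
    Prop where
  irrefl : ∀ t ∈ A, ¬ (order L t.1 t.1 : LProp S).Holds s
  trans : ∀ t ∈ A, ∀ t' ∈ A, ∀ t'' ∈ A, (order L t.1 t'.1 : LProp S).Holds s →
    (order L t'.1 t''.1 : LProp S).Holds s → (order L t.1 t''.1 : LProp S).Holds s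
  set : ∀ α ∈ I, ∀ t ∈ α.atoms, (world L α t).Holds s
  unique : ∀ α ∈ I, ∀ t ∈ A, ∀ t' ∈ A, t.1 = t'.1 → (world L α t).Holds s →
    (world L α t').Holds s → (t.2 : ℕ) = t'.2
  other : ∀ α ∈ I, ∀ t ∈ A, s t.1 = t.2 → ∃ t' ∈ A, t.1 = t'.1 ∧ (world L α t').Holds s
  determined : ∀ α ∈ I, ∀ α' ∈ I, ∀ t ∈ A, (∀ t' ∈ α.atoms, t.1 ≠ t'.1) →
    (∀ t' ∈ α'.atoms, t.1 ≠ t'.1) →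
    (∀ t' ∈ A, (order L t'.1 t.1 : LProp S).Holds s →
      ((world L α t').Holds s ↔ (world L α' t').Holds s)) →
    ((world L α t).Holds s ↔ (world L α' t).Holds s)

theorem holds_consistency {L : ℕ} {A : List (Σ n, S.Val n)} {I : List (LInt S)}
    {s : Assignment S} : (consistency L A I).Holds s ↔ Describes L A I s := by
  have h₁ : (∀ β ∈ irreflClauses L A, β.Holds s) ↔
      ∀ t ∈ A, ¬ (order L t.1 t.1 : LProp S).Holds s := by
    simp only [irreflClauses, List.mem_map]
    exact ⟨fun h t ht => h _ ⟨t, ht, rfl⟩, by rintro h _ ⟨t, ht, rfl⟩; exact h t ht⟩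
  have h₂ : (∀ β ∈ transClauses L A, β.Holds s) ↔
      ∀ t ∈ A, ∀ t' ∈ A, ∀ t'' ∈ A, (order L t.1 t'.1 : LProp S).Holds s →
        (order L t'.1 t''.1 : LProp S).Holds s → (order L t.1 t''.1 : LProp S).Holds s := by
    simp only [transClauses, List.mem_flatMap, List.mem_map]
    constructor
    · intro h t ht t' ht' t'' ht'' h₁ h₂
      by_contra h₃
      exact h _ ⟨t, ht, t', ht', t'', ht'', rfl⟩ ⟨h₁, h₂, h₃⟩
    · rintro h _ ⟨t, ht, t', ht', t'', ht'', rfl⟩ ⟨h₁, h₂, h₃⟩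
      exact h₃ (h t ht t' ht' t'' ht'' h₁ h₂)
  have h₃ : (∀ β ∈ setClauses L I, β.Holds s) ↔
      ∀ α ∈ I, ∀ t ∈ α.atoms, (world L α t).Holds s := by
    simp only [setClauses, List.mem_flatMap, List.mem_map]
    constructor
    · intro h α hα t ht
      exact h _ ⟨α, hα, t, ht, rfl⟩
    · rintro h _ ⟨α, hα, t, ht, rfl⟩
      exact h α hα t ht
  have h₄ : (∀ β ∈ uniqueClauses L A I, β.Holds s) ↔
      ∀ α ∈ I, ∀ t ∈ A, ∀ t' ∈ A, t.1 = t'.1 → (world L α t).Holds s →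
        (world L α t').Holds s → (t.2 : ℕ) = t'.2 := by
    simp only [uniqueClauses, List.mem_flatMap]
    constructor
    · intro h α hα t ht t' ht' htt' h₁ h₂
      by_contra hne
      exact h (.neg (.and (world L α t) (world L α t')))
        ⟨α, hα, t, ht, t', ht', by simp [htt', hne]⟩ ⟨h₁, h₂⟩
    · rintro h β ⟨α, hα, t, ht, t', ht', hβ⟩
      split_ifs at hβ with htt' hv
      · simp at hβ
      · obtain rfl := List.mem_singleton.1 hβ
        exact fun hh => hv (h α hα t ht t' ht' htt' hh.1 hh.2)
      · simp at hβ
  have h₅ : (∀ β ∈ otherClauses L A I, β.Holds s) ↔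
      ∀ α ∈ I, ∀ t ∈ A, s t.1 = t.2 → ∃ t' ∈ A, t.1 = t'.1 ∧ (world L α t').Holds s := by
    simp only [otherClauses, List.mem_flatMap, List.mem_map]
    constructor
    · intro h α hα t ht hs
      by_contra hne
      refine h _ ⟨α, hα, t, ht, rfl⟩ ⟨hs, (holds_all _ _).2 fun β hβ => ?_⟩
      obtain ⟨t', ht', hβ⟩ := List.mem_flatMap.1 hβ
      split_ifs at hβ with htt'
      · obtain rfl := List.mem_singleton.1 hβ
        exact fun hh => hne ⟨t', ht', htt', hh⟩
      · simp at hβ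
    · rintro h _ ⟨α, hα, t, ht, rfl⟩ ⟨hs, hall⟩
      obtain ⟨t', ht', htt', hw⟩ := h α hα t ht hs
      exact (holds_all _ _).1 hall (.neg (world L α t'))
        (List.mem_flatMap.2 ⟨t', ht', by simp [htt']⟩) hw
  have h₆ : (∀ β ∈ determinedClauses L A I, β.Holds s) ↔
      ∀ α ∈ I, ∀ α' ∈ I, ∀ t ∈ A, (∀ t' ∈ α.atoms, t.1 ≠ t'.1) →
        (∀ t' ∈ α'.atoms, t.1 ≠ t'.1) →
        (∀ t' ∈ A, (order L t'.1 t.1 : LProp S).Holds s →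
          ((world L α t').Holds s ↔ (world L α' t').Holds s)) →
        ((world L α t).Holds s ↔ (world L α' t).Holds s) := by
    simp only [determinedClauses, List.mem_flatMap, List.mem_map]
    constructor
    · intro h α hα α' hα' t ht hd hd' hp
      by_contra hne
      refine h _ ⟨α, hα, α', hα', t, ht, rfl⟩ ((holds_all _ _).2 fun β hβ => ?_)
      rcases List.mem_append.1 hβ with hβ | hβ
      · obtain ⟨t', ht', hβ⟩ := List.mem_flatMap.1 hβ
        rcases List.mem_append.1 ht' with ht' | ht'
        · rw [if_neg (hd t' ht')] at hβ; simp at hβ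
        · rw [if_neg (hd' t' ht')] at hβ; simp at hβ
      rcases List.mem_append.1 hβ with hβ | hβ
      · obtain ⟨t', ht', rfl⟩ := List.mem_map.1 hβ
        rintro ⟨ho, hh⟩
        exact hh ((holds_equiv _ _ _).2 (hp t' ht' ho))
      · obtain rfl := List.mem_singleton.1 hβ
        exact fun hh => hne ((holds_equiv _ _ _).1 hh)
    · rintro h _ ⟨α, hα, α', hα', t, ht, rfl⟩ hall
      have hall := (holds_all _ _).1 hall
      have hblock : ∀ t' ∈ α.atoms ++ α'.atoms, t.1 ≠ t'.1 := by
        intro t' ht' htt'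
        exact hall (.neg taut) (List.mem_append_left _
          (List.mem_flatMap.2 ⟨t', ht', by simp [htt']⟩)) (holds_taut s)
      refine hall _ (List.mem_append_right _ (List.mem_append_right _ (List.mem_singleton.2 rfl)))
        ((holds_equiv _ _ _).2 (h α hα α' hα' t ht
          (fun t' ht' => hblock t' (List.mem_append_left _ ht'))
          (fun t' ht' => hblock t' (List.mem_append_right _ ht')) fun t' ht' ho => ?_))
      by_contra hne
      exact hall _ (List.mem_append_right _ (List.mem_append_left _ (List.mem_map.2
        ⟨t', ht', rfl⟩))) ⟨ho, fun hh => hne ((holds_equiv _ _ _).1 hh)⟩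
  rw [consistency, holds_all]
  simp only [List.forall_mem_append, h₁, h₂, h₃, h₄, h₅, h₆]
  exact ⟨fun ⟨a, b, c, d, e, f⟩ => ⟨a, b, c, d, e, f⟩, fun h => ⟨h.1, h.2, h.3, h.4, h.5, h.6⟩⟩

/-- The truth of the reduced formula in a measurable model. -/
theorem holds_reduct {M : SCM S} (hM : M.IsMeasurable) (L : ℕ) (φ : LCausal S OP) :
    ((reduct L φ).Holds fun ε => (M.P {u | M.ModelsProp u ε}).toReal) ↔
      (∀ t ∈ φ.atoms, ∀ t' ∈ φ.atoms, (∀ᵐ u ∂M.P, M.ModelsProp u (order L t.1 t'.1)) ∨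
        ∀ᵐ u ∂M.P, ¬ M.ModelsProp u (order L t.1 t'.1)) ∧
      ((φ.map (LFull.toProp L)).Holds fun ε => (M.P {u | M.ModelsProp u ε}).toReal) ∧
      ∀ᵐ u ∂M.P, Describes L φ.atoms φ.boxes (M.solution (fun _ => none) u) := by
  have hc : ∀ β : LProp S,
      ((Formula.constant β : LProb S OP).Holds fun ε => (M.P {u | M.ModelsProp u ε}).toReal) ↔
        (∀ᵐ u ∂M.P, M.ModelsProp u β) ∨ ∀ᵐ u ∂M.P, ¬ M.ModelsProp u β := by
    intro β
    have h₂ := hM.le_prob_iff (.neg β)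
    simp only [Formula.constant, Formula.Holds, Term.value, hM.le_prob_iff, not_and_or, not_not]
    rfl
  have hg : (∀ᵐ u ∂M.P, M.ModelsProp u (consistency L φ.atoms φ.boxes)) ↔
      ∀ᵐ u ∂M.P, Describes L φ.atoms φ.boxes (M.solution (fun _ => none) u) := by
    simp only [SCM.ModelsProp, holds_consistency]
  rw [reduct, Formula.holds_foldr_and]
  simp only [List.mem_flatMap, List.mem_map, Formula.Holds, Term.value, hM.le_prob_iff, hg]
  refine and_congr ?_ Iff.rfl
  constructor
  · intro h t ht t' ht'
    exact (hc _).1 (h _ ⟨t, ht, t', ht', rfl⟩)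
  · rintro h _ ⟨t, ht, t', ht', rfl⟩
    exact (hc _).2 (h t ht t' ht')

/-! ### From the reduced formula to the causal formula -/

section Sound

/-- A value that is not mentioned in `A`, if there is one. -/
noncomputable def otherValue (A : List (Σ n, S.Val n)) (n : ℕ) : S.Val n :=
  Classical.epsilon fun v => ⟨n, v⟩ ∉ A

theorem otherValue_notMem {A : List (Σ n, S.Val n)} {n : ℕ} {v : S.Val n} (h : ⟨n, v⟩ ∉ A) :
    (⟨n, otherValue A n⟩ : Σ n, S.Val n) ∉ A :=
  Classical.epsilon_spec (p := fun v => (⟨n, v⟩ : Σ n, S.Val n) ∉ A) ⟨v, h⟩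

variable (L : ℕ) (A : List (Σ n, S.Val n)) (I : List (LInt S)) (o : ℕ → ℕ → Prop)

/-- According to the propositional variables, `Vₙ` has the mentioned value `v` under the
intervention `α`. -/
def IsWorldValue (α : LInt S) (s : Assignment S) (n : ℕ) (v : S.Val n) : Prop :=
  ⟨n, v⟩ ∈ A ∧ (world L α ⟨n, v⟩).Holds s

open scoped Classical in
/-- The value of `Vₙ` under the intervention `α` according to the propositional variables. -/
noncomputable def worldValue (α : LInt S) (s : Assignment S) (n : ℕ) : S.Val n :=
  if ∃ v, IsWorldValue L A α s n v then Classical.epsilon (IsWorldValue L A α s n)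
  else otherValue A n

instance : Nonempty (LInt S) := ⟨.top⟩

/-- The intervention `α` does not set `Vₙ`, and it gives the predecessors of `Vₙ` the values `v`. -/
def IsSource (n : ℕ) (v s : Assignment S) (α : LInt S) : Prop :=
  α ∈ I ∧ (∀ t ∈ α.atoms, n ≠ t.1) ∧ ∀ t ∈ A, o t.1 n → v t.1 = worldValue L A α s t.1

open scoped Classical in
/-- The structural functions of the model that is built from the propositional variables: the value
of `Vₙ` is the one that it has under some intervention which gives its predecessors the values
`v`. -/
noncomputable def structural (n : ℕ) (v s : Assignment S) : S.Val n :=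
  if ∃ α, IsSource L A I o n v s α then
    worldValue L A (Classical.epsilon (IsSource L A I o n v s)) s n
  else S.zero n

variable {L A I o}

theorem Describes.worldValue_eq_iff {s : Assignment S} (h : Describes L A I s) {α : LInt S}
    (hα : α ∈ I) {n : ℕ} {v : S.Val n} (hv : ⟨n, v⟩ ∈ A) :
    worldValue L A α s n = v ↔ (world L α ⟨n, v⟩).Holds s := by
  rw [worldValue]
  split_ifs with hex
  · obtain ⟨h₁, h₂⟩ := Classical.epsilon_spec hex
    constructor
    · intro heq
      rwa [heq] at h₂
    · intro hw
      exact Fin.ext (h.unique α hα _ h₁ _ hv rfl h₂ hw)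
  · refine ⟨fun heq => absurd hv ?_, fun hw => absurd ⟨v, hv, hw⟩ hex⟩
    -- The actual value of the variable is not mentioned, so there is a value that is not mentioned.
    rw [← heq]
    refine otherValue_notMem (v := s n) fun hs => ?_
    obtain ⟨⟨m, w⟩, hw, hm, hh⟩ := h.other α hα _ hs rfl
    obtain rfl : n = m := hm
    exact hex ⟨w, hw, hh⟩

theorem worldValue_congr {s s' : Assignment S} {α α' : LInt S} {n : ℕ}
    (hn : ∀ v : S.Val n, ⟨n, v⟩ ∈ A →
      ((world L α ⟨n, v⟩).Holds s ↔ (world L α' ⟨n, v⟩).Holds s')) :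
    worldValue L A α s n = worldValue L A α' s' n := by
  have : IsWorldValue L A α s n = IsWorldValue L A α' s' n := by
    funext v
    exact propext (and_congr_right (hn v))
  unfold worldValue
  rw [this]

/-- In the model that is built, the interventions have the values that the propositional variables
describe. -/
theorem Describes.solution_eq {M : SCM S} (hM : M.IsRecursive) {r : ℕ → ℕ → Prop}
    (hr : WellFounded r) {u : M.ExoAssignment} {s : Assignment S} (h : Describes L A I s)
    (ho : ∀ t ∈ A, ∀ t' ∈ A, o t.1 t'.1 ↔ (order L t.1 t'.1 : LProp S).Holds s)
    (hor : ∀ t ∈ A, ∀ t' ∈ A, o t.1 t'.1 → r t.1 t'.1)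
    (hF : ∀ n v, M.F n v u = structural L A I o n v s)
    {α : LInt S} (hα : α ∈ I) (hc : α.Consistent) (hαA : ∀ t ∈ α.atoms, t ∈ A) (n : ℕ) :
    ∀ t ∈ A, t.1 = n → M.solution α.toIntervention u t.1 = worldValue L A α s t.1 := by
  induction n using hr.induction with
  | _ n ih =>
    rintro ⟨n, v⟩ ht rfl
    have hsol := hM.isSolution_solution α.toIntervention u n
    simp only [SCM.intervene] at hsol
    by_cases hd : ∃ w : S.Val n, ⟨n, w⟩ ∈ α.conjuncts
    · obtain ⟨w, hw⟩ := hd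
      rw [LInt.toIntervention_of_mem hc hw, Option.getD_some] at hsol
      rw [hsol]
      have hw' := LInt.mem_atoms.2 hw
      exact ((h.worldValue_eq_iff hα (hαA _ hw')).2 (h.set α hα _ hw')).symm
    · rw [LInt.toIntervention_eq_none hd, Option.getD_none, hF] at hsol
      have hdα : ∀ t ∈ α.atoms, n ≠ t.1 := by
        rintro ⟨m, w⟩ hm rfl
        exact hd ⟨w, LInt.mem_atoms.1 hm⟩
      have hs : ∃ α', IsSource L A I o n (M.solution α.toIntervention u) s α' :=
        ⟨α, hα, hdα, fun t' ht' hot => ih _ (hor _ ht' _ ht hot) t' ht' rfl⟩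
      rw [structural, if_pos hs] at hsol
      generalize hα' : Classical.epsilon
        (IsSource L A I o n (M.solution α.toIntervention u) s) = α' at hsol
      have hs' : IsSource L A I o n (M.solution α.toIntervention u) s α' := by
        rw [← hα']; exact Classical.epsilon_spec hs
      obtain ⟨hα'I, hdα', hα'⟩ := hs'
      refine hsol.trans ?_
      refine worldValue_congr fun w hw => h.determined α' hα'I α hα ⟨n, w⟩ hw hdα' hdα ?_
      rintro ⟨m, x⟩ hm hom
      have hom : o m n := (ho _ hm _ ht).2 hom
      rw [← h.worldValue_eq_iff hα'I hm, ← h.worldValue_eq_iff hα hm, ← hα' _ hm hom,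
        ih _ (hor _ hm _ ht hom) _ hm rfl]

/-- The structural functions depend only on the propositional variables for `A` and `I`. -/
theorem structural_congr {s s' : Assignment S}
    (h : ∀ α ∈ I, ∀ t ∈ A, (world L α t).Holds s ↔ (world L α t).Holds s') :
    (structural L A I o · · s) = (structural L A I o · · s') := by
  have hw : ∀ α ∈ I, ∀ n, worldValue L A α s n = worldValue L A α s' n := by
    exact fun α hα n => worldValue_congr fun v hv => h α hα ⟨n, v⟩ hv
  funext n v
  have hs : IsSource L A I o n v s = IsSource L A I o n v s' := by
    funext α
    refine propext (and_congr_right fun hα => and_congr_right fun _ => ?_)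
    simp only [hw α hα]
  unfold structural
  rw [hs]
  split_ifs with hex
  · exact hw _ (Classical.epsilon_spec hex).1 n
  · rfl

/-- A relation that is irreflexive and transitive on a finite set of numbers is contained in a
well-order of all numbers. -/
theorem exists_isWellOrder (s : Finset ℕ) (hirr : ∀ m ∈ s, ¬ o m m)
    (htrans : ∀ l ∈ s, ∀ m ∈ s, ∀ n ∈ s, o l m → o m n → o l n) :
    ∃ r : ℕ → ℕ → Prop, IsWellOrder ℕ r ∧ ∀ m ∈ s, ∀ n ∈ s, o m n → r m n := by
  classical
  -- Order first by the number of predecessors.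
  let rank : ℕ → ℕ := fun n => (s.filter fun m => o m n).card
  let f : ℕ ↪ ℕ ×ₗ ℕ := ⟨fun n => toLex (rank n, n), fun m n h => (Prod.ext_iff.1 h).2⟩
  refine ⟨f ⁻¹'o (· < ·), (RelEmbedding.preimage f (· < ·)).isWellOrder, fun m hm n hn hmn => ?_⟩
  refine Prod.Lex.toLex_lt_toLex.2 (Or.inl (Finset.card_lt_card ?_))
  refine (Finset.ssubset_iff_of_subset fun l hl => ?_).2 ⟨m, by simp [hm, hmn], by simp [hirr m hm]⟩
  rw [Finset.mem_filter] at hl ⊢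
  exact ⟨hl.1, htrans l hl.1 m hm n hn hl.2 hmn⟩

/-- The exogenous assignments are kept; the structural functions are read off from the values of
the propositional variables. Since the variables for the order are almost surely constant, one
well-order works for almost all exogenous assignments. -/
theorem satCausal_of_satProb_reduct (L : ℕ) (φ : LCausal S OP) (h : SATProb (reduct L φ)) :
    SATCausal φ := by
  obtain ⟨M, -, hmeas, h⟩ := h
  obtain ⟨hconst, hφ, hdesc⟩ := (holds_reduct hmeas L φ).1 h
  let _ := M.sigma
  have := M.isProbabilityMeasure
  let sol : M.ExoAssignment → Assignment S := M.solution fun _ => none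
  let o : ℕ → ℕ → Prop := fun m n => ∀ᵐ u ∂M.P, M.ModelsProp u (order L m n)
  have hgood : ∀ᵐ u ∂M.P, Describes L φ.atoms φ.boxes (sol u) ∧
      ∀ t ∈ φ.atoms, ∀ t' ∈ φ.atoms, o t.1 t'.1 ↔ (order L t.1 t'.1 : LProp S).Holds (sol u) := by
    refine hdesc.and ?_
    have hfin : {t | t ∈ φ.atoms}.Countable := φ.atoms.finite_toSet.countable
    refine (ae_ball_iff hfin).2 fun t ht => (ae_ball_iff hfin).2 fun t' ht' => ?_
    rcases hconst t ht t' ht' with hc | hc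
    · exact hc.mono fun u hu => iff_of_true hc hu
    · exact hc.mono fun u hu => iff_of_false (fun ho => by
        obtain ⟨u, h₁, h₂⟩ := (hc.and ho).exists
        exact h₁ h₂) hu
  obtain ⟨u₀, hdesc₀, ho₀⟩ := hgood.exists
  obtain ⟨r, hr, hor⟩ := exists_isWellOrder (o := o) (φ.atoms.map Sigma.fst).toFinset
    (by
      intro m hm
      obtain ⟨t, ht, rfl⟩ := List.mem_map.1 (List.mem_toFinset.1 hm)
      rw [ho₀ t ht t ht]
      exact hdesc₀.irrefl t ht)
    (by
      intro l hl m hm n hn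
      obtain ⟨t, ht, rfl⟩ := List.mem_map.1 (List.mem_toFinset.1 hl)
      obtain ⟨t', ht', rfl⟩ := List.mem_map.1 (List.mem_toFinset.1 hm)
      obtain ⟨t'', ht'', rfl⟩ := List.mem_map.1 (List.mem_toFinset.1 hn)
      rw [ho₀ t ht t' ht', ho₀ t' ht' t'' ht'', ho₀ t ht t'' ht'']
      exact hdesc₀.trans t ht t' ht' t'' ht'')
  have hor' : ∀ t ∈ φ.atoms, ∀ t' ∈ φ.atoms, o t.1 t'.1 → r t.1 t'.1 := fun t ht t' ht' =>
    hor _ (List.mem_toFinset.2 (List.mem_map_of_mem ht)) _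
      (List.mem_toFinset.2 (List.mem_map_of_mem ht'))
  -- The relation `o` need not be contained in `r` outside the variables that are mentioned.
  let o' : ℕ → ℕ → Prop := fun m n => o m n ∧ r m n
  have ho' : ∀ t ∈ φ.atoms, ∀ t' ∈ φ.atoms, o' t.1 t'.1 ↔ o t.1 t'.1 := fun t ht t' ht' =>
    and_iff_left_of_imp (hor' t ht t' ht')
  let M' : SCM S := { M with F := fun n v u => structural L φ.atoms φ.boxes o' n v (sol u) }
  have hrec : M'.IsRecursive := by
    refine ⟨r, hr, fun n v₁ v₂ u hv => ?_⟩
    have : IsSource L φ.atoms φ.boxes o' n v₁ (sol u) =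
        IsSource L φ.atoms φ.boxes o' n v₂ (sol u) := by
      funext α
      refine propext (and_congr_right fun _ => and_congr_right fun _ => ?_)
      refine forall_congr' fun t => forall_congr' fun _ => forall_congr' fun hrt => ?_
      rw [hv _ hrt.2]
    change structural _ _ _ _ _ _ _ = structural _ _ _ _ _ _ _
    unfold structural
    rw [this]
  have hmeas' : M'.IsMeasurable := by
    intro i _
    -- The solution is a function of finitely many endogenous variables of `M`.
    have : Measurable fun s : Assignment S => Classical.epsilon fun v : Assignment S =>
        ∀ n, v n = (i n).getD (structural L φ.atoms φ.boxes o' n v s) := by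
      refine measurable_of_finset (φ.boxes.flatMap fun α => φ.atoms.map fun t =>
        freshIndex L (worldName α t.1 t.2)).toFinset fun s s' hss' => ?_
      have := structural_congr (L := L) (A := φ.atoms) (I := φ.boxes) (o := o') (s := s) (s' := s')
        fun α hα t ht => by
          simp only [world, fresh, Holds]
          rw [hss']
          exact List.mem_toFinset.2 (List.mem_flatMap.2 ⟨α, hα, List.mem_map.2 ⟨t, ht, rfl⟩⟩)
      have h' : ∀ n v, structural L φ.atoms φ.boxes o' n v s =
        structural L φ.atoms φ.boxes o' n v s' := fun n v => congrFun (congrFun this n) v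
      simp only [h']
    exact this.comp (hmeas (fun _ => none) (by simp))
  refine ⟨M', hrec, hmeas', ?_⟩
  refine (Formula.holds_map φ fun ε hε => ?_).1 hφ
  congr 1
  refine measure_congr ?_
  filter_upwards [hgood] with u hu
  refine propext ?_
  change M'.ModelsFull u ε ↔ M.ModelsProp u (ε.toProp L)
  refine (LFull.holds_toProp ε fun α hα t ht => ?_).symm
  have hα' : α ∈ φ.boxes := List.mem_flatMap.2 ⟨ε, hε, hα⟩
  have ht' : t ∈ φ.atoms := List.mem_flatMap.2 ⟨ε, hε, ht⟩
  rw [hu.1.solution_eq (M := M') (o := o') (r := r) (u := u) hrec hr.toIsWellFounded.wf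
    (fun t ht t' ht' => (ho' t ht t' ht').trans (hu.2 t ht t' ht'))
    (fun _ _ _ _ h => h.2) (fun n v => rfl) hα' (LCausal.consistent_of_mem_boxes hα')
    (fun t ht => LCausal.mem_atoms_of_mem_boxes hα' ht) t.1 t ht' rfl,
    hu.1.worldValue_eq_iff hα' ht']

end Sound

end

section

open LProp

variable {S : Signature} {OP : Set Operation}

/-! ### From the causal formula to the reduced formula -/

section Complete

/-- The truth values of the propositional variables that come from a recursive model. -/
def SCM.FreshTrue (M : SCM S) (r : ℕ → ℕ → Prop) (u : M.ExoAssignment) (l : List Sym) : Prop :=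
  (∃ (α : LInt S) (n : ℕ) (v : S.Val n), l = worldName α n v ∧
    M.solution α.toIntervention u n = v) ∨
  ∃ m n, l = orderName m n ∧ r m n

variable {M : SCM S} {r : ℕ → ℕ → Prop}

theorem SCM.freshTrue_worldName {u : M.ExoAssignment} {α : LInt S} {n : ℕ} {v : S.Val n} :
    M.FreshTrue r u (worldName α n v) ↔ M.solution α.toIntervention u n = v := by
  constructor
  · rintro (⟨α', n', v', h, hs⟩ | ⟨i, j, h, -⟩)
    · obtain ⟨rfl, rfl, hv⟩ := worldName_inj h
      rw [hs, Fin.ext hv]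
    · exact absurd h (worldName_ne_orderName _ _ _ _ _)
  · exact fun h => Or.inl ⟨α, n, v, rfl, h⟩

theorem SCM.freshTrue_orderName {u : M.ExoAssignment} {m n : ℕ} :
    M.FreshTrue r u (orderName m n) ↔ r m n := by
  constructor
  · rintro (⟨α', n', v', h, -⟩ | ⟨i, j, h, hr⟩)
    · exact absurd h.symm (worldName_ne_orderName _ _ _ _ _)
    · obtain ⟨rfl, rfl⟩ := orderName_inj h
      exact hr
  · exact fun h => Or.inr ⟨m, n, rfl, h⟩

theorem SCM.IsMeasurable.measurableSet_freshTrue (h : M.IsMeasurable) (l : List Sym) :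
    @MeasurableSet _ M.sigma {u | M.FreshTrue r u l} := by
  let _ := M.sigma
  by_cases hl : ∃ (α : LInt S) (n : ℕ) (v : S.Val n), l = worldName α n v
  · obtain ⟨α, n, v, rfl⟩ := hl
    simp only [freshTrue_worldName]
    exact (h α.toIntervention α.finite_toIntervention)
      (measurable_pi_apply n (measurableSet_singleton v))
  · have : {u | M.FreshTrue r u l} = {_u | ∃ m n, l = orderName m n ∧ r m n} := by
      ext u
      exact or_iff_right fun ⟨α, n, v, h, _⟩ => hl ⟨α, n, v, h⟩
    rw [this]
    exact MeasurableSet.const _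

open scoped Classical in
/-- The value of a fresh variable encodes the truth of its propositional variable. The other
variables avoid the values that are mentioned in `A`, if they can. -/
noncomputable def SCM.freshValue (M : SCM S) (r : ℕ → ℕ → Prop) (L : ℕ)
    (A : List (Σ n, S.Val n)) (k : ℕ) (u : M.ExoAssignment) : S.Val k :=
  if h : ∃ l, k = freshIndex L l then
    if M.FreshTrue r u h.choose then S.zero k else S.one k
  else otherValue A k

theorem SCM.freshValue_freshIndex {L : ℕ} {A : List (Σ n, S.Val n)} {u : M.ExoAssignment}
    {l : List Sym} : M.freshValue r L A (freshIndex L l) u = S.zero _ ↔ M.FreshTrue r u l := by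
  have h : ∃ l', freshIndex L l = freshIndex L l' := ⟨l, rfl⟩
  have hl : h.choose = l := (freshIndex_injective L h.choose_spec).symm
  rw [freshValue, dif_pos h, hl]
  split_ifs with ht
  · simp [ht]
  · simp [ht, S.one_ne_zero]

theorem SCM.freshValue_of_ne {L : ℕ} {A : List (Σ n, S.Val n)} {u : M.ExoAssignment} {k : ℕ}
    (hk : ∀ l, freshIndex L l ≠ k) : M.freshValue r L A k u = otherValue A k := by
  rw [freshValue, dif_neg]
  rintro ⟨l, rfl⟩
  exact hk l rfl

theorem SCM.IsMeasurable.measurable_freshValue (h : M.IsMeasurable) (L : ℕ)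
    (A : List (Σ n, S.Val n)) (k : ℕ) :
    @Measurable _ _ M.sigma _ (M.freshValue r L A k) := by
  classical
  let _ := M.sigma
  by_cases hk : ∃ l, k = freshIndex L l
  · have : M.freshValue r L A k = fun u =>
        if M.FreshTrue r u hk.choose then S.zero k else S.one k := by
      funext u
      rw [freshValue, dif_pos hk]
    rw [this]
    exact Measurable.ite (h.measurableSet_freshTrue _) measurable_const measurable_const
  · have : M.freshValue r L A k = fun u => otherValue A k := by
      funext u
      rw [freshValue, dif_neg hk]
    rw [this]
    exact measurable_const

theorem SCM.isMeasurable_withValues (M : SCM S) {f : ∀ n, M.ExoAssignment → S.Val n}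
    (hf : ∀ n, @Measurable _ _ M.sigma _ (f n)) : (M.withValues f).IsMeasurable := by
  intro i _
  refine @measurable_pi_lambda _ _ _ M.sigma _ _ fun n => ?_
  simp only [solution_withValues]
  cases i n with
  | none => exact hf n
  | some v => exact @measurable_const _ _ _ M.sigma v

/-- If the predecessors of `Vₙ` have the same mentioned values under `α` and under `α'`, then they
have the same values. Indeed, the first variable with different values would be set by one of the
interventions, so one of its values would be mentioned. -/
theorem SCM.IsRecursive.solution_eq_of_forall_atoms (hM : M.IsRecursive) [IsWellOrder ℕ r]
    (hF : ∀ (n : ℕ) (v₁ v₂ : Assignment S) (u : M.ExoAssignment),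
      (∀ m, r m n → v₁ m = v₂ m) → M.F n v₁ u = M.F n v₂ u)
    {u : M.ExoAssignment} {A : List (Σ n, S.Val n)} {α α' : LInt S} (hα : α.Consistent)
    (hα' : α'.Consistent) (hA : ∀ t ∈ α.atoms, t ∈ A) (hA' : ∀ t ∈ α'.atoms, t ∈ A) {n : ℕ}
    (hn : ∀ t ∈ A, r t.1 n → (M.solution α.toIntervention u t.1 = t.2 ↔
      M.solution α'.toIntervention u t.1 = t.2)) (m : ℕ) :
    r m n → M.solution α.toIntervention u m = M.solution α'.toIntervention u m := by
  induction m using (IsWellFounded.wf (r := r)).induction with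
  | _ m ih =>
    intro hmn
    have h₁ := hM.isSolution_solution α.toIntervention u m
    have h₂ := hM.isSolution_solution α'.toIntervention u m
    simp only [SCM.intervene] at h₁ h₂
    by_cases hd : ∃ v : S.Val m, ⟨m, v⟩ ∈ α.conjuncts
    · obtain ⟨v, hv⟩ := hd
      rw [LInt.toIntervention_of_mem hα hv, Option.getD_some] at h₁
      rw [h₁, (hn ⟨m, v⟩ (hA _ (LInt.mem_atoms.2 hv)) hmn).1 h₁]
    by_cases hd' : ∃ v : S.Val m, ⟨m, v⟩ ∈ α'.conjuncts
    · obtain ⟨v, hv⟩ := hd'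
      rw [LInt.toIntervention_of_mem hα' hv, Option.getD_some] at h₂
      rw [h₂, (hn ⟨m, v⟩ (hA' _ (LInt.mem_atoms.2 hv)) hmn).2 h₂]
    rw [LInt.toIntervention_eq_none hd, Option.getD_none] at h₁
    rw [LInt.toIntervention_eq_none hd', Option.getD_none] at h₂
    rw [h₁, h₂]
    exact hF m _ _ u fun l hl => ih l hl (_root_.trans hl hmn)

/-- The variables that are mentioned keep a value of their own that is mentioned only if all their
values are, and the fresh variables get the truth values that come from the causal model. -/
theorem satProb_reduct_of_satCausal {L : ℕ} {φ : LCausal S OP}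
    (hL : ∀ t ∈ φ.atoms, (Nat.bits t.1).length ≤ L) (h : SATCausal φ) :
    SATProb (reduct L φ) := by
  obtain ⟨M, hrec, hmeas, hφ⟩ := h
  obtain ⟨r, hr, hF⟩ := id hrec
  let M' := M.withValues (M.freshValue r L φ.atoms)
  have hmeas' : M'.IsMeasurable :=
    M.isMeasurable_withValues fun k => hmeas.measurable_freshValue L φ.atoms k
  have hsol : ∀ (u : M.ExoAssignment) k, M'.solution (fun _ => none) u k = M.freshValue r L φ.atoms k u :=
    fun u k => M.solution_withValues _ _ u k
  have hworld : ∀ (u : M.ExoAssignment) (α : LInt S) t, (world L α t).Holds (M'.solution (fun _ => none) u) ↔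
      M.solution α.toIntervention u t.1 = t.2 := by
    intro u α t
    simp only [world, fresh, Holds, hsol]
    exact SCM.freshValue_freshIndex.trans SCM.freshTrue_worldName
  have horder : ∀ (u : M.ExoAssignment) m n, (order L m n : LProp S).Holds (M'.solution (fun _ => none) u) ↔
      r m n := by
    intro u m n
    simp only [order, fresh, Holds, hsol]
    exact SCM.freshValue_freshIndex.trans SCM.freshTrue_orderName
  have hother : ∀ u : M.ExoAssignment, ∀ t ∈ φ.atoms, M'.solution (fun _ => none) u t.1 = otherValue φ.atoms t.1 :=
    fun u t ht => (hsol u t.1).trans (SCM.freshValue_of_ne (freshIndex_ne (hL t ht)))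
  refine ⟨M', M.isRecursive_withValues _, hmeas', (holds_reduct hmeas' L φ).2 ⟨?_, ?_, ?_⟩⟩
  · intro t _ t' _
    by_cases hrt : r t.1 t'.1
    · exact Or.inl (Filter.Eventually.of_forall fun u => (horder u _ _).2 hrt)
    · exact Or.inr (Filter.Eventually.of_forall fun u => mt (horder u _ _).1 hrt)
  · refine (Formula.holds_map φ fun ε hε => ?_).2 hφ
    have : {u | M.ModelsFull u ε} = {u | M'.ModelsProp u (ε.toProp L)} := by
      ext u
      exact (LFull.holds_toProp ε fun α _ t _ => hworld u α t).symm
    rw [this]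
    rfl
  · refine Filter.Eventually.of_forall fun (u : M.ExoAssignment) => ?_
    constructor
    · intro t _
      rw [horder]
      exact irrefl _
    · intro t _ t' _ t'' _
      rw [horder, horder, horder]
      exact _root_.trans
    · rintro α hα ⟨n, v⟩ ht
      rw [hworld]
      have h := hrec.isSolution_solution α.toIntervention u n
      simp only [SCM.intervene] at h
      rwa [LInt.toIntervention_of_mem (LCausal.consistent_of_mem_boxes hα)
        (LInt.mem_atoms.1 ht), Option.getD_some] at h
    · rintro α _ ⟨n, v⟩ _ ⟨n', v'⟩ _ rfl
      rw [hworld, hworld]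
      intro h₁ h₂
      exact congrArg Fin.val (h₁.symm.trans h₂)
    · rintro α hα ⟨n, v⟩ ht hv
      have hv : M'.solution (fun _ => none) u n = v := hv
      refine ⟨⟨n, M.solution α.toIntervention u n⟩, ?_, rfl, (hworld _ _ _).2 rfl⟩
      -- All values of the variable are mentioned: the chosen value `v` is.
      by_contra hne
      refine otherValue_notMem hne ?_
      rw [← hother u _ ht]
      simpa only [hv] using ht
    · rintro α hα α' hα' ⟨n, v⟩ _ hd hd' hp
      rw [hworld, hworld]
      have hc := LCausal.consistent_of_mem_boxes hα
      have hc' := LCausal.consistent_of_mem_boxes hα'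
      have hpred := hrec.solution_eq_of_forall_atoms hF (u := u) (n := n) hc hc'
        (fun t ht => LCausal.mem_atoms_of_mem_boxes hα ht)
        (fun t ht => LCausal.mem_atoms_of_mem_boxes hα' ht) fun t ht hrt => by
          rw [← hworld, ← hworld]
          exact hp t ht ((horder u _ _).2 hrt)
      have h₁ := hrec.isSolution_solution α.toIntervention u n
      have h₂ := hrec.isSolution_solution α'.toIntervention u n
      simp only [SCM.intervene] at h₁ h₂
      rw [LInt.toIntervention_eq_none, Option.getD_none] at h₁
      · rw [LInt.toIntervention_eq_none, Option.getD_none] at h₂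
        · rw [h₁, h₂, hF n _ _ u hpred]
        · rintro ⟨w, hw⟩
          exact hd' _ (LInt.mem_atoms.2 hw) rfl
      · rintro ⟨w, hw⟩
        exact hd _ (LInt.mem_atoms.2 hw) rfl

end Complete

theorem satCausal_iff_satProb_reduct {L : ℕ} {φ : LCausal S OP}
    (hL : ∀ t ∈ φ.atoms, (Nat.bits t.1).length ≤ L) : SATCausal φ ↔ SATProb (reduct L φ) :=
  ⟨satProb_reduct_of_satCausal hL, satCausal_of_satProb_reduct L φ⟩

end

/-! ### Tokens of a causal formula -/

/-- The symbols that are not part of a numeral, of an assignment, or of a bracket. -/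
def Sym.isPlain : Sym → Bool
  | .top => true
  | .neg => true
  | .and => true
  | .prob => true
  | .rpar => true
  | .ge => true
  | _ => false

/-- The parts of which the code of an intervention and of a propositional formula consists. -/
inductive Piece (S : Signature) : Type
  | sym (s : Sym) (hs : s.isPlain = true)
  | atom (t : Σ n, S.Val n)

/-- The parts of which the code of a causal formula consists: single symbols, left parentheses with
the number of an operation, and formulas `[α] β`. -/
inductive Token (S : Signature) : Type
  | sym (s : Sym) (hs : s.isPlain = true)
  | lpar (k : ℕ)
  | box (α : LInt S) (β : LProp S)

section Tokens

variable {S : Signature} {OP : Set Operation} {B B' A : Type}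

def Piece.code : Piece S → List Sym
  | .sym s _ => [s]
  | .atom t => eqCode t.1 t.2

/-- Map the symbols by `o` and the assignments by `g`. -/
def Piece.out (o : Sym → List A) (g : (Σ n, S.Val n) → List A) : Piece S → List A
  | .sym s _ => o s
  | .atom t => g t

def LInt.pieces : LInt S → List (Piece S)
  | .top => [.sym .top (by decide)]
  | .eq n v => [.atom ⟨n, v⟩]
  | .and α β => .sym .and (by decide) :: (α.pieces ++ β.pieces)

def LProp.pieces : LProp S → List (Piece S)
  | .eq n v => [.atom ⟨n, v⟩]
  | .neg β => .sym .neg (by decide) :: β.pieces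
  | .and β γ => .sym .and (by decide) :: (β.pieces ++ γ.pieces)

theorem LInt.flatMap_code_pieces (α : LInt S) : α.pieces.flatMap Piece.code = α.code := by
  induction α with
  | top => rfl
  | eq n v => simp [pieces, Piece.code, code]
  | and α β ih₁ ih₂ => simp [pieces, Piece.code, code, ih₁, ih₂]

theorem LProp.flatMap_code_pieces (β : LProp S) : β.pieces.flatMap Piece.code = β.code := by
  induction β with
  | eq n v => simp [pieces, Piece.code, code]
  | neg β ih => simp [pieces, Piece.code, code, ih]
  | and β γ ih₁ ih₂ => simp [pieces, Piece.code, code, ih₁, ih₂]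

theorem LInt.flatMap_out_pieces (g : (Σ n, S.Val n) → List A) (α : LInt S) :
    α.pieces.flatMap (Piece.out (fun _ => []) g) = α.atoms.flatMap g := by
  induction α with
  | top => rfl
  | eq n v => simp [pieces, Piece.out, atoms]
  | and α β ih₁ ih₂ => simp [pieces, Piece.out, atoms, ih₁, ih₂]

theorem LProp.flatMap_out_pieces (g : (Σ n, S.Val n) → List A) (β : LProp S) :
    β.pieces.flatMap (Piece.out (fun _ => []) g) = β.atoms.flatMap g := by
  induction β with
  | eq n v => simp [pieces, Piece.out, atoms]
  | neg β ih => simp [pieces, Piece.out, atoms, ih]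
  | and β γ ih₁ ih₂ => simp [pieces, Piece.out, atoms, ih₁, ih₂]

theorem LProp.code_relativize (L : ℕ) (α : LInt S) (β : LProp S) :
    (β.relativize L α).code =
      β.pieces.flatMap (Piece.out (fun s => [s]) fun t => (world L α t).code) := by
  induction β with
  | eq n v => simp [pieces, Piece.out, relativize]
  | neg β ih => simp [pieces, Piece.out, relativize, code, ih]
  | and β γ ih₁ ih₂ => simp [pieces, Piece.out, relativize, code, ih₁, ih₂]

namespace Token

def code : Token S → List Sym
  | sym s _ => [s]
  | lpar k => .lpar :: natCode k
  | box α β => .box :: (α.code ++ β.code)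

/-- The code with a separator `none` after the intervention. -/
def markedCode : Token S → List (Option Sym)
  | sym s _ => [some s]
  | lpar k => some .lpar :: (natCode k).map some
  | box α β => some .box :: (α.code.map some ++ none :: β.code.map some)

def atoms : Token S → List (Σ n, S.Val n)
  | box α β => α.atoms ++ β.atoms
  | _ => []

def boxes : Token S → List (LInt S)
  | box α _ => [α]
  | _ => []

/-- The code of the translation. -/
def translation (L : ℕ) : Token S → List Sym
  | sym s _ => [s]
  | lpar k => .lpar :: natCode k
  | box α β => (β.relativize L α).code

end Token

def LFull.tokens : LFull S → List (Token S)
  | .box α _ β => [.box α β]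
  | .neg ε => .sym .neg (by decide) :: ε.tokens
  | .and ε ζ => .sym .and (by decide) :: (ε.tokens ++ ζ.tokens)

def Term.tokens [Encodable OP] (c : B → List (Token S)) : Term OP B → List (Token S)
  | .prob ε => .sym .prob (by decide) :: c ε
  | .app f args => .lpar (Encodable.encode f) ::
      ((List.ofFn fun i => (args i).tokens c).flatten ++ [.sym .rpar (by decide)])

def Formula.tokens [Encodable OP] (c : B → List (Token S)) : Formula OP B → List (Token S)
  | .ge t₁ t₂ => .sym .ge (by decide) :: (t₁.tokens c ++ t₂.tokens c)
  | .neg φ => .sym .neg (by decide) :: φ.tokens c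
  | .and φ ψ => .sym .and (by decide) :: (φ.tokens c ++ ψ.tokens c)

theorem Term.code_map [Encodable OP] (f : B → B') (c : B' → List Sym) (t : Term OP B) :
    (t.map f).code c = t.code (c ∘ f) := by
  induction t with
  | prob ε => rfl
  | app g args ih => simp only [map, code, ih]

theorem Formula.code_map [Encodable OP] (f : B → B') (c : B' → List Sym) (φ : Formula OP B) :
    (φ.map f).code c = φ.code (c ∘ f) := by
  induction φ with
  | ge t₁ t₂ => simp only [map, code, Term.code_map]
  | neg φ ih => simp only [map, code, ih]
  | and φ ψ ih₁ ih₂ => simp only [map, code, ih₁, ih₂]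

theorem flatMap_flatten_ofFn {k : ℕ} (h : B → List A) (f : Fin k → List B) :
    (List.ofFn f).flatten.flatMap h = (List.ofFn fun i => (f i).flatMap h).flatten := by
  rw [List.flatMap_def, List.map_flatten, List.map_ofFn, List.flatten_flatten, List.map_ofFn]
  rfl

section Fusion

variable [Encodable OP] {c : B → List (Token S)}

theorem Term.flatMap_tokens_eq_code {h : Token S → List Sym} {d : B → List Sym}
    (hs : ∀ s hs, h (.sym s hs) = [s]) (hl : ∀ k, h (.lpar k) = .lpar :: natCode k)
    (hc : ∀ ε, (c ε).flatMap h = d ε) (t : Term OP B) : (t.tokens c).flatMap h = t.code d := by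
  induction t with
  | prob ε => simp [tokens, code, hs, hc]
  | app g args ih =>
    simp only [tokens, code, List.flatMap_cons, List.flatMap_append, flatMap_flatten_ofFn,
      List.flatMap_nil, hs, hl, List.cons_append, List.append_nil,
      List.append_assoc, ih]

theorem Formula.flatMap_tokens_eq_code {h : Token S → List Sym} {d : B → List Sym}
    (hs : ∀ s hs, h (.sym s hs) = [s]) (hl : ∀ k, h (.lpar k) = .lpar :: natCode k)
    (hc : ∀ ε, (c ε).flatMap h = d ε) (φ : Formula OP B) :
    (φ.tokens c).flatMap h = φ.code d := by
  induction φ with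
  | ge t₁ t₂ => simp [tokens, code, hs, Term.flatMap_tokens_eq_code hs hl hc]
  | neg φ ih => simp [tokens, code, hs, ih]
  | and φ ψ ih₁ ih₂ => simp [tokens, code, hs, ih₁, ih₂]

theorem Term.flatMap_tokens_eq_bases {h : Token S → List A} {d : B → List A}
    (hs : ∀ s hs, h (.sym s hs) = []) (hl : ∀ k, h (.lpar k) = [])
    (hc : ∀ ε, (c ε).flatMap h = d ε) (t : Term OP B) :
    (t.tokens c).flatMap h = t.bases.flatMap d := by
  induction t with
  | prob ε => simp [tokens, bases, hs, hc]
  | app g args ih =>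
    simp only [tokens, bases, List.flatMap_cons, List.flatMap_append, flatMap_flatten_ofFn,
      List.flatMap_nil, hs, hl, List.nil_append, List.append_nil,
      ih]

theorem Formula.flatMap_tokens_eq_bases {h : Token S → List A} {d : B → List A}
    (hs : ∀ s hs, h (.sym s hs) = []) (hl : ∀ k, h (.lpar k) = [])
    (hc : ∀ ε, (c ε).flatMap h = d ε) (φ : Formula OP B) :
    (φ.tokens c).flatMap h = φ.bases.flatMap d := by
  induction φ with
  | ge t₁ t₂ => simp [tokens, bases, hs, Term.flatMap_tokens_eq_bases hs hl hc]
  | neg φ ih => simp [tokens, bases, hs, ih]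
  | and φ ψ ih₁ ih₂ => simp [tokens, bases, hs, ih₁, ih₂]

end Fusion

namespace LFull

theorem flatMap_code_tokens (ε : LFull S) : ε.tokens.flatMap Token.code = ε.code := by
  induction ε with
  | box α hα β => simp [tokens, Token.code, code]
  | neg ε ih => simp [tokens, Token.code, code, ih]
  | and ε ζ ih₁ ih₂ => simp [tokens, Token.code, code, ih₁, ih₂]

theorem flatMap_atoms_tokens (ε : LFull S) : ε.tokens.flatMap Token.atoms = ε.atoms := by
  induction ε with
  | box α hα β => simp [tokens, Token.atoms, atoms]
  | neg ε ih => simp [tokens, Token.atoms, atoms, ih]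
  | and ε ζ ih₁ ih₂ => simp [tokens, Token.atoms, atoms, ih₁, ih₂]

theorem flatMap_boxes_tokens (ε : LFull S) : ε.tokens.flatMap Token.boxes = ε.boxes := by
  induction ε with
  | box α hα β => simp [tokens, Token.boxes, boxes]
  | neg ε ih => simp [tokens, Token.boxes, boxes, ih]
  | and ε ζ ih₁ ih₂ => simp [tokens, Token.boxes, boxes, ih₁, ih₂]

theorem flatMap_translation_tokens (L : ℕ) (ε : LFull S) :
    ε.tokens.flatMap (Token.translation L) = (ε.toProp L).code := by
  induction ε with
  | box α hα β => simp [tokens, Token.translation, toProp]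
  | neg ε ih => simp [tokens, Token.translation, toProp, LProp.code, ih]
  | and ε ζ ih₁ ih₂ => simp [tokens, Token.translation, toProp, LProp.code, ih₁, ih₂]

end LFull

namespace LCausal

variable [Encodable OP]

def tokens (φ : LCausal S OP) : List (Token S) := Formula.tokens LFull.tokens φ

theorem flatMap_code_tokens (φ : LCausal S OP) :
    (tokens φ).flatMap Token.code = LCausal.code φ :=
  Formula.flatMap_tokens_eq_code (fun _ _ => rfl) (fun _ => rfl) LFull.flatMap_code_tokens φ

theorem flatMap_atoms_tokens (φ : LCausal S OP) : (tokens φ).flatMap Token.atoms = φ.atoms :=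
  Formula.flatMap_tokens_eq_bases (fun _ _ => rfl) (fun _ => rfl) LFull.flatMap_atoms_tokens φ

theorem flatMap_boxes_tokens (φ : LCausal S OP) : (tokens φ).flatMap Token.boxes = φ.boxes :=
  Formula.flatMap_tokens_eq_bases (fun _ _ => rfl) (fun _ => rfl) LFull.flatMap_boxes_tokens φ

theorem flatMap_translation_tokens (L : ℕ) (φ : LCausal S OP) :
    (tokens φ).flatMap (Token.translation L) = LProb.code (φ.map (LFull.toProp L)) := by
  rw [LProb.code, Formula.code_map]
  exact Formula.flatMap_tokens_eq_code (fun _ _ => rfl) (fun _ => rfl)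
    (LFull.flatMap_translation_tokens L) φ

end LCausal

/-! ### The separators of a causal formula -/

theorem mark_false_append {l : List Sym} (hl : Sym.box ∉ l) (c : ℕ) (r : List Sym) :
    mark false c (l ++ r) = l.map some ++ mark false c r := by
  induction l with
  | nil => rfl
  | cons s l ih =>
    simp only [List.mem_cons, not_or] at hl
    rw [List.cons_append, mark, if_neg (Ne.symm hl.1), ih hl.2]
    rfl

theorem mark_true_append {l : List Sym} (hl : ∀ s ∈ l, s.isInner = true) (c : ℕ) (r : List Sym) :
    mark true c (l ++ r) = l.map some ++ mark true c r := by
  induction l with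
  | nil => rfl
  | cons s l ih =>
    have h := ih fun s hs => hl s (by simp [hs])
    cases c <;> simp [mark, hl s, h]

theorem isInner_of_mem_natCode {n : ℕ} {s : Sym} (hs : s ∈ natCode n) : s.isInner = true := by
  obtain ⟨b, -, rfl⟩ := List.mem_map.1 hs
  rfl

/-- The symbols after `V` in the code of an assignment. -/
def eqTail (n v : ℕ) : List Sym := natCode n ++ .eq :: natCode v

theorem eqCode_eq (n v : ℕ) : eqCode n v = .var :: eqTail n v := rfl

theorem isInner_of_mem_eqTail {n v : ℕ} {s : Sym} (hs : s ∈ eqTail n v) : s.isInner = true := by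
  simp only [eqTail, List.mem_append, List.mem_cons] at hs
  obtain h | rfl | h := hs
  · exact isInner_of_mem_natCode h
  · rfl
  · exact isInner_of_mem_natCode h

theorem LInt.mark_code_append (α : LInt S) : ∀ (c : ℕ) (r : List Sym),
    mark true (c + 1) (α.code ++ r) = α.code.map some ++ mark true c r := by
  induction α with
  | top => intro c r; simp [code, mark, Sym.isInner]
  | eq n v =>
    intro c r
    rw [code, eqCode_eq, List.cons_append, mark]
    simp [Sym.isInner, mark_true_append fun s => isInner_of_mem_eqTail]
  | and α β ih₁ ih₂ => intro c r; simp [code, mark, Sym.isInner, ih₁, ih₂]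

theorem Piece.box_notMem_code (x : Piece S) : Sym.box ∉ x.code := by
  cases x with
  | sym s hs =>
    rintro h
    obtain rfl := List.mem_singleton.1 h
    simp [Sym.isPlain] at hs
  | atom t =>
    intro h
    rw [code, eqCode_eq, List.mem_cons] at h
    exact h.elim (by simp) fun h => by simpa [Sym.isInner] using isInner_of_mem_eqTail h

theorem LProp.box_notMem_code (β : LProp S) : Sym.box ∉ β.code := by
  rw [← flatMap_code_pieces, List.mem_flatMap]
  exact fun ⟨x, _, h⟩ => x.box_notMem_code h

theorem LInt.box_notMem_code (α : LInt S) : Sym.box ∉ α.code := by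
  rw [← flatMap_code_pieces, List.mem_flatMap]
  exact fun ⟨x, _, h⟩ => x.box_notMem_code h

theorem mark_code_append (x : Token S) (r : List Sym) :
    mark false 0 (x.code ++ r) = x.markedCode ++ mark false 0 r := by
  cases x with
  | sym s hs =>
    refine mark_false_append (l := [s]) ?_ 0 r
    rintro h
    obtain rfl := List.mem_singleton.1 h
    simp [Sym.isPlain] at hs
  | lpar k =>
    refine mark_false_append (l := .lpar :: natCode k) ?_ 0 r
    rw [List.mem_cons]
    rintro (h | h)
    · simp at h
    · simpa [Sym.isInner] using isInner_of_mem_natCode h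
  | box α β =>
    have h : mark true 0 (β.code ++ r) = none :: mark false 0 (β.code ++ r) := by
      cases β <;> rfl
    rw [Token.code, List.cons_append, mark, if_pos rfl, List.append_assoc, LInt.mark_code_append, h,
      mark_false_append β.box_notMem_code]
    simp [Token.markedCode]

theorem mark_flatMap_code (l : List (Token S)) :
    mark false 0 (l.flatMap Token.code) = l.flatMap Token.markedCode := by
  induction l with
  | nil => rfl
  | cons x l ih => rw [List.flatMap_cons, mark_code_append, ih, List.flatMap_cons]

end Tokens

/-! ### Reading the tokens with a loop -/

section Reading

variable {S : Signature} {A : Type}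

/-- `l` begins with the code of the assignment `t`. -/
def AtomAt (l : List (Option Sym)) (t : Σ n, S.Val n) : Prop :=
  l.head? = some (some .var) ∧ l.tail.takeWhile (·.any Sym.isInner) = (eqTail t.1 t.2).map some

/-- `l` begins with a marked code of `[α]`. -/
def BoxAt (l : List (Option Sym)) (α : LInt S) : Prop :=
  ∃ r, l = some .box :: (α.code.map some ++ none :: r)

/-- The letters of which numerals consist. -/
def Sym.isDigit : Sym → Bool
  | .bit _ => true
  | _ => false

/-- The word does not begin in the interior of an assignment. -/
def Boundary (l : List (Option Sym)) : Prop := ∀ a ∈ l.head?, a.any Sym.isInner = false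

theorem boundary_cons {a : Option Sym} (ha : a.any Sym.isInner = false) (l : List (Option Sym)) :
    Boundary (a :: l) := by simpa [Boundary] using ha

theorem takeWhile_append_of_forall {Γ : Type} {p : Γ → Bool} {l r : List Γ}
    (hl : ∀ a ∈ l, p a = true) (hr : ∀ a ∈ r.head?, p a = false) :
    (l ++ r).takeWhile p = l := by
  rw [List.takeWhile_append_of_pos hl]
  cases r with
  | nil => simp
  | cons a r => simp [hr a (by simp)]

theorem atomAt_append (t : Σ n, S.Val n) {r : List (Option Sym)} (hr : Boundary r) :
    AtomAt ((eqCode t.1 t.2).map some ++ r) t := by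
  refine ⟨rfl, takeWhile_append_of_forall ?_ hr⟩
  intro a ha
  obtain ⟨s, hs, rfl⟩ := List.mem_map.1 ha
  exact isInner_of_mem_eqTail hs

theorem takeWhile_isDigit_eqTail (n v : ℕ) :
    ((eqTail n v).map some).takeWhile (·.any Sym.isDigit) = (natCode n).map some := by
  rw [eqTail, List.map_append]
  refine takeWhile_append_of_forall ?_ ?_
  · intro a ha
    obtain ⟨s, hs, rfl⟩ := List.mem_map.1 ha
    obtain ⟨b, -, rfl⟩ := List.mem_map.1 hs
    rfl
  · rintro a ⟨⟩
    rfl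

theorem AtomAt.takeWhile_isDigit {l : List (Option Sym)} {t : Σ n, S.Val n} (h : AtomAt l t) :
    l.tail.takeWhile (·.any Sym.isDigit) = (natCode t.1).map some := by
  rw [← takeWhile_isDigit_eqTail t.1 t.2, ← h.2, List.takeWhile_takeWhile]
  congr 1
  funext a
  rcases a with - | s
  · rfl
  · cases s <;> rfl

theorem map_some_injective : Function.Injective (List.map (some : Sym → Option Sym)) :=
  List.map_injective_iff.2 (Option.some_injective _)

theorem sameWord_isDigit_iff {l l' : List (Option Sym)} {t t' : Σ n, S.Val n} (h : AtomAt l t)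
    (h' : AtomAt l' t') : SameWord (·.any Sym.isDigit) l l' ↔ t.1 = t'.1 := by
  rw [SameWord, h.takeWhile_isDigit, h'.takeWhile_isDigit, h.1, h'.1, map_some_injective.eq_iff]
  refine ⟨fun h => bits_injective ?_, fun h => by rw [h]; simp⟩
  exact List.map_injective_iff.2 (fun a b h => by simpa using h) h.2

theorem sameWord_isInner_iff {l l' : List (Option Sym)} {t t' : Σ n, S.Val n} (h : AtomAt l t)
    (h' : AtomAt l' t') :
    SameWord (·.any Sym.isInner) l l' ↔ t.1 = t'.1 ∧ (t.2 : ℕ) = t'.2 := by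
  rw [SameWord, h.2, h'.2, h.1, h'.1, map_some_injective.eq_iff]
  refine ⟨fun h => ?_, fun h => ⟨rfl, congrArg₂ eqTail h.1 h.2⟩⟩
  have h := congrArg (fun l => Sym.var :: l ++ []) h.2
  obtain ⟨h₁, h₂, -⟩ := eqCode_append_inj (r := []) (r' := []) (by simp [NoDigit])
    (by simp [NoDigit]) h
  exact ⟨h₁, h₂⟩

theorem BoxAt.takeWhile {l : List (Option Sym)} {α : LInt S} (h : BoxAt l α) :
    l.tail.takeWhile (·.isSome) = α.code.map some := by
  obtain ⟨r, rfl⟩ := h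
  refine takeWhile_append_of_forall ?_ (by simp)
  intro a ha
  obtain ⟨s, -, rfl⟩ := List.mem_map.1 ha
  rfl

section SuffixFlatMap

variable {Γ : Type} {p : Γ → Bool} {F : List Γ → List A}

theorem suffixFlatMap_append_of_nil {m : List Γ} (hp : ∀ a ∈ m, p a = true)
    (hF : ∀ a ∈ m, ∀ l, F (a :: l) = []) (r : List Γ) :
    suffixFlatMap p F (m ++ r) = suffixFlatMap p F r := by
  induction m with
  | nil => rfl
  | cons a m ih =>
    rw [List.cons_append, suffixFlatMap, if_pos (hp a (by simp)), hF a (by simp), List.nil_append,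
      ih (fun b hb => hp b (by simp [hb])) fun b hb => hF b (by simp [hb])]

theorem suffixFlatMap_of_head? {f : Option Γ → List A} (l : List Γ) :
    suffixFlatMap p (fun l => f l.head?) l = (l.takeWhile p).flatMap fun a => f (some a) := by
  induction l with
  | nil => rfl
  | cons a l ih =>
    rw [suffixFlatMap, List.takeWhile_cons]
    split_ifs <;> simp [ih]

end SuffixFlatMap

theorem boundary_flatMap_code (l : List (Piece S)) {r : List (Option Sym)} (hr : Boundary r) :
    Boundary ((l.flatMap Piece.code).map some ++ r) := by
  cases l with
  | nil => exact hr
  | cons x l =>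
    cases x with
    | sym s hs =>
      refine boundary_cons ?_ _
      cases s <;> simp_all [Sym.isPlain, Sym.isInner]
    | atom t => exact boundary_cons rfl _

/-- The value of a loop over a word that consists of symbols and assignments. -/
theorem suffixFlatMap_pieces {p : Option Sym → Bool} {F : List (Option Sym) → List A}
    {o : Sym → List A} {g : (Σ n, S.Val n) → List A}
    (hp : ∀ s ≠ Sym.box, p (some s) = true)
    (hsym : ∀ s, s.isPlain = true → ∀ l, F (some s :: l) = o s)
    (hinner : ∀ s, s.isInner = true → ∀ l, F (some s :: l) = [])
    (hatom : ∀ t l, AtomAt l t → F l = g t) (l : List (Piece S)) {r : List (Option Sym)}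
    (hr : Boundary r) :
    suffixFlatMap p F ((l.flatMap Piece.code).map some ++ r) =
      l.flatMap (Piece.out o g) ++ suffixFlatMap p F r := by
  induction l with
  | nil => rfl
  | cons x l ih =>
    rw [List.flatMap_cons, List.map_append, List.append_assoc, List.flatMap_cons,
      List.append_assoc, ← ih]
    have hb := boundary_flatMap_code l hr
    generalize (l.flatMap Piece.code).map some ++ r = r' at *
    cases x with
    | sym s hs =>
      have : p (some s) = true := hp s (by rintro rfl; simp [Sym.isPlain] at hs)
      simp [Piece.code, Piece.out, suffixFlatMap, this, hsym s hs]
    | atom t =>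
      have hin : ∀ s, s.isInner = true → p (some s) = true := fun s hs =>
        hp s (by rintro rfl; simp [Sym.isInner] at hs)
      have ht := hatom t _ (atomAt_append t hb)
      rw [eqCode_eq, List.map_cons, List.cons_append] at ht
      rw [Piece.code, eqCode_eq, List.map_cons, List.cons_append, suffixFlatMap,
        if_pos (hp _ (by simp)), ht, suffixFlatMap_append_of_nil]
      · rfl
      · intro a ha
        obtain ⟨s, hs, rfl⟩ := List.mem_map.1 ha
        exact hin s (isInner_of_mem_eqTail hs)
      · intro a ha
        obtain ⟨s, hs, rfl⟩ := List.mem_map.1 ha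
        exact hinner s (isInner_of_mem_eqTail hs)

/-- `F` is nonempty only at the beginning of an assignment, where it is `g`. -/
structure ReadsAtoms (F : List (Option Sym) → List A) (g : (Σ n, S.Val n) → List A) : Prop where
  eq_nil : ∀ a ≠ some Sym.var, ∀ l, F (a :: l) = []
  eq_of_atomAt : ∀ t l, AtomAt l t → F l = g t

/-- `F` is nonempty only at the beginning of an intervention, where it is `g`. -/
structure ReadsBoxes (F : List (Option Sym) → List A) (g : LInt S → List A) : Prop where
  eq_nil : ∀ a ≠ some Sym.box, ∀ l, F (a :: l) = []
  eq_of_boxAt : ∀ α l, BoxAt l α → F l = g α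

theorem boundary_flatMap_markedCode (l : List (Token S)) :
    Boundary (l.flatMap Token.markedCode) := by
  cases l with
  | nil => simp [Boundary]
  | cons x l =>
    cases x with
    | sym s hs =>
      refine boundary_cons ?_ _
      cases s <;> simp_all [Sym.isPlain, Sym.isInner]
    | _ => exact boundary_cons rfl _

theorem ReadsAtoms.suffixFlatMap_pieces {F : List (Option Sym) → List A}
    {g : (Σ n, S.Val n) → List A} (h : ReadsAtoms F g) {p : Option Sym → Bool}
    (hp : ∀ s ≠ Sym.box, p (some s) = true) (l : List (Piece S)) {r : List (Option Sym)}
    (hr : Boundary r) : suffixFlatMap p F ((l.flatMap Piece.code).map some ++ r) =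
      l.flatMap (Piece.out (fun _ => []) g) ++ suffixFlatMap p F r := by
  refine CausalLogic.suffixFlatMap_pieces hp (fun s hs l => h.eq_nil _ ?_ l)
    (fun s hs l => h.eq_nil _ ?_ l) h.eq_of_atomAt l hr
  · rintro ⟨⟩; simp [Sym.isPlain] at hs
  · rintro ⟨⟩; simp [Sym.isInner] at hs

theorem ReadsAtoms.suffixFlatMap_of_boxAt {F : List (Option Sym) → List A}
    {g : (Σ n, S.Val n) → List A} (h : ReadsAtoms F g) {l : List (Option Sym)} {α : LInt S}
    (hl : BoxAt l α) : suffixFlatMap (·.isSome) F l.tail = α.atoms.flatMap g := by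
  obtain ⟨r, rfl⟩ := hl
  rw [List.tail_cons, ← α.flatMap_code_pieces, h.suffixFlatMap_pieces (fun _ _ => rfl) _
    (boundary_cons rfl r), α.flatMap_out_pieces, suffixFlatMap, if_neg (by simp), List.append_nil]

theorem ReadsAtoms.suffixFlatMap_tokens {F : List (Option Sym) → List A}
    {g : (Σ n, S.Val n) → List A} (h : ReadsAtoms F g) (l : List (Token S)) :
    suffixFlatMap (fun _ => true) F (l.flatMap Token.markedCode) =
      (l.flatMap Token.atoms).flatMap g := by
  induction l with
  | nil => rfl
  | cons x l ih =>
    rw [List.flatMap_cons, List.flatMap_cons, List.flatMap_append, ← ih]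
    have hb := boundary_flatMap_markedCode l
    generalize l.flatMap Token.markedCode = r at *
    have hnil : ∀ m : List (Option Sym), (∀ a ∈ m, a ≠ some .var) →
        suffixFlatMap (fun _ => true) F (m ++ r) = suffixFlatMap (fun _ => true) F r :=
      fun m hm => suffixFlatMap_append_of_nil (fun _ _ => rfl) (fun a ha => h.eq_nil a (hm a ha)) r
    cases x with
    | sym s hs =>
      refine hnil [some s] ?_
      rintro a ha rfl
      cases List.mem_singleton.1 ha
      simp [Sym.isPlain] at hs
    | lpar k =>
      refine hnil _ ?_
      rintro a ha rfl
      simp only [Token.markedCode, List.mem_cons, List.mem_map] at ha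
      obtain ha | ⟨s, hs, hs'⟩ := ha
      · simp at ha
      · cases hs'
        simpa [Sym.isInner] using isInner_of_mem_natCode hs
    | box α β =>
      simp only [Token.markedCode, Token.atoms, List.cons_append, List.append_assoc,
        List.flatMap_append]
      rw [suffixFlatMap, if_pos rfl, h.eq_nil _ (by simp), List.nil_append,
        ← α.flatMap_code_pieces, h.suffixFlatMap_pieces (fun _ _ => rfl) _ (boundary_cons rfl _),
        α.flatMap_out_pieces, suffixFlatMap, if_pos rfl, h.eq_nil _ (by simp), List.nil_append,
        ← β.flatMap_code_pieces, h.suffixFlatMap_pieces (fun _ _ => rfl) _ hb,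
        β.flatMap_out_pieces]

theorem suffixFlatMap_append_of_box_notMem {F : List (Option Sym) → List A}
    (h : ∀ a ≠ some Sym.box, ∀ l, F (a :: l) = []) {m : List Sym} (hm : Sym.box ∉ m)
    (r : List (Option Sym)) :
    suffixFlatMap (fun _ => true) F (m.map some ++ r) = suffixFlatMap (fun _ => true) F r := by
  refine suffixFlatMap_append_of_nil (fun _ _ => rfl) (fun a ha => h a ?_) r
  rintro rfl
  obtain ⟨s, hs, hs'⟩ := List.mem_map.1 ha
  cases hs'
  exact hm hs

theorem Token.box_notMem_sym {s : Sym} (hs : s.isPlain = true) : Sym.box ∉ [s] := by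
  intro h
  cases List.mem_singleton.1 h
  simp [Sym.isPlain] at hs

theorem Token.box_notMem_lpar (k : ℕ) : Sym.box ∉ Sym.lpar :: natCode k := by
  rw [List.mem_cons]
  rintro (h | h)
  · simp at h
  · simpa [Sym.isInner] using isInner_of_mem_natCode h

theorem suffixFlatMap_box {F : List (Option Sym) → List A}
    (h : ∀ a ≠ some Sym.box, ∀ l, F (a :: l) = []) (α : LInt S) (β : LProp S)
    (r : List (Option Sym)) :
    suffixFlatMap (fun _ => true) F ((Token.box α β).markedCode ++ r) =
      F ((Token.box α β).markedCode ++ r) ++ suffixFlatMap (fun _ => true) F r := by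
  simp only [Token.markedCode, List.cons_append, List.append_assoc]
  rw [suffixFlatMap, if_pos rfl, suffixFlatMap_append_of_box_notMem h α.box_notMem_code,
    suffixFlatMap, if_pos rfl, h none (by simp), List.nil_append,
    suffixFlatMap_append_of_box_notMem h β.box_notMem_code]

theorem boxAt_markedCode (α : LInt S) (β : LProp S) (r : List (Option Sym)) :
    BoxAt ((Token.box α β).markedCode ++ r) α := ⟨β.code.map some ++ r, by
  simp [Token.markedCode]⟩

theorem ReadsBoxes.suffixFlatMap_tokens {F : List (Option Sym) → List A} {g : LInt S → List A}
    (h : ReadsBoxes F g) (l : List (Token S)) :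
    suffixFlatMap (fun _ => true) F (l.flatMap Token.markedCode) =
      (l.flatMap Token.boxes).flatMap g := by
  induction l with
  | nil => rfl
  | cons x l ih =>
    rw [List.flatMap_cons, List.flatMap_cons, List.flatMap_append, ← ih]
    cases x with
    | sym s hs => exact suffixFlatMap_append_of_box_notMem h.eq_nil (Token.box_notMem_sym hs) _
    | lpar k => exact suffixFlatMap_append_of_box_notMem h.eq_nil (Token.box_notMem_lpar k) _
    | box α β =>
      rw [suffixFlatMap_box h.eq_nil, h.eq_of_boxAt α _ (boxAt_markedCode α β _)]
      simp [Token.boxes]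

end Reading

/-! ### The program that writes the reduced formula -/

/-- The pointers of the program: the whole input, occurrences of interventions, occurrences of
assignments, positions in the scope of an intervention, and single letters. -/
inductive Pointer : Type
  | input | box₁ | box₂ | atom₁ | atom₂ | atom₃ | pos | letter
  deriving DecidableEq

instance : Finite Pointer :=
  Finite.of_injective
    (fun x : Pointer => match x with
      | .input => (0 : Fin 8) | .box₁ => 1 | .box₂ => 2 | .atom₁ => 3 | .atom₂ => 4 | .atom₃ => 5
      | .pos => 6 | .letter => 7)
    (by intro a b; cases a <;> cases b <;> simp)

abbrev Prog : Type := LoopProg Pointer (Option Sym)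

instance : Append Prog := ⟨.seq⟩

namespace Prog

open Pointer

/-- Write a given word. -/
def say (l : List Sym) : Prog := l.foldr (fun s c => .seq (.emit .input fun _ => some s) c) .skip

/-- Copy the longest word over `p` that follows `x`. -/
def copy (x : Pointer) (p : Sym → Bool) : Prog :=
  .loop letter x (·.any p) (.emit letter Option.join)

/-- The `i`-th bit of the letter that `letter` points at. -/
def sayBit (i : ℕ) : Prog :=
  .emit letter fun a => a.join.map fun s => .bit (s.toBits.getD i false)

/-- Write the bits of the longest word over `p` that follows `x`. -/
def spell (x : Pointer) (p : Option Sym → Bool) : Prog :=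
  .loop letter x p (sayBit 0 ++ (sayBit 1 ++ (sayBit 2 ++ sayBit 3)))

/-- Write the propositional variable of which the bits of the name are written by `name`. -/
def fresh (name : Prog) : Prog :=
  say [.var] ++ (.loop letter input (fun _ => true) (.emit letter fun _ => some (.bit false)) ++
    (name ++ say [.bit true, .eq]))

def world (h x : Pointer) : Prog :=
  fresh (spell h (·.isSome) ++ (say (Sym.ge.toBits.map .bit) ++ spell x (·.any Sym.isInner)))

def order (x y : Pointer) : Prog :=
  fresh (spell x (·.any Sym.isDigit) ++
    (say (Sym.ge.toBits.map .bit) ++ spell y (·.any Sym.isDigit)))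

/-- Let `x` run over the occurrences of assignments after `y`, up to the first letter outside
`p`. -/
def forAtoms (x y : Pointer) (p : Option Sym → Bool) (c : Prog) : Prog :=
  .loop x y p (.ite x (· == some (some .var)) c .skip)

/-- Let `x` run over the occurrences of interventions. -/
def forBoxes (x : Pointer) (c : Prog) : Prog :=
  .loop x input (fun _ => true) (.ite x (· == some (some .box)) c .skip)

def neg (c : Prog) : Prog := say [.neg] ++ c

def and (c d : Prog) : Prog := say [.and] ++ (c ++ d)

def equiv (c d : Prog) : Prog := and (neg (and c (neg d))) (neg (and d (neg c)))

/-- The code of the tautology. -/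
def tautCode : List Sym := .neg :: .and :: (eqCode 0 0 ++ .neg :: eqCode 0 0)

/-- One member of a conjunction. -/
def clause (c : Prog) : Prog := say [.and] ++ c

/-- A conjunction, the members of which are written by `c`. -/
def all (c : Prog) : Prog := c ++ say tautCode

def irreflClauses : Prog :=
  forAtoms atom₁ input (fun _ => true) (clause (neg (order atom₁ atom₁)))

def transClauses : Prog :=
  forAtoms atom₁ input (fun _ => true) <| forAtoms atom₂ input (fun _ => true) <|
    forAtoms atom₃ input (fun _ => true) <|
      clause (neg (and (order atom₁ atom₂) (and (order atom₂ atom₃) (neg (order atom₁ atom₃)))))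

def setClauses : Prog :=
  forBoxes box₁ (forAtoms atom₁ box₁ (·.isSome) (clause (world box₁ atom₁)))

def uniqueClauses : Prog :=
  forBoxes box₁ <| forAtoms atom₁ input (fun _ => true) <| forAtoms atom₂ input (fun _ => true) <|
    .iteEq atom₁ atom₂ (·.any Sym.isDigit)
      (.iteEq atom₁ atom₂ (·.any Sym.isInner) .skip
        (clause (neg (and (world box₁ atom₁) (world box₁ atom₂)))))
      .skip

def otherClauses : Prog :=
  forBoxes box₁ <| forAtoms atom₁ input (fun _ => true) <| clause <| neg <|
    and (say [.var] ++ copy atom₁ Sym.isInner) <| all <|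
      forAtoms atom₂ input (fun _ => true) <|
        .iteEq atom₁ atom₂ (·.any Sym.isDigit) (clause (neg (world box₁ atom₂))) .skip

/-- Write the clauses saying that the intervention `h` does not set the variable of `atom₁`. -/
def notSet (h : Pointer) : Prog :=
  forAtoms atom₂ h (·.isSome) <|
    .iteEq atom₁ atom₂ (·.any Sym.isDigit) (clause (neg (say tautCode))) .skip

def determinedClauses : Prog :=
  forBoxes box₁ <| forBoxes box₂ <| forAtoms atom₁ input (fun _ => true) <| clause <| neg <| all <|
    (notSet box₁ ++ notSet box₂) ++
    (forAtoms atom₂ input (fun _ => true) (clause (neg (and (order atom₂ atom₁)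
      (neg (equiv (world box₁ atom₂) (world box₂ atom₂)))))) ++
    clause (neg (equiv (world box₁ atom₁) (world box₂ atom₁))))

def consistency : Prog :=
  all (irreflClauses ++ (transClauses ++ (setClauses ++ (uniqueClauses ++
    (otherClauses ++ determinedClauses)))))

def constantClauses : Prog :=
  forAtoms atom₁ input (fun _ => true) <| forAtoms atom₂ input (fun _ => true) <|
    say [.and, .neg, .and, .neg, .ge, .prob] ++ (order atom₁ atom₂ ++
      (say (.prob :: tautCode ++ [.neg, .ge, .prob, .neg]) ++ (order atom₁ atom₂ ++
        say (.prob :: tautCode))))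

/-- Translate what is at `pos`, in the scope of the intervention `h`. -/
def translateAtPos (h : Pointer) : Prog :=
  .ite pos (·.join.any Sym.isInner) .skip <|
  .ite pos (· == some (some .var)) (world h pos) <|
  .ite pos (· == some (some .lpar)) (say [.lpar] ++ copy pos Sym.isDigit) <|
  .emit pos Option.join

/-- Translate the parts after `x` that precede the next intervention, in the scope of the
intervention `h`. -/
def translateFrom (h x : Pointer) : Prog :=
  .loop pos x (· != some .box) (translateAtPos h)

/-- Write the translation of the formula. Before the first intervention there is no assignment, so
that the scope does not matter. -/
def translation : Prog :=
  translateFrom input input ++ forBoxes box₁ (.loop atom₁ box₁ (· != some .box)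
    (.ite atom₁ (· == some none) (translateFrom box₁ atom₁) .skip))

/-- Write the reduced formula. -/
def reduct : Prog :=
  constantClauses ++ (say [.and] ++ (translation ++
    (say [.ge, .prob] ++ (consistency ++ say (.prob :: tautCode)))))

theorem wellFormed_append {c d : Prog} {s : Finset Pointer} :
    (c ++ d).WellFormed s ↔ c.WellFormed s ∧ d.WellFormed s := Iff.rfl

theorem wellFormed_say (l : List Sym) (s : Finset Pointer) : (say l).WellFormed s := by
  induction l with
  | nil => trivial
  | cons a l ih => exact ⟨trivial, ih⟩

theorem wellFormed_reduct : reduct.WellFormed {input} := by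
  simp [reduct, constantClauses, translation, translateFrom, translateAtPos, consistency,
    irreflClauses, transClauses, setClauses, uniqueClauses, otherClauses, determinedClauses,
    notSet, all, clause, neg, and, equiv, forAtoms, forBoxes, order, world, fresh, spell, sayBit,
    copy, LoopProg.WellFormed, wellFormed_append, wellFormed_say]

end Prog

/-! ### Correctness of the program -/

namespace Prog

open Pointer

variable {S : Signature} {OP : Set Operation} {e : Pointer → List (Option Sym)}

/-- The program `c` writes the word `l`. -/
def Writes (e : Pointer → List (Option Sym)) (c : Prog) (l : List Sym) : Prop :=
  c.eval e = l.map some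

theorem Writes.append {c d : Prog} {l m : List Sym} (hc : Writes e c l) (hd : Writes e d m) :
    Writes e (c ++ d) (l ++ m) :=
  (congrArg₂ (· ++ ·) hc hd).trans List.map_append.symm

theorem writes_say (l : List Sym) : Writes e (say l) l := by
  induction l with
  | nil => rfl
  | cons s l ih => exact congrArg (some s :: ·) ih

theorem writes_copy {x : Pointer} {p : Sym → Bool} {m : List Sym}
    (h : (e x).tail.takeWhile (·.any p) = m.map some) : Writes e (copy x p) m := by
  have := suffixFlatMap_of_head? (p := fun a : Option Sym => a.any p)
    (f := fun a => [Option.join a]) (e x).tail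
  rw [h] at this
  simp only [Writes, copy, LoopProg.eval, Function.update_self, this]
  simp [List.flatMap_map]
  rw [← List.map_eq_flatMap]

theorem writes_spell {x : Pointer} {p : Option Sym → Bool} {m : List Sym}
    (h : (e x).tail.takeWhile p = m.map some) :
    Writes e (spell x p) ((m.flatMap Sym.toBits).map .bit) := by
  let f : Option (Option Sym) → List (Option Sym) := fun a =>
    [a.join.map fun s => .bit (s.toBits.getD 0 false)] ++
    ([a.join.map fun s => .bit (s.toBits.getD 1 false)] ++
    ([a.join.map fun s => .bit (s.toBits.getD 2 false)] ++
    [a.join.map fun s => .bit (s.toBits.getD 3 false)]))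
  have hf : ∀ s : Sym, f (some (some s)) = (s.toBits.map Sym.bit).map some := by
    intro s
    cases s <;> rfl
  have h₁ : (spell x p).eval e = suffixFlatMap p (fun l => f l.head?) (e x).tail := by
    simp only [spell, LoopProg.eval]
    congr 1
  rw [Writes, h₁, suffixFlatMap_of_head?, h]
  simp only [List.flatMap_map, hf, List.map_flatMap]

/-- The zeros are as many as the letters of the input, so the variable is fresh. -/
theorem writes_fresh {name : Prog} {l : List Sym}
    (h : Writes e name ((l.flatMap Sym.toBits).map .bit)) :
    Writes e (fresh name) (LProp.fresh (S := S) (e input).tail.length l).code := by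
  have hpad : ∀ l : List (Option Sym), suffixFlatMap (fun _ => true)
      (fun _ => [some (Sym.bit false)]) l = List.replicate l.length (some (Sym.bit false)) := by
    intro l
    induction l with
    | nil => rfl
    | cons a l ih => simp [suffixFlatMap, ih, List.replicate_succ]
  have h₂ : Writes e (.loop letter input (fun _ => true)
      (.emit letter fun _ => some (.bit false))) (List.replicate (e input).tail.length
        (.bit false)) := by
    simp only [Writes, LoopProg.eval, hpad, List.map_replicate]
  have h₃ := (writes_say [.var]).append (h₂.append (h.append (writes_say [.bit true, .eq])))
  rw [fresh]
  convert h₃ using 1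
  simp [LProp.fresh, LProp.code, eqCode, natCode, bits_freshIndex, Signature.zero]

theorem writes_world {h x : Pointer} {α : LInt S} {t : Σ n, S.Val n} (hh : BoxAt (e h) α)
    (hx : AtomAt (e x) t) :
    Writes e (world h x) (LProp.world (e input).tail.length α t).code := by
  refine writes_fresh ?_
  have := (writes_spell hh.takeWhile).append ((writes_say (Sym.ge.toBits.map .bit)).append
    (writes_spell hx.2))
  convert this using 1
  simp [worldName, eqTail]

theorem writes_order {x y : Pointer} {t t' : Σ n, S.Val n} (hx : AtomAt (e x) t)
    (hy : AtomAt (e y) t') :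
    Writes e (order x y) (LProp.order (S := S) (e input).tail.length t.1 t'.1).code := by
  refine writes_fresh ?_
  have := (writes_spell hx.takeWhile_isDigit).append
    ((writes_say (Sym.ge.toBits.map .bit)).append (writes_spell hy.takeWhile_isDigit))
  convert this using 1
  simp [orderName]

/-- The body of `forAtoms` is executed at the occurrences of assignments only. -/
theorem readsAtoms {x : Pointer} {c : Prog} {g : (Σ n, S.Val n) → List Sym}
    (h : ∀ t l, AtomAt l t → Writes (Function.update e x l) c (g t)) :
    ReadsAtoms (fun l => LoopProg.eval (.ite x (· == some (some .var)) c .skip)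
      (Function.update e x l)) fun t => (g t).map some where
  eq_nil a ha l := by simp [LoopProg.eval, ha]
  eq_of_atomAt t l hl := by
    have : l.head? = some (some .var) := hl.1
    simp only [LoopProg.eval, Function.update_self, this]
    exact h t l hl

/-- The body of `forBoxes` is executed at the occurrences of interventions only. -/
theorem readsBoxes {x : Pointer} {c : Prog} {g : LInt S → List Sym}
    (h : ∀ α l, BoxAt l α → Writes (Function.update e x l) c (g α)) :
    ReadsBoxes (fun l => LoopProg.eval (.ite x (· == some (some .box)) c .skip)
      (Function.update e x l)) fun α => (g α).map some where
  eq_nil a ha l := by simp [LoopProg.eval, ha]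
  eq_of_boxAt α l hl := by
    have : l.head? = some (some .box) := by
      obtain ⟨r, rfl⟩ := hl
      rfl
    simp only [LoopProg.eval, Function.update_self, this]
    exact h α l hl

theorem writes_forAtoms_box {h x : Pointer} {c : Prog} {g : (Σ n, S.Val n) → List Sym} {α : LInt S}
    (hh : BoxAt (e h) α) (hc : ∀ t l, AtomAt l t → Writes (Function.update e x l) c (g t)) :
    Writes e (forAtoms x h (·.isSome) c) (α.atoms.flatMap g) :=
  ((readsAtoms hc).suffixFlatMap_of_boxAt hh).trans List.map_flatMap.symm

theorem Writes.neg {c : Prog} {β : LProp S} (h : Writes e c β.code) :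
    Writes e (neg c) (LProp.neg β).code := (writes_say [.neg]).append h

theorem Writes.and {c d : Prog} {β γ : LProp S} (hc : Writes e c β.code) (hd : Writes e d γ.code) :
    Writes e (and c d) (LProp.and β γ).code := (writes_say [.and]).append (hc.append hd)

theorem Writes.equiv {c d : Prog} {β γ : LProp S} (hc : Writes e c β.code)
    (hd : Writes e d γ.code) : Writes e (equiv c d) (LProp.equiv β γ).code :=
  (hc.and hd.neg).neg.and (hd.and hc.neg).neg

/-- The members of a conjunction, as they are written. -/
def conj (l : List (LProp S)) : List Sym := l.flatMap fun β => .and :: β.code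

theorem conj_append (l m : List (LProp S)) : conj (l ++ m) = conj l ++ conj m :=
  List.flatMap_append

theorem conj_flatMap {A : Type} (l : List A) (f : A → List (LProp S)) :
    conj (l.flatMap f) = l.flatMap fun a => conj (f a) := List.flatMap_assoc

theorem conj_map {A : Type} (l : List A) (f : A → LProp S) :
    conj (l.map f) = l.flatMap fun a => conj [f a] := by
  simp [conj, List.flatMap_map]

theorem Writes.clause {c : Prog} {β : LProp S} (h : Writes e c β.code) :
    Writes e (clause c) (conj [β]) := by
  rw [show conj [β] = [.and] ++ β.code by simp [conj]]
  exact (writes_say [.and]).append h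

theorem code_taut : (LProp.taut : LProp S).code = tautCode := rfl

theorem code_all (l : List (LProp S)) : (LProp.all l).code = conj l ++ tautCode := by
  induction l with
  | nil => rfl
  | cons β l ih =>
    change Sym.and :: (β.code ++ (LProp.all l).code) = _
    rw [ih]
    simp [conj]

theorem Writes.all {c : Prog} {l : List (LProp S)} (h : Writes e c (conj l)) :
    Writes e (all c) (LProp.all l).code := by
  rw [code_all]
  exact h.append (writes_say _)

/-- The comparison of the numerals after `V` decides whether two assignments are about the same
variable. -/
theorem writes_ite_sameVariable {x y : Pointer} {t t' : Σ n, S.Val n} {c : Prog}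
    {l : List (LProp S)} (hx : AtomAt (e x) t) (hy : AtomAt (e y) t') (hc : Writes e c (conj l)) :
    Writes e (.iteEq x y (·.any Sym.isDigit) c .skip)
      (conj (if t.1 = t'.1 then l else [])) := by
  simp only [Writes, LoopProg.eval, sameWord_isDigit_iff hx hy]
  split_ifs
  · exact hc
  · rfl

theorem writes_ite_sameAtom {x y : Pointer} {t t' : Σ n, S.Val n} {c : Prog}
    {l : List (LProp S)} (hx : AtomAt (e x) t) (hy : AtomAt (e y) t') (hc : Writes e c (conj l)) :
    Writes e (.iteEq x y (·.any Sym.isDigit) (.iteEq x y (·.any Sym.isInner) .skip c) .skip)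
      (conj (if t.1 = t'.1 then if (t.2 : ℕ) = t'.2 then [] else l else [])) := by
  simp only [Writes, LoopProg.eval, sameWord_isDigit_iff hx hy, sameWord_isInner_iff hx hy]
  split_ifs with h₁ h₂ h₃ h₄
  · rfl
  · exact absurd h₂.2 ‹_›
  · exact absurd ⟨h₁, ‹_›⟩ h₂
  · exact hc
  · rfl

section Clauses

variable {l : List (Token S)}

local notation "W" => List.flatMap Token.markedCode l
local notation "𝔸" => List.flatMap Token.atoms l
local notation "𝕀" => List.flatMap Token.boxes l
local notation "𝕃" => List.length (List.flatMap Token.markedCode l)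

theorem writes_forAtoms {x : Pointer} {c : Prog} {g : (Σ n, S.Val n) → List Sym}
    (hW : e input = none :: W)
    (hc : ∀ t m, AtomAt m t → Writes (Function.update e x m) c (g t)) :
    Writes e (forAtoms x input (fun _ => true) c) (List.flatMap g 𝔸) := by
  have := (readsAtoms hc).suffixFlatMap_tokens l
  rw [← List.tail_cons (a := none) (as := W), ← hW] at this
  exact this.trans List.map_flatMap.symm

theorem writes_forBoxes {x : Pointer} {c : Prog} {g : LInt S → List Sym}
    (hW : e input = none :: W)
    (hc : ∀ α m, BoxAt m α → Writes (Function.update e x m) c (g α)) :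
    Writes e (forBoxes x c) (List.flatMap g 𝕀) := by
  have := (readsBoxes hc).suffixFlatMap_tokens l
  rw [← List.tail_cons (a := none) (as := W), ← hW] at this
  exact this.trans List.map_flatMap.symm

theorem Writes.world {h x : Pointer} {α : LInt S} {t : Σ n, S.Val n} (hW : e input = none :: W)
    (hh : BoxAt (e h) α) (hx : AtomAt (e x) t) :
    Writes e (world h x) (LProp.world 𝕃 α t).code := by
  have := writes_world hh hx
  rwa [hW] at this

theorem Writes.order {x y : Pointer} {t t' : Σ n, S.Val n} (hW : e input = none :: W)
    (hx : AtomAt (e x) t) (hy : AtomAt (e y) t') :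
    Writes e (order x y) (LProp.order (S := S) 𝕃 t.1 t'.1).code := by
  have := writes_order hx hy
  rwa [hW] at this

theorem writes_irreflClauses (hW : e input = none :: W) :
    Writes e irreflClauses (conj (CausalLogic.irreflClauses 𝕃 𝔸)) := by
  rw [CausalLogic.irreflClauses, conj_map]
  refine writes_forAtoms hW fun t m hm => (Writes.order (l := l) ?_ ?_ ?_).neg.clause <;> simpa

theorem writes_transClauses (hW : e input = none :: W) :
    Writes e transClauses (conj (CausalLogic.transClauses 𝕃 𝔸)) := by
  simp only [CausalLogic.transClauses, conj_map, conj_flatMap]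
  refine writes_forAtoms hW fun t m hm => writes_forAtoms (by simpa) fun t' m' hm' =>
    writes_forAtoms (by simpa) fun t'' m'' hm'' => ?_
  exact ((Writes.order (l := l) (by simpa) (by simpa) (by simpa)).and
    ((Writes.order (l := l) (by simpa) (by simpa) (by simpa)).and
    (Writes.order (l := l) (by simpa) (by simpa) (by simpa)).neg)).neg.clause

theorem writes_setClauses (hW : e input = none :: W) :
    Writes e setClauses (conj (CausalLogic.setClauses 𝕃 𝕀)) := by
  simp only [CausalLogic.setClauses, conj_map, conj_flatMap]
  exact writes_forBoxes hW fun α m hm => writes_forAtoms_box (by simpa) fun t m' hm' =>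
    (Writes.world (l := l) (by simpa) (by simpa) (by simpa)).clause

theorem writes_uniqueClauses (hW : e input = none :: W) :
    Writes e uniqueClauses (conj (CausalLogic.uniqueClauses 𝕃 𝔸 𝕀)) := by
  simp only [CausalLogic.uniqueClauses, conj_flatMap]
  refine writes_forBoxes hW fun α m hm => writes_forAtoms (by simpa) fun t m' hm' =>
    writes_forAtoms (by simpa) fun t' m'' hm'' => ?_
  exact writes_ite_sameAtom (by simpa) (by simpa)
    ((Writes.world (l := l) (by simpa) (by simpa) (by simpa)).and
      (Writes.world (l := l) (by simpa) (by simpa) (by simpa))).neg.clause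

theorem writes_otherClauses (hW : e input = none :: W) :
    Writes e otherClauses (conj (CausalLogic.otherClauses 𝕃 𝔸 𝕀)) := by
  simp only [CausalLogic.otherClauses, conj_map, conj_flatMap]
  refine writes_forBoxes hW fun α m hm => writes_forAtoms (by simpa) fun t m' hm' =>
    Writes.clause (Writes.neg (Writes.and ?_ (Writes.all ?_)))
  · exact (writes_say [.var]).append (writes_copy (m := eqTail t.1 t.2) (by simpa using hm'.2))
  · rw [conj_flatMap]
    exact writes_forAtoms (by simpa) fun t' m'' hm'' => writes_ite_sameVariable (by simpa)
      (by simpa) (Writes.world (l := l) (by simpa) (by simpa) (by simpa)).neg.clause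

theorem writes_notSet {h : Pointer} {α : LInt S} {t : Σ n, S.Val n} (hh : BoxAt (e h) α)
    (ht : AtomAt (e atom₁) t) : Writes e (notSet h) (conj
      (α.atoms.flatMap fun t' => if t.1 = t'.1 then [LProp.neg (LProp.taut (S := S))] else [])) := by
  rw [conj_flatMap]
  exact writes_forAtoms_box hh fun t' m hm => writes_ite_sameVariable (by simpa) (by simpa)
    (Writes.neg (β := .taut) (writes_say _)).clause

theorem writes_determinedClauses (hW : e input = none :: W) :
    Writes e determinedClauses (conj (CausalLogic.determinedClauses 𝕃 𝔸 𝕀)) := by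
  simp only [CausalLogic.determinedClauses, conj_map, conj_flatMap]
  refine writes_forBoxes hW fun α m hm => writes_forBoxes (by simpa) fun α' m' hm' =>
    writes_forAtoms (by simpa) fun t m'' hm'' =>
      Writes.clause (Writes.neg (Writes.all ?_))
  rw [conj_append, conj_append, List.flatMap_append, conj_append, conj_map]
  refine ((writes_notSet (by simpa) (by simpa)).append
    (writes_notSet (by simpa) (by simpa))).append (.append ?_ ?_)
  · exact writes_forAtoms (by simpa) fun t' m₃ hm₃ =>
      ((Writes.order (l := l) (by simpa) (by simpa) (by simpa)).and
        ((Writes.world (l := l) (by simpa) (by simpa) (by simpa)).equiv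
        (Writes.world (l := l) (by simpa) (by simpa) (by simpa))).neg).neg.clause
  · exact ((Writes.world (l := l) (by simpa) (by simpa) (by simpa)).equiv
      (Writes.world (l := l) (by simpa) (by simpa) (by simpa))).neg.clause

theorem writes_consistency (hW : e input = none :: W) :
    Writes e consistency (CausalLogic.consistency 𝕃 𝔸 𝕀).code := by
  refine Writes.all ?_
  simp only [conj_append]
  exact (writes_irreflClauses hW).append ((writes_transClauses hW).append
    ((writes_setClauses hW).append ((writes_uniqueClauses hW).append
    ((writes_otherClauses hW).append (writes_determinedClauses hW)))))

theorem writes_constantClauses [Encodable OP] (hW : e input = none :: W) :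
    Writes e constantClauses (List.flatMap (fun φ : LProb S OP => .and :: LProb.code φ)
      (List.flatMap (fun t => List.map (fun t' =>
        Formula.constant (LProp.order 𝕃 t.1 t'.1)) 𝔸) 𝔸)) := by
  rw [List.flatMap_assoc]
  simp only [List.flatMap_map]
  refine writes_forAtoms hW fun t m hm => writes_forAtoms (l := l) (by simpa) fun t' m' hm' => ?_
  have h : Writes _ (order atom₁ atom₂) (LProp.order (S := S) 𝕃 t.1 t'.1).code :=
    Writes.order (e := Function.update (Function.update e atom₁ m) atom₂ m') (l := l)
      (by simpa) (by simpa) (by simpa)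
  convert (writes_say [.and, .neg, .and, .neg, .ge, .prob]).append (h.append
    ((writes_say (.prob :: tautCode ++ [.neg, .ge, .prob, .neg])).append
      (h.append (writes_say (.prob :: tautCode))))) using 1
  simp [LProb.code, Formula.constant, Formula.code, Term.code, code_taut, LProp.code]

end Clauses

end Prog

/-! ### Correctness of the translation -/

section Separators

variable {S : Signature} {A : Type}

theorem ne_box_of_box_notMem {m : List Sym} (hm : Sym.box ∉ m) :
    ∀ a ∈ m.map some, (a != some Sym.box) = true := by
  intro a ha
  obtain ⟨s, hs, rfl⟩ := List.mem_map.1 ha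
  simp only [bne_iff_ne, ne_eq, Option.some.injEq]
  rintro rfl
  exact hm hs

/-- There is no separator before the next intervention. -/
theorem suffixFlatMap_tokens_of_nil {H : List (Option Sym) → List A}
    (h : ∀ s l, H (some s :: l) = []) (l : List (Token S)) :
    suffixFlatMap (· != some .box) H (l.flatMap Token.markedCode) = [] := by
  have key : ∀ {m : List Sym}, Sym.box ∉ m → ∀ r,
      suffixFlatMap (· != some .box) H (m.map some ++ r) =
        suffixFlatMap (· != some .box) H r := by
    intro m hm r
    refine suffixFlatMap_append_of_nil (ne_box_of_box_notMem hm) (fun a ha l => ?_) r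
    obtain ⟨s, -, rfl⟩ := List.mem_map.1 ha
    exact h s l
  induction l with
  | nil => rfl
  | cons x l ih =>
    rw [List.flatMap_cons]
    cases x with
    | sym s hs => exact (key (Token.box_notMem_sym hs) _).trans ih
    | lpar k => exact (key (Token.box_notMem_lpar k) _).trans ih
    | box α β => rfl

end Separators

namespace Prog

open Pointer

variable {S : Signature} {OP : Set Operation} {e : Pointer → List (Option Sym)} {h : Pointer}

theorem writes_translateAtPos_plain {s : Sym} (hs : s.isPlain = true) (m : List (Option Sym)) :
    Writes (Function.update e pos (some s :: m)) (translateAtPos h) [s] := by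
  cases s <;> first
    | simp [Sym.isPlain] at hs; done
    | simp [Writes, translateAtPos, LoopProg.eval, Sym.isInner]

theorem writes_translateAtPos_inner {s : Sym} (hs : s.isInner = true) (m : List (Option Sym)) :
    Writes (Function.update e pos (some s :: m)) (translateAtPos h) [] := by
  simp [Writes, translateAtPos, LoopProg.eval, hs]

theorem writes_translateAtPos_lpar (k : ℕ) {r : List (Option Sym)} (hr : Boundary r) :
    Writes (Function.update e pos (some .lpar :: ((natCode k).map some ++ r))) (translateAtPos h)
      (.lpar :: natCode k) := by
  have hc : Writes (Function.update e pos (some .lpar :: ((natCode k).map some ++ r)))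
      (copy pos Sym.isDigit) (natCode k) := by
    refine writes_copy ?_
    rw [Function.update_self, List.tail_cons]
    refine takeWhile_append_of_forall ?_ ?_
    · intro a ha
      obtain ⟨s, hs, rfl⟩ := List.mem_map.1 ha
      obtain ⟨b, -, rfl⟩ := List.mem_map.1 hs
      rfl
    · intro a ha
      have := hr a ha
      rcases a with - | s
      · rfl
      · cases s <;> simp_all [Sym.isInner, Sym.isDigit]
  have := (writes_say [.lpar]).append hc
  simpa [Writes, translateAtPos, LoopProg.eval, Sym.isInner] using this

theorem writes_translateAtPos_atom {α : LInt S} {t : Σ n, S.Val n} (hp : h ≠ pos)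
    (hh : BoxAt (e h) α) {m : List (Option Sym)} (hm : AtomAt m t) :
    Writes (Function.update e pos m) (translateAtPos h)
      (LProp.world (e input).tail.length α t).code := by
  have hw : Writes (Function.update e pos m) (world h pos)
      (LProp.world (e input).tail.length α t).code := by
    have := writes_world (e := Function.update e pos m) (h := h) (x := pos) (α := α) (t := t)
      (by simpa [hp]) (by simpa)
    simpa using this
  have hm := hm.1
  simpa [Writes, translateAtPos, LoopProg.eval, hm, Sym.isInner] using hw

/-- The translation of the parts that precede the next intervention. -/
theorem eval_translateFrom (x : Pointer) : (translateFrom h x).eval e =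
    suffixFlatMap (· != some .box) (fun m => (translateAtPos h).eval (Function.update e pos m))
      (e x).tail := rfl

/-- The word that is written while `box₁` points at `m`. -/
noncomputable def evalBox (e : Pointer → List (Option Sym)) (m : List (Option Sym)) :
    List (Option Sym) :=
  LoopProg.eval (.ite box₁ (· == some (some .box)) (.loop atom₁ box₁ (· != some .box)
    (.ite atom₁ (· == some none) (translateFrom box₁ atom₁) .skip)) .skip)
    (Function.update e box₁ m)

theorem evalBox_of_ne {a : Option Sym} (ha : a ≠ some .box) (m : List (Option Sym)) :
    evalBox e (a :: m) = [] := by simp [evalBox, LoopProg.eval, ha]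

/-- At an intervention, the parts from its separator to the next intervention are translated. -/
theorem evalBox_markedCode (α : LInt S) (β : LProp S) (l : List (Token S)) :
    ∃ e' : Pointer → List (Option Sym), e' input = e input ∧ BoxAt (e' box₁) α ∧
      evalBox e ((Token.box α β).markedCode ++ l.flatMap Token.markedCode) =
        suffixFlatMap (· != some .box)
          (fun m => (translateAtPos box₁).eval (Function.update e' pos m))
          (β.code.map some ++ l.flatMap Token.markedCode) := by
  set m := (Token.box α β).markedCode ++ l.flatMap Token.markedCode with hm
  let m' := none :: (β.code.map some ++ l.flatMap Token.markedCode)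
  refine ⟨Function.update (Function.update e box₁ m) atom₁ m', by simp, ?_, ?_⟩
  · simpa using boxAt_markedCode α β _
  have htail : m.tail = α.code.map some ++ m' := by simp [hm, m', Token.markedCode]
  have hhead : m.head? = some (some .box) := rfl
  simp only [evalBox, LoopProg.eval, Function.update_self, hhead, beq_self_eq_true, if_true, htail]
  have hnil : ∀ (s : Sym) (m' : List (Option Sym)), (if ((some s :: m').head? == some none) = true
      then (translateFrom box₁ atom₁).eval
        (Function.update (Function.update e box₁ m) atom₁ (some s :: m')) else []) = [] := by
    intro s m'
    rw [if_neg (by simp)]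
  rw [suffixFlatMap_append_of_nil (ne_box_of_box_notMem α.box_notMem_code)
    (fun a ha r => by obtain ⟨s, -, rfl⟩ := List.mem_map.1 ha; exact hnil s r)]
  rw [suffixFlatMap, if_pos (by decide), suffixFlatMap_append_of_nil
    (ne_box_of_box_notMem β.box_notMem_code)
    (fun a ha r => by obtain ⟨s, -, rfl⟩ := List.mem_map.1 ha; exact hnil s r),
    suffixFlatMap_tokens_of_nil hnil, List.append_nil]
  simp only [List.head?_cons, beq_self_eq_true, if_true, eval_translateFrom, Function.update_self]
  rfl

/-- The first part translates what precedes the next intervention, in the scope that is given by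
`e` and `h`; the second part translates the rest, in the scopes of the interventions that follow.
In a list of tokens assignments occur only after an intervention, so the scope `h` is arbitrary. -/
theorem eval_translation_tokens {L : ℕ} : ∀ (l : List (Token S))
    (e e₀ : Pointer → List (Option Sym)) (h : Pointer), (e input).tail.length = L →
    (e₀ input).tail.length = L →
    suffixFlatMap (· != some .box) (fun m => (translateAtPos h).eval (Function.update e pos m))
        (l.flatMap Token.markedCode) ++
      suffixFlatMap (fun _ => true) (evalBox e₀) (l.flatMap Token.markedCode) =
    (l.flatMap (Token.translation L)).map some := by
  intro l
  induction l with
  | nil => intros; rfl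
  | cons x l ih =>
    intro e e₀ h he he₀
    simp only [List.flatMap_cons, List.map_append]
    have hF : ∀ a ≠ some Sym.box, ∀ l, evalBox e₀ (a :: l) = [] := fun a ha l => evalBox_of_ne ha l
    cases x with
    | sym s hs =>
      have hbox : s ≠ .box := fun h => Token.box_notMem_sym hs (by simp [h])
      have h₁ := suffixFlatMap_append_of_box_notMem hF (Token.box_notMem_sym hs)
        (l.flatMap Token.markedCode)
      rw [← ih e e₀ h he he₀]
      simp only [List.map_cons, List.map_nil] at h₁
      simp only [Token.markedCode]
      rw [h₁, List.singleton_append, suffixFlatMap, if_pos (by simpa using hbox),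
        writes_translateAtPos_plain hs, List.append_assoc]
      rfl
    | lpar k =>
      have h₁ := suffixFlatMap_append_of_box_notMem hF (Token.box_notMem_lpar k)
        (l.flatMap Token.markedCode)
      rw [← ih e e₀ h he he₀]
      simp only [List.map_cons] at h₁
      simp only [Token.markedCode]
      rw [h₁, List.cons_append, suffixFlatMap, if_pos (by decide),
        writes_translateAtPos_lpar k (boundary_flatMap_markedCode l),
        suffixFlatMap_append_of_nil (m := (natCode k).map some), List.append_assoc]
      · rfl
      · refine ne_box_of_box_notMem fun h => ?_
        simpa [Sym.isInner] using isInner_of_mem_natCode h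
      · intro a ha r
        obtain ⟨s, hs, rfl⟩ := List.mem_map.1 ha
        exact writes_translateAtPos_inner (isInner_of_mem_natCode hs) r
    | box α β =>
      obtain ⟨e', he', hb, hG⟩ := evalBox_markedCode (e := e₀) α β l
      have hL : (e' input).tail.length = L := by rw [he', he₀]
      rw [suffixFlatMap_box hF, hG, ← β.flatMap_code_pieces,
        suffixFlatMap_pieces (o := fun s => [some s])
          (g := fun t => (LProp.world L α t).code.map some), ← ih e' e₀ box₁ hL he₀]
      · have h₁ : ∀ r, suffixFlatMap (· != some .box)
            (fun m => (translateAtPos h).eval (Function.update e pos m))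
            ((Token.box α β).markedCode ++ r) = [] := fun _ => rfl
        rw [h₁, List.nil_append, List.append_assoc]
        congr 1
        rw [Token.translation, LProp.code_relativize, List.map_flatMap]
        congr 1
        funext x
        cases x <;> rfl
      · intro s hs
        simpa using hs
      · exact fun s hs r => writes_translateAtPos_plain hs r
      · exact fun s hs r => writes_translateAtPos_inner hs r
      · intro t m hm
        have := writes_translateAtPos_atom (e := e') (by simp) hb hm
        rwa [hL] at this
      · exact boundary_flatMap_markedCode l

theorem writes_translation {l : List (Token S)}
    (hW : e input = none :: l.flatMap Token.markedCode) :
    Writes e translation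
      (l.flatMap (Token.translation (l.flatMap Token.markedCode).length)) := by
  have hL : (e input).tail.length = (l.flatMap Token.markedCode).length := by rw [hW]; rfl
  have hT : (e input).tail = l.flatMap Token.markedCode := by rw [hW]; rfl
  change suffixFlatMap _ _ (e input).tail ++ suffixFlatMap _ (evalBox e) (e input).tail = _
  rw [hT]
  exact eval_translation_tokens l e e input hL hL

theorem code_foldr_and [Encodable OP] (l : List (LProb S OP)) (ψ : LProb S OP) :
    LProb.code (l.foldr .and ψ) = (l.flatMap fun φ => .and :: LProb.code φ) ++ LProb.code ψ := by
  induction l with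
  | nil => rfl
  | cons φ l ih =>
    change Sym.and :: (LProb.code φ ++ LProb.code (l.foldr .and ψ)) = _
    rw [ih]
    simp

theorem writes_reduct [Encodable OP] {φ : LCausal S OP}
    (hW : e input = none :: mark false 0 (LCausal.code φ)) :
    Writes e reduct
      (LProb.code (CausalLogic.reduct (mark false 0 (LCausal.code φ)).length φ)) := by
  rw [← LCausal.flatMap_code_tokens, mark_flatMap_code] at hW ⊢
  have h₁ := writes_constantClauses (OP := OP) hW
  have h₂ := writes_translation hW
  have h₃ := writes_consistency hW
  rw [LCausal.flatMap_translation_tokens] at h₂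
  rw [LCausal.flatMap_atoms_tokens] at h₁ h₃
  rw [LCausal.flatMap_boxes_tokens] at h₃
  rw [CausalLogic.reduct, code_foldr_and]
  exact h₁.append ((writes_say [.and]).append (h₂.append ((writes_say [.ge, .prob]).append
    (h₃.append (writes_say (.prob :: tautCode))))))

end Prog

/-- The index of a variable that is mentioned has fewer digits than the input has letters. -/
theorem length_bits_le_of_mem_atoms {S : Signature} {OP : Set Operation} [Encodable OP]
    {φ : LCausal S OP} {t : Σ n, S.Val n} (ht : t ∈ φ.atoms) :
    (Nat.bits t.1).length ≤ (mark false 0 (LCausal.code φ)).length := by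
  rw [← LCausal.flatMap_code_tokens, mark_flatMap_code]
  rw [← LCausal.flatMap_atoms_tokens, List.mem_flatMap] at ht
  obtain ⟨x, hx, ht⟩ := ht
  have hlen : ∀ (l : List (Piece S)), t ∈ l.flatMap (Piece.out (fun _ => []) fun t => [t]) →
      (Nat.bits t.1).length ≤ (l.flatMap Piece.code).length := by
    intro l hl
    obtain ⟨y, hy, ht⟩ := List.mem_flatMap.1 hl
    cases y with
    | sym s hs => simp [Piece.out] at ht
    | atom t' =>
      obtain rfl := List.mem_singleton.1 ht
      refine le_trans ?_ (List.sublist_flatten_of_mem (List.mem_map_of_mem hy)).length_le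
      simp [Piece.code, eqCode, natCode]
      omega
  refine le_trans ?_ (List.sublist_flatten_of_mem (List.mem_map_of_mem hx)).length_le
  cases x with
  | sym s hs => simp [Token.atoms] at ht
  | lpar k => simp [Token.atoms] at ht
  | box α β =>
    have hα := hlen α.pieces
    have hβ := hlen β.pieces
    rw [α.flatMap_out_pieces, α.flatMap_code_pieces, List.flatMap_singleton'] at hα
    rw [β.flatMap_out_pieces, β.flatMap_code_pieces, List.flatMap_singleton'] at hβ
    simp only [Token.markedCode, List.length_cons, List.length_append, List.length_map]
    obtain h | h := List.mem_append.1 ht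
    · have := hα h
      omega
    · have := hβ h
      omega

/-- The machine of the program puts out the reduced formula. -/
theorem stk_run_machine_reduct {S : Signature} {OP : Set Operation} [Encodable OP]
    (φ : LCausal S OP) (bs : List Bool)
    (hbs : ((machine Prog.reduct .input).run (LCausal.code φ) bs).l = none) :
    ((machine Prog.reduct .input).run (LCausal.code φ) bs).stk
        (machine Prog.reduct .input).outputStack =
      (LProb.code (reduct (mark false 0 (LCausal.code φ)).length φ)).map
        (machine Prog.reduct .input).letter :=
  (stk_run_machine _ _ Prog.wellFormed_reduct _ bs hbs).trans
    (Prog.writes_reduct (Function.update_self _ _ _))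

end CausalLogic

theorem mainTheorem2 (S : CausalLogic.Signature) (OP : Set CausalLogic.Operation)
    [Encodable OP] :
    CausalLogic.NPReducible
      (CausalLogic.LCausal.code (S := S) (OP := OP)) CausalLogic.SATCausal
      (CausalLogic.LProb.code (S := S) (OP := OP)) CausalLogic.SATProb := by
  refine ⟨CausalLogic.machine CausalLogic.Prog.reduct .input,
    CausalLogic.machineTime CausalLogic.Prog.reduct, fun φ => ?_⟩
  have hhalt := CausalLogic.haltsWithin_machine _ _ CausalLogic.Prog.wellFormed_reduct
    (CausalLogic.LCausal.code φ)
  have hout := CausalLogic.stk_run_machine_reduct φ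
  refine ⟨hhalt, fun bs hbs => ⟨_, hout bs hbs⟩, ?_⟩
  rw [CausalLogic.satCausal_iff_satProb_reduct
    fun t ht => CausalLogic.length_bits_le_of_mem_atoms ht]
  constructor
  · intro h
    have hbs := hhalt _ (List.length_replicate (a := true))
    exact ⟨_, ⟨_, hbs, hout _ hbs⟩, h⟩
  · rintro ⟨ψ, ⟨bs, hbs, hψ⟩, h⟩
    have := List.map_injective_iff.2 (Function.Embedding.injective _)
      ((hout bs hbs).symm.trans hψ)
    rwa [CausalLogic.LProb.code_injective this]
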